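/- Write $e(x) = e^{2\pi i x}$ for real $x$. There is an absolute constant $C > 0$ such that the following holds. Let $p$ be a prime, let $a$ be an integer with $a \not\equiv 0 \pmod p$, and let $M, N$ be positive integers with $N \le p$. Then $$\left| \sum_{n=M}^{M+N} e\left( \frac{a n^p}{p^2} \right) \right| \le C\, p^{11/18} N^{1/4} (\log p)^{1/6}.$$ In particular, there is an absolute constant $C' > 0$ such that, for every prime $p$ and every integer $a \not\equiv 0 \pmod p$, the complete Heilbronn sum $$S(a) = \sum_{n=1}^{p} e\left( \frac{a n^p}{p^2} \right)$$ satisfies $$|S(a)| \le C'\, p^{31/36} (\log p)^{1/6}.$$ -/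

import Mathlib

namespace Heilbronn

/-- The standard additive character `e(x) = exp(2πix)` of the reals. -/
noncomputable def e (x : ℝ) : ℂ := Complex.exp (2 * Real.pi * Complex.I * (x : ℂ))

/-- The incomplete Heilbronn sum `∑ e(a n ^ p / p ^ 2)` over `M ≤ n ≤ M + N`, both ends included. -/
noncomputable def incompleteSum (p : ℕ) (a : ℤ) (M N : ℕ) : ℂ :=
  ∑ n ∈ Finset.Icc M (M + N), e ((a : ℝ) * (n : ℝ) ^ p / (p : ℝ) ^ 2)

/-- The complete Heilbronn sum `S(a) = ∑ e(a n ^ p / p ^ 2)` over `1 ≤ n ≤ p`. -/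
noncomputable def completeSum (p : ℕ) (a : ℤ) : ℂ :=
  ∑ n ∈ Finset.Icc 1 p, e ((a : ℝ) * (n : ℝ) ^ p / (p : ℝ) ^ 2)

end Heilbronn

open Polynomial

/-! The `p`-th powers prime to `p` form a multiplicative group modulo `p^2`, the lifts `teich u`
with `u ≠ 0`. The exponential sum `powerSum` over this group at the frequency `a + p b` is the
`b`-th Fourier coefficient on `ℤ/p` of the Heilbronn summand (`fourierSum_heilbronnTerm`). Interval
sums are thus governed by the size and the moments of these coefficients.

Arithmetic input: for odd `p`, `s^p - (s-1)^p = 1 - p f(s)` modulo `p^2`, where `f` is the truncated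
logarithm, so additive relations between `p`-th powers become equations `f(s) + d s = y` over `𝔽_p`.
The identity `(1 - X) f' = 1 - X^(p-1)` makes `f` accessible to Stepanov's method
(`mul_card_curvePoints_le`): at most `O(p^2 / τ^3)` values `y` are attained `τ` times, and the third
moment of the counting function is `O(p^2 log p)` (`sum_lineCount_pow_three_le`).

This is used twice. Two applications of Cauchy–Schwarz turn the third moment into the uniform bound
`p^(5/6) (log p)^(1/6)` for `powerSum` (`norm_powerSum_pow_six_le`). Combined with an elementary
incidence bound (`sum_mul_lineCount_le`), it also bounds the additive energy of a union of `h`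
dilates of the group, hence the fourth moment of combinations of `h` consecutive Fourier
coefficients by `p^(7/2) h^(7/2) (log p)^(1/2)` (`sum_norm_shifted_pow_four_le`).

On an interval of length `L ≤ p/16`, smoothing with `h ≈ p/L` frequencies and Hölder give `L^(3/8)
p^(1/2) (log p)^(1/8)`. On a longer interval, averaging over `R` shifts and the uniform bound give
`p^(5/6) (L/R)^(1/4) (log p)^(1/6)`, up to edge sums of length at most `R`. With `R ≈ p^(8/9)` every
contribution is at most of order `p^(11/18) L^(1/4) (log p)^(1/6)`. -/

/-- The truncated logarithm `∑ X ^ k / k` over `1 ≤ k ≤ p - 1`. -/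
noncomputable def truncLog (p : ℕ) : (ZMod p)[X] :=
  ∑ k ∈ Finset.range (p - 1), C (((k + 1 : ℕ) : ZMod p)⁻¹) * X ^ (k + 1)

lemma natDegree_truncLog_le (p : ℕ) : (truncLog p).natDegree ≤ p - 1 := by
  unfold truncLog
  refine natDegree_sum_le_of_forall_le _ _ fun k hk => ?_
  refine (natDegree_C_mul_X_pow_le _ _).trans ?_
  have := Finset.mem_range.1 hk
  omega

/-! ### Independence of powers of `1 - X`, of the truncated logarithm and of `X^p`. -/

section TruncLog

variable {p : ℕ} [Fact p.Prime]

lemma natCast_ne_zero_of_lt {k : ℕ} (hk : 0 < k) (hkp : k < p) : (k : ZMod p) ≠ 0 := by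
  rw [Ne, ZMod.natCast_eq_zero_iff]
  exact Nat.not_dvd_of_pos_of_lt hk hkp

lemma derivative_truncLog : derivative (truncLog p) = ∑ k ∈ Finset.range (p - 1), X ^ k := by
  unfold truncLog
  rw [derivative_sum]
  refine Finset.sum_congr rfl fun k hk => ?_
  have hk' : ((k + 1 : ℕ) : ZMod p) ≠ 0 :=
    natCast_ne_zero_of_lt (Nat.succ_pos k) (by have := Finset.mem_range.1 hk; omega)
  rw [derivative_C_mul, derivative_X_pow, Nat.add_sub_cancel, ← mul_assoc, ← C_mul,
    inv_mul_cancel₀ hk', C_1, one_mul]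

/-- Modulo `X^(p-1)` this is the differential equation of `-log(1 - X)`. It is the only property of
`truncLog` that Stepanov's method uses besides its degree. -/
lemma one_sub_X_mul_derivative_truncLog :
    (1 - X) * derivative (truncLog p) = 1 - X ^ (p - 1) := by
  rw [derivative_truncLog, mul_comm]
  have := geom_sum_mul_neg (X : (ZMod p)[X]) (p - 1)
  exact this

lemma one_sub_X_mul_derivative_pow (a : ℕ) :
    (1 - X) * derivative ((1 - X : (ZMod p)[X]) ^ a) = -(a : (ZMod p)[X]) * (1 - X) ^ a := by
  rcases a with _ | a
  · simp
  · rw [derivative_pow_succ]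
    simp only [derivative_sub, derivative_one, derivative_X, zero_sub]
    push_cast [pow_succ]
    simp only [map_add, map_natCast, map_one]
    ring

/-- The functions `(1 - X) ^ a * f ^ b`, where `f` is the truncated logarithm, satisfy no linear
relation modulo a power of `X` whose exponent is at least their number. -/
lemma eq_zero_of_X_pow_dvd_sum (n : ℕ) : ∀ (A : Finset ℕ) (Q : ℕ → (ZMod p)[X]) (k : ℕ),
    (∀ a ∈ A, a < p) → (∀ a ∈ A, (Q a).natDegree < p) →
    ∑ a ∈ A, (if Q a = 0 then 0 else (Q a).natDegree + 1) ≤ n → n ≤ k → k ≤ p →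
    X ^ k ∣ ∑ a ∈ A, (1 - X) ^ a * (Q a).comp (truncLog p) → ∀ a ∈ A, Q a = 0 := by
  induction n with
  | zero =>
    intro A Q k _ _ hw _ _ _ a ha
    have h := (Finset.sum_eq_zero_iff.1 (Nat.le_zero.1 hw)) a ha
    by_contra hne
    simp [hne] at h
  | succ n ih =>
    intro A Q k hA hQ hw hnk hkp hdvd
    by_cases hall : ∀ a ∈ A, Q a = 0
    · exact hall
    push Not at hall
    obtain ⟨a0, ha0, hne0⟩ := hall
    exfalso
    -- The operator `(1 - X) d/dX + a0` sends `(1 - X)^a Q(f)` to `(1 - X)^a Q'(f)` modulo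
    -- `X^(p-1)`. It lowers the weight at `a0`, raises none, and costs one power of `X`, so the
    -- induction on the weight applies to `Q'`.
    set Q' : ℕ → (ZMod p)[X] := fun a => C ((a0 : ZMod p) - (a : ZMod p)) * Q a + derivative (Q a)
      with hQ'
    have hdeg : ∀ a, (Q' a).natDegree ≤ (Q a).natDegree := by
      intro a
      refine (natDegree_add_le _ _).trans (max_le (natDegree_C_mul_le _ _) ?_)
      exact (natDegree_derivative_le _).trans (Nat.sub_le _ _)
    have hw' : ∑ a ∈ A, (if Q' a = 0 then 0 else (Q' a).natDegree + 1) ≤ n := by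
      have hlt : ∑ a ∈ A, (if Q' a = 0 then 0 else (Q' a).natDegree + 1) <
          ∑ a ∈ A, (if Q a = 0 then 0 else (Q a).natDegree + 1) := by
        refine Finset.sum_lt_sum (fun a _ => ?_) ⟨a0, ha0, ?_⟩
        · by_cases h0 : Q a = 0
          · simp [hQ', h0]
          · rw [if_neg h0]
            split_ifs
            · omega
            · have := hdeg a; omega
        · rw [if_neg hne0]
          have hQ0 : Q' a0 = derivative (Q a0) := by simp [hQ']
          rw [hQ0]
          split_ifs with h
          · omega
          · have h1 : (Q a0).natDegree ≠ 0 := by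
              intro h0
              exact h (derivative_of_natDegree_zero h0)
            have := natDegree_derivative_lt h1
            omega
      omega
    have hder : X ^ (k - 1) ∣ ∑ a ∈ A, (1 - X) ^ a * (Q' a).comp (truncLog p) := by
      set P : (ZMod p)[X] := ∑ a ∈ A, (1 - X) ^ a * (Q a).comp (truncLog p) with hP
      have h1 : X ^ (k - 1) ∣ derivative P := pow_sub_one_dvd_derivative_of_pow_dvd hdvd
      have h2 : X ^ (k - 1) ∣ P := (pow_dvd_pow X (Nat.sub_le k 1)).trans hdvd
      have h3 : (X : (ZMod p)[X]) ^ (k - 1) ∣ X ^ (p - 1) := pow_dvd_pow X (by omega)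
      have hid : ∑ a ∈ A, (1 - X) ^ a * (Q' a).comp (truncLog p) =
          (1 - X) * derivative P + C (a0 : ZMod p) * P +
            X ^ (p - 1) * ∑ a ∈ A, (1 - X) ^ a * (derivative (Q a)).comp (truncLog p) := by
        rw [hP, derivative_sum, Finset.mul_sum, Finset.mul_sum, Finset.mul_sum,
          ← Finset.sum_add_distrib, ← Finset.sum_add_distrib]
        refine Finset.sum_congr rfl fun a _ => ?_
        rw [derivative_mul, derivative_comp]
        have e1 := one_sub_X_mul_derivative_pow (p := p) a
        have e2 := one_sub_X_mul_derivative_truncLog (p := p)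
        simp only [hQ', add_comp, Polynomial.mul_comp, C_comp]
        have e3 : C ((a0 : ZMod p) - (a : ZMod p)) = C (a0 : ZMod p) - (a : (ZMod p)[X]) := by
          simp
        rw [e3]
        linear_combination (-(Q a).comp (truncLog p)) * e1 -
          (1 - X) ^ a * (derivative (Q a)).comp (truncLog p) * e2
      rw [hid]
      exact dvd_add (dvd_add (dvd_mul_of_dvd_right h1 _) (dvd_mul_of_dvd_right h2 _))
        (dvd_mul_of_dvd_left h3 _)
    have hz := ih A Q' (k - 1) hA (fun a ha => (hdeg a).trans_lt (hQ a ha)) hw' (by omega)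
      (by omega) hder
    -- For `a ≠ a0` the equation `Q' a = 0` equates a nonzero multiple of `Q a` with a derivative of
    -- it, which has smaller degree.
    have hother : ∀ a ∈ A, a ≠ a0 → Q a = 0 := by
      intro a ha hne
      by_contra hq
      have h1 := hz a ha
      have h2 : C ((a0 : ZMod p) - (a : ZMod p)) * Q a = -derivative (Q a) := by
        simp only [hQ'] at h1
        exact eq_neg_of_add_eq_zero_left h1
      have hc : (a0 : ZMod p) - (a : ZMod p) ≠ 0 := by
        intro h0
        have h3 : (a0 : ZMod p) = (a : ZMod p) := sub_eq_zero.1 h0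
        rw [ZMod.natCast_eq_natCast_iff] at h3
        exact hne (Nat.ModEq.eq_of_lt_of_lt h3 (hA a0 ha0) (hA a ha)).symm
      have h4 : (C ((a0 : ZMod p) - (a : ZMod p)) * Q a).degree = (Q a).degree := by
        rw [degree_mul, degree_C hc, zero_add]
      have h5 := degree_derivative_lt hq
      rw [h2, degree_neg] at h4
      exact h5.ne h4
    have hder0 : derivative (Q a0) = 0 := by
      have := hz a0 ha0
      simpa [hQ'] using this
    -- In characteristic `p` a vanishing derivative forces a constant only because the degree is
    -- below `p`.
    have hconst : Q a0 = C ((Q a0).coeff 0) := by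
      ext m
      rw [coeff_C]
      split_ifs with hm
      · rw [hm]
      · obtain ⟨m, rfl⟩ := Nat.exists_eq_succ_of_ne_zero hm
        by_cases hlt : m.succ < p
        · have h1 : (derivative (Q a0)).coeff m = 0 := by rw [hder0, coeff_zero]
          rw [coeff_derivative] at h1
          rcases mul_eq_zero.1 h1 with h | h
          · exact h
          · exact absurd (by exact_mod_cast h) (natCast_ne_zero_of_lt (Nat.succ_pos m) hlt)
        · exact coeff_eq_zero_of_natDegree_lt (lt_of_lt_of_le (hQ a0 ha0) (not_lt.1 hlt))
    have hsum : ∑ a ∈ A, (1 - X) ^ a * (Q a).comp (truncLog p) =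
        (1 - X) ^ a0 * C ((Q a0).coeff 0) := by
      rw [Finset.sum_eq_single_of_mem a0 ha0]
      · rw [hconst]; simp
      · intro a ha hne
        rw [hother a ha hne]; simp
    rw [hsum] at hdvd
    have hX : X ∣ (1 - X) ^ a0 * C ((Q a0).coeff 0) := (dvd_pow_self X (by omega)).trans hdvd
    rw [X_dvd_iff, coeff_zero_eq_eval_zero] at hX
    simp only [eval_mul, eval_pow, eval_sub, eval_one, eval_X, sub_zero, one_pow, one_mul,
      eval_C] at hX
    exact hne0 (by rw [hconst, hX, C_0])

/-- A nonzero combination of the `(1 - X) ^ a * f ^ b` with `a < A`, `b < B`, `A * B ≤ p` is not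
divisible by `X ^ p`. -/
lemma coeff_eq_zero_of_X_pow_dvd {A B : ℕ} (hA : 0 < A) (hB : 0 < B) (hAB : A * B ≤ p)
    (c : ℕ → ℕ → ZMod p)
    (h : X ^ p ∣ ∑ a ∈ Finset.range A, ∑ b ∈ Finset.range B,
      C (c a b) * ((1 - X) ^ a * truncLog p ^ b)) :
    ∀ a < A, ∀ b < B, c a b = 0 := by
  set Q : ℕ → (ZMod p)[X] := fun a => ∑ b ∈ Finset.range B, C (c a b) * X ^ b with hQ
  have hcoeff : ∀ a, ∀ b < B, (Q a).coeff b = c a b := by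
    intro a b hb
    simp only [hQ, finsetSum_coeff, coeff_C_mul, coeff_X_pow]
    simp [hb]
  have hdeg : ∀ a, (Q a).natDegree ≤ B - 1 := by
    intro a
    refine natDegree_sum_le_of_forall_le _ _ fun b hb => ?_
    refine (natDegree_C_mul_X_pow_le _ _).trans ?_
    have := Finset.mem_range.1 hb
    omega
  have hBp : B ≤ p := (Nat.le_mul_of_pos_left B hA).trans hAB
  have hAp : A ≤ p := (Nat.le_mul_of_pos_right A hB).trans hAB
  have key := eq_zero_of_X_pow_dvd_sum (p := p) (A * B) (Finset.range A) Q p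
    (fun a ha => (Finset.mem_range.1 ha).trans_le hAp)
    (fun a _ => by have := hdeg a; omega)
    (by
      refine (Finset.sum_le_card_nsmul _ _ B fun a _ => ?_).trans (by simp)
      split_ifs
      · exact Nat.zero_le _
      · have := hdeg a; omega) hAB le_rfl
    (by
      convert h using 2 with a _
      simp only [hQ, Polynomial.sum_comp, Polynomial.mul_comp, C_comp, X_pow_comp, Finset.mul_sum]
      refine Finset.sum_congr rfl fun b _ => ?_
      ring)
  intro a ha b hb
  rw [← hcoeff a b hb, key a (Finset.mem_range.2 ha), coeff_zero]

/-- The products `(1 - X) ^ a * f ^ b * X ^ (p * c)` with `a < A`, `b < B`, `A * B ≤ p` are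
linearly independent. -/
lemma coeff_eq_zero_of_sum_eq_zero {A B : ℕ} (hA : 0 < A) (hB : 0 < B) (hAB : A * B ≤ p)
    (K : ℕ) : ∀ c : ℕ → ℕ → ℕ → ZMod p,
    (∑ k ∈ Finset.range K, (∑ a ∈ Finset.range A, ∑ b ∈ Finset.range B,
      C (c a b k) * ((1 - X) ^ a * truncLog p ^ b)) * X ^ (p * k) = 0) →
    ∀ k < K, ∀ a < A, ∀ b < B, c a b k = 0 := by
  induction K with
  | zero => intro c _ k hk; omega
  | succ K ih =>
    intro c h
    rw [Finset.sum_range_succ'] at h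
    have hfac : ∑ k ∈ Finset.range K, (∑ a ∈ Finset.range A, ∑ b ∈ Finset.range B,
        C (c a b (k + 1)) * ((1 - X) ^ a * truncLog p ^ b)) * X ^ (p * (k + 1)) =
        X ^ p * ∑ k ∈ Finset.range K, (∑ a ∈ Finset.range A, ∑ b ∈ Finset.range B,
        C (c a b (k + 1)) * ((1 - X) ^ a * truncLog p ^ b)) * X ^ (p * k) := by
      rw [Finset.mul_sum]
      refine Finset.sum_congr rfl fun k _ => ?_
      rw [Nat.mul_succ, pow_add]
      ring
    rw [hfac, mul_zero, pow_zero, mul_one] at h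
    -- Reduction modulo `X^p` isolates the terms with `k = 0`. Once they vanish, `X^p` is cancelled
    -- and the induction continues.
    have h0 : ∀ a < A, ∀ b < B, c a b 0 = 0 := by
      refine coeff_eq_zero_of_X_pow_dvd hA hB hAB (fun a b => c a b 0) ?_
      rw [← neg_eq_of_add_eq_zero_right h]
      exact (dvd_mul_right _ _).neg_right
    have hz : ∑ a ∈ Finset.range A, ∑ b ∈ Finset.range B,
        C (c a b 0) * ((1 - X) ^ a * truncLog p ^ b) = 0 := by
      refine Finset.sum_eq_zero fun a ha => Finset.sum_eq_zero fun b hb => ?_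
      rw [h0 a (Finset.mem_range.1 ha) b (Finset.mem_range.1 hb), C_0, zero_mul]
    rw [hz, add_zero] at h
    have h' := (mul_eq_zero.1 h).resolve_left (pow_ne_zero _ X_ne_zero)
    intro k hk a ha b hb
    rcases k with _ | k
    · exact h0 a ha b hb
    · exact ih (fun a b k => c a b (k + 1)) h' k (by omega) a ha b hb

end TruncLog

/-! ### A derivation detecting multiple zeros, and its lift to three variables. -/

section Stepanov

variable {p : ℕ} [Fact p.Prime]

/-- The operator `X * (1 - X) * d/dX` on polynomials. -/
noncomputable def eulerOp (P : (ZMod p)[X]) : (ZMod p)[X] := X * (1 - X) * derivative P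

/-- Each application of the operator removes one factor `X - s` and contributes its multiplicity
times `s(1 - s)`. Every term keeping an extra factor dies at `s`. -/
lemma eulerOp_iterate_eval (s : ZMod p) (m : ℕ) : ∀ U : (ZMod p)[X],
    (eulerOp^[m] ((X - C s) ^ m * U)).eval s = m.factorial * (s * (1 - s)) ^ m * U.eval s := by
  induction m with
  | zero => intro U; simp
  | succ m ih =>
    intro U
    have h : eulerOp ((X - C s) ^ (m + 1) * U) = (X - C s) ^ m *
        (((m + 1 : ℕ) : (ZMod p)[X]) * (X * (1 - X) * U) + (X - C s) * eulerOp U) := by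
      unfold eulerOp
      rw [derivative_mul, derivative_X_sub_C_pow]
      push_cast [pow_succ]
      simp only [map_add, map_natCast, map_one]
      ring
    rw [Function.iterate_succ_apply, h, ih]
    simp only [eval_add, eval_mul, eval_natCast, eval_X, eval_sub, eval_one, eval_C, sub_self,
      zero_mul, add_zero, Nat.factorial_succ]
    push_cast
    ring

/-- Vanishing of the iterates of `X * (1 - X) * d/dX` at `s ≠ 0, 1` forces a multiple zero. -/
lemma X_sub_C_pow_dvd_of_eulerOp {P : (ZMod p)[X]} {s : ZMod p} (hs0 : s ≠ 0) (hs1 : s ≠ 1)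
    (D : ℕ) (hD : D ≤ p) (h : ∀ n < D, (eulerOp^[n] P).eval s = 0) : (X - C s) ^ D ∣ P := by
  induction D with
  | zero => simp
  | succ D ih =>
    obtain ⟨U, hU⟩ := ih (by omega) fun n hn => h n (by omega)
    have h1 := h D (by omega)
    rw [hU, eulerOp_iterate_eval] at h1
    have hf : (D.factorial : ZMod p) ≠ 0 := by
      rw [Ne, ZMod.natCast_eq_zero_iff, (Fact.out : p.Prime).dvd_factorial]
      omega
    have hU0 : U.eval s = 0 := by
      refine (mul_eq_zero.1 h1).resolve_left (mul_ne_zero hf (pow_ne_zero _ (mul_ne_zero hs0 ?_)))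
      exact sub_ne_zero.2 hs1.symm
    obtain ⟨V, hV⟩ := dvd_iff_isRoot.2 hU0
    exact ⟨V, by rw [hU, hV, pow_succ]; ring⟩

/-- The derivation of `𝔽_p[x, y, z]` lifting `X * (1 - X) * d/dX` under
`x ↦ X`, `y ↦ truncLog p`, `z ↦ X ^ p`. -/
noncomputable def liftedOp (p : ℕ) :
    Derivation (ZMod p) (MvPolynomial (Fin 3) (ZMod p)) (MvPolynomial (Fin 3) (ZMod p)) :=
  MvPolynomial.mkDerivation (ZMod p)
    ![MvPolynomial.X 0 * (1 - MvPolynomial.X 0), MvPolynomial.X 0 - MvPolynomial.X 2, 0]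

/-- Both sides are derivations along the substitution, so the generators suffice. There `X(1 - X) f'
= X - X^p` is again a polynomial in the generators, and `X^p` is a constant of the derivation. -/
lemma aeval_liftedOp (Q : MvPolynomial (Fin 3) (ZMod p)) :
    MvPolynomial.aeval ![X, truncLog p, X ^ p] (liftedOp p Q) =
      eulerOp (MvPolynomial.aeval ![X, truncLog p, X ^ p] Q) := by
  induction Q using MvPolynomial.induction_on with
  | C a =>
    simp [eulerOp]
  | add P Q hP hQ =>
    simp only [map_add, hP, hQ, eulerOp, mul_add]
  | mul_X P i hP =>
    have hX : MvPolynomial.aeval ![X, truncLog p, X ^ p] (liftedOp p (MvPolynomial.X i)) =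
        eulerOp (![X, truncLog p, X ^ p] i) := by
      unfold liftedOp eulerOp
      rw [MvPolynomial.mkDerivation_X]
      fin_cases i
      · simp
      · simp only [Fin.mk_one, Matrix.cons_val_one, Matrix.cons_val_zero, map_sub,
          MvPolynomial.aeval_X, Matrix.cons_val]
        rw [mul_assoc, one_sub_X_mul_derivative_truncLog, mul_sub, mul_one, ← pow_succ',
          Nat.sub_add_cancel (Fact.out : p.Prime).one_le]
      · simp [derivative_X_pow]
    simp only [Derivation.leibniz, smul_eq_mul, map_add, map_mul, hX, hP, MvPolynomial.aeval_X]
    simp only [eulerOp, derivative_mul]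
    ring

lemma aeval_liftedOp_iterate (n : ℕ) (Q : MvPolynomial (Fin 3) (ZMod p)) :
    MvPolynomial.aeval ![X, truncLog p, X ^ p] (((liftedOp p).toLinearMap ^ n) Q) =
      eulerOp^[n] (MvPolynomial.aeval ![X, truncLog p, X ^ p] Q) := by
  induction n with
  | zero => simp
  | succ n ih =>
    rw [pow_succ', Module.End.mul_apply, Function.iterate_succ_apply', ← ih]
    exact aeval_liftedOp _

lemma totalDegree_liftedOp_le (Q : MvPolynomial (Fin 3) (ZMod p)) :
    (liftedOp p Q).totalDegree ≤ Q.totalDegree + 2 := by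
  have hgen : ∀ i, (![MvPolynomial.X 0 * (1 - MvPolynomial.X 0),
      MvPolynomial.X 0 - MvPolynomial.X 2, 0] i :
      MvPolynomial (Fin 3) (ZMod p)).totalDegree ≤ 2 := by
    intro i
    fin_cases i
    · refine (MvPolynomial.totalDegree_mul _ _).trans ?_
      have h1 : (1 - MvPolynomial.X 0 : MvPolynomial (Fin 3) (ZMod p)).totalDegree ≤ 1 :=
        (MvPolynomial.totalDegree_sub _ _).trans (by simp)
      have h2 : (MvPolynomial.X 0 : MvPolynomial (Fin 3) (ZMod p)).totalDegree = 1 :=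
        MvPolynomial.totalDegree_X _
      omega
    · exact (MvPolynomial.totalDegree_sub _ _).trans (by simp)
    · simp
  rw [MvPolynomial.as_sum Q, map_sum]
  rw [← MvPolynomial.as_sum Q]
  refine MvPolynomial.totalDegree_finsetSum_le fun s hs => ?_
  unfold liftedOp
  rw [MvPolynomial.mkDerivation_monomial]
  refine (MvPolynomial.totalDegree_smul_le _ _).trans ?_
  refine MvPolynomial.totalDegree_finsetSum_le fun i _ => ?_
  simp only [smul_eq_mul]
  refine (MvPolynomial.totalDegree_mul _ _).trans (add_le_add ?_ (hgen i))
  refine (MvPolynomial.totalDegree_monomial_le _ _).trans ?_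
  refine le_trans ?_ (MvPolynomial.le_totalDegree hs)
  exact Finsupp.degree_mono tsub_le_self

lemma totalDegree_liftedOp_iterate_le (n : ℕ) (Q : MvPolynomial (Fin 3) (ZMod p)) :
    (((liftedOp p).toLinearMap ^ n) Q).totalDegree ≤ Q.totalDegree + 2 * n := by
  induction n with
  | zero => simp
  | succ n ih =>
    rw [pow_succ', Module.End.mul_apply]
    have := totalDegree_liftedOp_le (((liftedOp p).toLinearMap ^ n) Q)
    refine this.trans ?_
    omega

end Stepanov

/-! ### The auxiliary polynomial and the count of points on parallel lines. -/

section StepanovBound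

variable {p : ℕ} [Fact p.Prime]

/-- The points `s ≠ 0, 1` of `𝔽_p` with `truncLog s + d s ∈ Y`. -/
noncomputable def curvePoints (p : ℕ) [Fact p.Prime] (d : ZMod p) (Y : Finset (ZMod p)) :
    Finset (ZMod p) :=
  Finset.univ.filter fun s => s ≠ 0 ∧ s ≠ 1 ∧ (truncLog p).eval s + d * s ∈ Y

/-- The generic auxiliary polynomial of Stepanov's method. -/
noncomputable def auxPoly (p A B : ℕ) :
    (Fin A × Fin B × Fin B → ZMod p) →ₗ[ZMod p] MvPolynomial (Fin 3) (ZMod p) :=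
  Fintype.linearCombination (ZMod p) fun i =>
    (1 - MvPolynomial.X 0) ^ (i.1 : ℕ) * MvPolynomial.X 1 ^ (i.2.1 : ℕ) *
      MvPolynomial.X 2 ^ (i.2.2 : ℕ)

lemma totalDegree_auxPoly_le {A B : ℕ} (c : Fin A × Fin B × Fin B → ZMod p) :
    (auxPoly p A B c).totalDegree ≤ (A - 1) + (B - 1) + (B - 1) := by
  unfold auxPoly
  rw [Fintype.linearCombination_apply]
  refine MvPolynomial.totalDegree_finsetSum_le fun i _ => ?_
  refine (MvPolynomial.totalDegree_smul_le _ _).trans ?_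
  have h1 : (1 - MvPolynomial.X 0 : MvPolynomial (Fin 3) (ZMod p)).totalDegree ≤ 1 :=
    (MvPolynomial.totalDegree_sub _ _).trans (by simp)
  have ha := i.1.2
  have hb := i.2.1.2
  have hk := i.2.2.2
  have e1 := MvPolynomial.totalDegree_pow (1 - MvPolynomial.X 0 : MvPolynomial (Fin 3) (ZMod p))
    (i.1 : ℕ)
  have e2 := MvPolynomial.totalDegree_X_pow (R := ZMod p) (1 : Fin 3) (i.2.1 : ℕ)
  have e3 := MvPolynomial.totalDegree_X_pow (R := ZMod p) (2 : Fin 3) (i.2.2 : ℕ)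
  have e4 := MvPolynomial.totalDegree_mul ((1 - MvPolynomial.X 0 :
    MvPolynomial (Fin 3) (ZMod p)) ^ (i.1 : ℕ)) (MvPolynomial.X 1 ^ (i.2.1 : ℕ))
  have e5 := MvPolynomial.totalDegree_mul ((1 - MvPolynomial.X 0 :
    MvPolynomial (Fin 3) (ZMod p)) ^ (i.1 : ℕ) * (MvPolynomial.X 1 ^ (i.2.1 : ℕ)))
    (MvPolynomial.X 2 ^ (i.2.2 : ℕ))
  have e6 : (i.1 : ℕ) * (1 - MvPolynomial.X 0 : MvPolynomial (Fin 3) (ZMod p)).totalDegree ≤ i.1 :=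
    by nlinarith
  omega

lemma aeval_auxPoly {A B : ℕ} (c : Fin A × Fin B × Fin B → ZMod p) :
    MvPolynomial.aeval ![X, truncLog p, X ^ p] (auxPoly p A B c) =
      ∑ i, C (c i) * ((1 - X) ^ (i.1 : ℕ) * truncLog p ^ (i.2.1 : ℕ) *
        X ^ (p * (i.2.2 : ℕ))) := by
  unfold auxPoly
  rw [Fintype.linearCombination_apply, map_sum]
  refine Finset.sum_congr rfl fun i _ => ?_
  simp [Polynomial.smul_eq_C_mul, pow_mul]

/-- Distinct coefficient vectors give distinct polynomials, by the independence above. This is where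
`A * B ≤ p` enters. -/
lemma aeval_auxPoly_ne_zero {A B : ℕ} (hA : 0 < A) (hB : 0 < B) (hAB : A * B ≤ p)
    {c : Fin A × Fin B × Fin B → ZMod p} (hc : c ≠ 0) :
    MvPolynomial.aeval ![X, truncLog p, X ^ p] (auxPoly p A B c) ≠ 0 := by
  intro h
  apply hc
  rw [aeval_auxPoly] at h
  set c' : ℕ → ℕ → ℕ → ZMod p := fun a b k =>
    if h : a < A ∧ b < B ∧ k < B then c (⟨a, h.1⟩, ⟨b, h.2.1⟩, ⟨k, h.2.2⟩) else 0 with hc'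
  have hval : ∀ i : Fin A × Fin B × Fin B, c' i.1 i.2.1 i.2.2 = c i := by
    intro i
    simp [hc']
  have key := coeff_eq_zero_of_sum_eq_zero (p := p) hA hB hAB B c' (by
    rw [← h, Fintype.sum_prod_type]
    simp_rw [Fintype.sum_prod_type]
    rw [← Fin.sum_univ_eq_sum_range (fun k => (∑ a ∈ Finset.range A, ∑ b ∈ Finset.range B,
      C (c' a b k) * ((1 - X) ^ a * truncLog p ^ b)) * X ^ (p * k)) B]
    simp_rw [← Fin.sum_univ_eq_sum_range (fun a => ∑ b ∈ Finset.range B,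
      C (c' a b _) * ((1 - X) ^ a * truncLog p ^ b)) A,
      ← Fin.sum_univ_eq_sum_range (fun b => C (c' _ b _) * ((1 - X) ^ _ * truncLog p ^ b)) B,
      Finset.sum_mul]
    rw [Finset.sum_comm]
    refine Finset.sum_congr rfl fun a _ => ?_
    rw [Finset.sum_comm]
    refine Finset.sum_congr rfl fun b _ => Finset.sum_congr rfl fun k _ => ?_
    rw [← hval (a, b, k)]
    ring)
  funext i
  rw [← hval i]
  exact key _ i.2.2.2 _ i.1.2 _ i.2.1.2

lemma natDegree_aeval_auxPoly_le {A B : ℕ} (hA : A ≤ p) (c : Fin A × Fin B × Fin B → ZMod p) :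
    (MvPolynomial.aeval ![X, truncLog p, X ^ p] (auxPoly p A B c)).natDegree ≤ 2 * p * B := by
  rw [aeval_auxPoly]
  refine natDegree_sum_le_of_forall_le _ _ fun i _ => ?_
  refine (natDegree_C_mul_le _ _).trans ?_
  have h1 : ((1 - X : (ZMod p)[X]) ^ (i.1 : ℕ)).natDegree ≤ i.1 * 1 := by
    refine natDegree_pow_le.trans (Nat.mul_le_mul_left _ ?_)
    exact (natDegree_sub_le _ _).trans (by simp)
  have h2 : (truncLog p ^ (i.2.1 : ℕ)).natDegree ≤ i.2.1 * (p - 1) :=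
    natDegree_pow_le.trans (Nat.mul_le_mul_left _ (natDegree_truncLog_le p))
  have h3 : (X ^ (p * (i.2.2 : ℕ)) : (ZMod p)[X]).natDegree ≤ p * i.2.2 := natDegree_X_pow_le _
  have h4 := natDegree_mul_le (p := (1 - X : (ZMod p)[X]) ^ (i.1 : ℕ))
    (q := truncLog p ^ (i.2.1 : ℕ))
  have h5 := natDegree_mul_le (p := (1 - X : (ZMod p)[X]) ^ (i.1 : ℕ) * truncLog p ^ (i.2.1 : ℕ))
    (q := X ^ (p * (i.2.2 : ℕ)))
  have h6 : (i.1 : ℕ) + 1 ≤ p := lt_of_lt_of_le i.1.2 hA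
  have h7 : (i.2.1 : ℕ) * (p - 1) ≤ (B - 1) * p :=
    Nat.mul_le_mul (by have := i.2.1.2; omega) (Nat.sub_le _ _)
  have h8 : p * (i.2.2 : ℕ) ≤ p * (B - 1) :=
    Nat.mul_le_mul_left _ (by have := i.2.2.2; omega)
  have h9 : (B - 1) * p + p = p * B := by
    have : 0 < B := i.2.1.pos
    obtain ⟨B, rfl⟩ := Nat.exists_eq_succ_of_ne_zero this.ne'
    simp
    ring
  have h10 : p * (B - 1) = (B - 1) * p := mul_comm _ _
  have h11 : 2 * p * B = p * B + p * B := by ring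
  omega

/-- Stepanov's method: the points of the curve on a family of parallel lines. -/
lemma mul_card_curvePoints_le {A B D : ℕ} (hA : 0 < A) (hB : 0 < B) (hAB : A * B ≤ p)
    (hD : D ≤ p) (d : ZMod p) (Y : Finset (ZMod p))
    (h : Y.card * (D * (A + 2 * B + 2 * D)) < A * (B * B)) :
    (curvePoints p d Y).card * D ≤ 2 * p * B := by
  set K := A + 2 * B + 2 * D with hK
  -- On the line `f(s) + d s = y`, and with `s^p = s`, each derivative of the auxiliary polynomial
  -- becomes a polynomial in `s` of degree below `K`. `T` collects its coefficients for every `y ∈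
  -- Y` and every order below `D`; there are fewer of them than free coefficients, so a nonzero
  -- vector is killed.
  let T : (Fin A × Fin B × Fin B → ZMod p) →ₗ[ZMod p] (Y × Fin D × Fin K → ZMod p) :=
    LinearMap.pi fun i => (lcoeff (ZMod p) (i.2.2 : ℕ)) ∘ₗ
      (MvPolynomial.aeval ![X, C (i.1 : ZMod p) - C d * X, X] :
        MvPolynomial (Fin 3) (ZMod p) →ₐ[ZMod p] (ZMod p)[X]).toLinearMap ∘ₗ
      ((liftedOp p).toLinearMap ^ (i.2.1 : ℕ)) ∘ₗ auxPoly p A B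
  have hker : LinearMap.ker T ≠ ⊥ := by
    apply LinearMap.ker_ne_bot_of_finrank_lt
    simpa using h
  obtain ⟨c, hcT, hc⟩ := (Submodule.ne_bot_iff _).1 hker
  rw [LinearMap.mem_ker] at hcT
  set Φ := MvPolynomial.aeval ![X, truncLog p, X ^ p] (auxPoly p A B c) with hΦ
  have hΦ0 : Φ ≠ 0 := aeval_auxPoly_ne_zero hA hB hAB hc
  have hAp : A ≤ p := (Nat.le_mul_of_pos_right A hB).trans hAB
  have hvan : ∀ s ∈ curvePoints p d Y, (X - C s) ^ D ∣ Φ := by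
    intro s hs
    obtain ⟨hs0, hs1, hsY⟩ := (Finset.mem_filter.1 hs).2
    refine X_sub_C_pow_dvd_of_eulerOp hs0 hs1 D hD fun n hn => ?_
    set y := (truncLog p).eval s + d * s with hy
    set R := ((liftedOp p).toLinearMap ^ n) (auxPoly p A B c) with hR
    rw [hΦ, ← aeval_liftedOp_iterate, ← hR]
    have hzero : MvPolynomial.aeval ![X, C y - C d * X, X] R = 0 := by
      ext m
      rw [coeff_zero]
      by_cases hm : m < K
      · exact congrFun hcT (⟨y, hsY⟩, ⟨n, hn⟩, ⟨m, hm⟩)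
      · refine coeff_eq_zero_of_natDegree_lt ?_
        have h1 : R.totalDegree ≤ (A - 1) + (B - 1) + (B - 1) + 2 * n :=
          (totalDegree_liftedOp_iterate_le n _).trans
            (Nat.add_le_add_right (totalDegree_auxPoly_le c) _)
        have h2 := MvPolynomial.aeval_natDegree_le R h1 ![X, C y - C d * X, X] (n := 1) (by
          intro i
          fin_cases i
          · simp
          · refine (natDegree_sub_le _ _).trans ?_
            simpa using (natDegree_C_mul_le d X).trans natDegree_X_le
          · simp)
        omega
    have he : ∀ g : Fin 3 → (ZMod p)[X], (MvPolynomial.aeval g R).eval s =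
        MvPolynomial.aeval (fun i => (g i).eval s) R := by
      intro g
      have := MvPolynomial.comp_aeval_apply (f := g) (Polynomial.aeval s :
        (ZMod p)[X] →ₐ[ZMod p] ZMod p) R
      simpa [Polynomial.coe_aeval_eq_eval] using this
    -- At a point of the curve the two substitutions agree: `f(s) = y - d s` by definition and `s^p
    -- = s` by Fermat.
    have hpt : (fun i => ((![X, truncLog p, X ^ p] : Fin 3 → (ZMod p)[X]) i).eval s) =
        fun i => ((![X, C y - C d * X, X] : Fin 3 → (ZMod p)[X]) i).eval s := by
      funext i
      fin_cases i
      · simp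
      · simp [hy]
      · simp
    rw [he, hpt, ← he, hzero, eval_zero]
  -- Each curve point is a root of multiplicity at least `D`; these roots are compared with the
  -- degree of `Φ`.
  have hroots : (curvePoints p d Y).val.bind (fun s => Multiset.replicate D s) ≤ Φ.roots := by
    rw [Multiset.le_iff_count]
    intro s
    rw [Multiset.count_bind]
    by_cases hs : s ∈ curvePoints p d Y
    · have : (Multiset.map (fun b => Multiset.count s (Multiset.replicate D b))
          (curvePoints p d Y).val).sum = D := by
        change ∑ b ∈ curvePoints p d Y, Multiset.count s (Multiset.replicate D b) = D
        rw [Finset.sum_eq_single_of_mem s hs]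
        · simp
        · intro b _ hb
          simp [Multiset.count_replicate, hb]
      rw [this, count_roots, le_rootMultiplicity_iff hΦ0]
      exact hvan s hs
    · have : (Multiset.map (fun b => Multiset.count s (Multiset.replicate D b))
          (curvePoints p d Y).val).sum = 0 := by
        change ∑ b ∈ curvePoints p d Y, Multiset.count s (Multiset.replicate D b) = 0
        refine Finset.sum_eq_zero fun b hb => ?_
        have : b ≠ s := fun h => hs (h ▸ hb)
        simp [Multiset.count_replicate, this]
      rw [this]
      exact Nat.zero_le _
  have hcard := Multiset.card_le_card hroots
  rw [Multiset.card_bind] at hcard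
  have hcard' : (curvePoints p d Y).card * D ≤ Multiset.card Φ.roots := by
    simpa using hcard
  exact hcard'.trans ((card_roots' Φ).trans (natDegree_aeval_auxPoly_le hAp c))

end StepanovBound

/-! ### Level sets and the third moment of the counts on parallel lines. -/

section Levels

variable {p : ℕ} [Fact p.Prime]

/-- The number of `s ≠ 0, 1` with `truncLog s + d s = y`. -/
noncomputable def lineCount (p : ℕ) [Fact p.Prime] (d y : ZMod p) : ℕ :=
  (Finset.univ.filter fun s : ZMod p => s ≠ 0 ∧ s ≠ 1 ∧ (truncLog p).eval s + d * s = y).card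

lemma sum_lineCount (d : ZMod p) (Y : Finset (ZMod p)) :
    ∑ y ∈ Y, lineCount p d y = (curvePoints p d Y).card := by
  rw [Finset.card_eq_sum_card_fiberwise (f := fun s => (truncLog p).eval s + d * s) (t := Y)
    (fun s hs => (Finset.mem_filter.1 hs).2.2.2)]
  refine Finset.sum_congr rfl fun y hy => ?_
  unfold lineCount curvePoints
  congr 1
  ext s
  simp only [Finset.mem_filter, Finset.mem_univ, true_and]
  constructor
  · rintro ⟨h0, h1, h2⟩
    exact ⟨⟨h0, h1, h2 ▸ hy⟩, h2⟩
  · rintro ⟨⟨h0, h1, _⟩, h2⟩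
    exact ⟨h0, h1, h2⟩

lemma card_curvePoints_le (d : ZMod p) (Y : Finset (ZMod p)) : (curvePoints p d Y).card ≤ p := by
  refine (Finset.card_le_univ _).trans ?_
  rw [ZMod.card]

/-- `∑_{y ∈ Y} N_d(y) ≪ (p |Y|) ^ (2/3)` for `|Y| ≤ √p`. -/
lemma card_curvePoints_pow_le (hp : 25600 ≤ p) (d : ZMod p) (Y : Finset (ZMod p))
    (hY : 0 < Y.card) (hYp : Y.card ^ 2 ≤ p) :
    (curvePoints p d Y).card ^ 3 ≤ 2097152000 * p ^ 2 * Y.card ^ 2 := by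
  set h := Y.card with hh
  set M := (curvePoints p d Y).card with hM
  have hex : ∃ B : ℕ, p * h ≤ B ^ 3 := ⟨p * h, Nat.le_self_pow (by norm_num) _⟩
  -- `B` is the least integer with `p h ≤ B^3`. With `A ≈ p/B` and `D ≈ A/40`, the dimension
  -- condition asks for `h A ≪ B^2`, which this choice just meets, and the conclusion becomes `M ≪ p
  -- B / D ≪ B^2`.
  obtain ⟨B, hB1, hB2⟩ : ∃ B : ℕ, p * h ≤ B ^ 3 ∧ ∀ m < B, m ^ 3 < p * h := by
    refine ⟨Nat.find hex, Nat.find_spec hex, fun m hm => not_le.1 (Nat.find_min hex hm)⟩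
  have hph : p ≤ p * h := Nat.le_mul_of_pos_right p hY
  have hB2' : 2 ≤ B := by
    by_contra hlt
    have : B ≤ 1 := by omega
    have : B ^ 3 ≤ 1 ^ 3 := Nat.pow_le_pow_left this 3
    omega
  have hB8 : B ^ 3 ≤ 8 * (p * h) := by
    have h1 := hB2 (B - 1) (by omega)
    have h2 : B ^ 3 ≤ (2 * (B - 1)) ^ 3 := Nat.pow_le_pow_left (by omega) 3
    have h3 : (2 * (B - 1)) ^ 3 = 8 * (B - 1) ^ 3 := by ring
    omega
  have hB4 : B ^ 2 ≤ 4 * p := by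
    have h1 : (B ^ 2) ^ 3 ≤ (4 * p) ^ 3 := by
      calc (B ^ 2) ^ 3 = (B ^ 3) ^ 2 := by ring
        _ ≤ (8 * (p * h)) ^ 2 := Nat.pow_le_pow_left hB8 2
        _ = 64 * p ^ 2 * h ^ 2 := by ring
        _ ≤ 64 * p ^ 2 * p := Nat.mul_le_mul_left _ hYp
        _ = (4 * p) ^ 3 := by ring
    exact (Nat.pow_le_pow_iff_left (by norm_num)).1 h1
  set A := p / B with hA
  have hAB : A * B ≤ p := Nat.div_mul_le_self p B
  have hAB' : p < (A + 1) * B := by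
    have := Nat.lt_div_mul_add (a := p) (b := B) (by omega)
    rw [← hA] at this
    linarith
  -- As `B^2 ≤ 4p`, the bound `p < 80 B` would give `p < 4 * 80^2 = 25600`. A large `A` keeps the
  -- rounding in `A / 40` harmless.
  have hA80 : 79 < A := by
    by_contra hlt
    have h1 : A + 1 ≤ 80 := by omega
    have h2 : p < 80 * B := lt_of_lt_of_le hAB' (Nat.mul_le_mul_right _ h1)
    nlinarith
  have hB8A : B ≤ 8 * A := by
    have : B * B < 4 * (A + 1) * B := by nlinarith
    have := lt_of_mul_lt_mul_right this (Nat.zero_le _)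
    omega
  set D := A / 40 with hDdef
  have hD1 : 40 * D ≤ A := Nat.mul_div_le A 40
  have hD2 : A ≤ 80 * D := by omega
  have hAp : A ≤ p := Nat.div_le_self p B
  have hcond : h * (D * (A + 2 * B + 2 * D)) < A * (B * B) := by
    have h1 : A + 2 * B + 2 * D ≤ 18 * A := by omega
    have h2 : 18 * (h * D) < B * B := by
      have h3 : (18 * (h * A)) * B < (40 * (B * B)) * B := by
        calc (18 * (h * A)) * B = 18 * (h * (A * B)) := by ring
          _ ≤ 18 * (h * p) := by gcongr
          _ ≤ 18 * B ^ 3 := by nlinarith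
          _ < 40 * B ^ 3 := by
            have : 0 < B ^ 3 := by positivity
            omega
          _ = (40 * (B * B)) * B := by ring
      have h4 := lt_of_mul_lt_mul_right h3 (Nat.zero_le _)
      have h5 : h * (40 * D) ≤ h * A := Nat.mul_le_mul_left _ hD1
      nlinarith
    calc h * (D * (A + 2 * B + 2 * D)) ≤ h * (D * (18 * A)) := by gcongr
      _ = A * (18 * (h * D)) := by ring
      _ < A * (B * B) := Nat.mul_lt_mul_of_pos_left h2 (by omega)
  have key := mul_card_curvePoints_le (by omega : 0 < A) (by omega : 0 < B) hAB
    (by omega : D ≤ p) d Y hcond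
  rw [← hM] at key
  have hM320 : M ≤ 320 * B ^ 2 := by
    have h1 : M * p ≤ (320 * B ^ 2) * p := by
      have hp2 : p ≤ 2 * (A * B) := by nlinarith
      calc M * p ≤ M * (2 * (A * B)) := Nat.mul_le_mul_left _ hp2
        _ = 2 * B * (M * A) := by ring
        _ ≤ 2 * B * (M * (80 * D)) := by gcongr
        _ = 160 * B * (M * D) := by ring
        _ ≤ 160 * B * (2 * p * B) := Nat.mul_le_mul_left _ key
        _ = (320 * B ^ 2) * p := by ring
    exact Nat.le_of_mul_le_mul_right h1 (by omega)
  calc M ^ 3 ≤ (320 * B ^ 2) ^ 3 := Nat.pow_le_pow_left hM320 3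
    _ = 32768000 * (B ^ 3) ^ 2 := by ring
    _ ≤ 32768000 * (8 * (p * h)) ^ 2 := by gcongr
    _ = 2097152000 * p ^ 2 * h ^ 2 := by ring

/-- The level sets of the counting function on parallel lines. -/
lemma card_level_mul_pow_le (hp : 25600 ≤ p) (d : ZMod p) (τ : ℕ) :
    (Finset.univ.filter fun y => τ ≤ lineCount p d y).card * τ ^ 3 ≤ 4194304000 * p ^ 2 := by
  rcases Nat.eq_zero_or_pos τ with rfl | hτ
  · simp
  set S := Finset.univ.filter fun y => τ ≤ lineCount p d y with hS
  have hsub : ∀ Y ⊆ S, Y.card * τ ≤ (curvePoints p d Y).card := by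
    intro Y hY
    rw [← sum_lineCount, ← smul_eq_mul]
    exact Finset.card_nsmul_le_sum _ _ _ fun y hy => (Finset.mem_filter.1 (hY hy)).2
  have hsmall : ∀ Y ⊆ S, 0 < Y.card → Y.card ^ 2 ≤ p → Y.card * τ ^ 3 ≤ 2097152000 * p ^ 2 := by
    intro Y hY h0 h1
    have h2 := card_curvePoints_pow_le hp d Y h0 h1
    have h3 : (Y.card * τ) ^ 3 ≤ 2097152000 * p ^ 2 * Y.card ^ 2 :=
      (Nat.pow_le_pow_left (hsub Y hY) 3).trans h2
    have h4 : (Y.card * τ ^ 3) * Y.card ^ 2 ≤ (2097152000 * p ^ 2) * Y.card ^ 2 := by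
      calc (Y.card * τ ^ 3) * Y.card ^ 2 = (Y.card * τ) ^ 3 := by ring
        _ ≤ _ := h3
    exact Nat.le_of_mul_le_mul_right h4 (by positivity)
  rcases Nat.eq_zero_or_pos S.card with h0 | h0
  · rw [h0]; simp
  by_cases h1 : S.card ^ 2 ≤ p
  · exact (hsmall S subset_rfl h0 h1).trans (by gcongr; norm_num)
  -- For a level set with more than `√p` elements, a subset of size `⌊√p⌋` already forces `τ^2 ≪ p`;
  -- the trivial bound `|S| τ ≤ p` then finishes.
  · set r := Nat.sqrt p with hr
    have hr1 : r * r ≤ p := Nat.sqrt_le p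
    have hr2 : p < (r + 1) * (r + 1) := Nat.lt_succ_sqrt p
    have hr0 : 0 < r := Nat.sqrt_pos.2 (by omega)
    have hrS : r ≤ S.card := by
      by_contra hlt
      have : S.card ^ 2 ≤ r ^ 2 := Nat.pow_le_pow_left (by omega) 2
      nlinarith
    obtain ⟨Y, hYS, hYc⟩ := Finset.exists_subset_card_eq hrS
    have h2 := hsmall Y hYS (by omega) (by rw [hYc]; nlinarith)
    rw [hYc] at h2
    have h3 : p ≤ 4 * r ^ 2 := by nlinarith
    have h4 : τ ^ 6 * p ≤ 17592186044416000000 * p ^ 4 := by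
      calc τ ^ 6 * p ≤ τ ^ 6 * (4 * r ^ 2) := Nat.mul_le_mul_left _ h3
        _ = 4 * (r * τ ^ 3) ^ 2 := by ring
        _ ≤ 4 * (2097152000 * p ^ 2) ^ 2 := by gcongr
        _ = 17592186044416000000 * p ^ 4 := by ring
    have h5 : τ ^ 6 ≤ 17592186044416000000 * p ^ 3 := by
      refine Nat.le_of_mul_le_mul_right (c := p) ?_ (by omega)
      calc τ ^ 6 * p ≤ _ := h4
        _ = 17592186044416000000 * p ^ 3 * p := by ring
    have h6 : τ ^ 2 ≤ 4194304000 * p := by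
      have : (τ ^ 2) ^ 3 ≤ (4194304000 * p) ^ 3 := by
        calc (τ ^ 2) ^ 3 = τ ^ 6 := by ring
          _ ≤ _ := h5
          _ ≤ (4194304000 * p) ^ 3 := by
            rw [mul_pow]
            exact Nat.mul_le_mul_right _ (by norm_num)
      exact (Nat.pow_le_pow_iff_left (by norm_num)).1 this
    have h7 : S.card * τ ≤ p := (hsub S subset_rfl).trans (card_curvePoints_le d S)
    calc S.card * τ ^ 3 = (S.card * τ) * τ ^ 2 := by ring
      _ ≤ p * (4194304000 * p) := Nat.mul_le_mul h7 h6
      _ = 4194304000 * p ^ 2 := by ring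

lemma nat_pow_three_le_sum (n : ℕ) : n ^ 3 ≤ ∑ τ ∈ Finset.Icc 1 n, 3 * τ ^ 2 := by
  induction n with
  | zero => simp
  | succ n ih =>
    rw [Finset.sum_Icc_succ_top (by omega)]
    have h : n ^ 3 + 3 * (n + 1) ^ 2 = (n + 1) ^ 3 + (3 * n + 2) := by ring
    omega

lemma lineCount_le (d y : ZMod p) : lineCount p d y ≤ p := by
  refine (Finset.card_le_univ _).trans ?_
  rw [ZMod.card]

/-- The third moment of the counting function on parallel lines. -/
lemma sum_lineCount_pow_three_le (hp : 25600 ≤ p) (d : ZMod p) :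
    ∑ y, (lineCount p d y : ℝ) ^ 3 ≤ 25165824000 * (p : ℝ) ^ 2 * Real.log p := by
  -- The cube is written as a sum over levels `τ`. The level set bound `p^2 / τ^3` against the
  -- weight `3 τ^2` leaves a harmonic sum, the source of the logarithm.
  have h1 : ∀ y, (lineCount p d y : ℝ) ^ 3 ≤
      ∑ τ ∈ Finset.Icc 1 p, if τ ≤ lineCount p d y then 3 * (τ : ℝ) ^ 2 else 0 := by
    intro y
    rw [← Finset.sum_filter]
    have h2 : (Finset.Icc 1 p).filter (fun τ => τ ≤ lineCount p d y) =
        Finset.Icc 1 (lineCount p d y) := by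
      ext τ
      have := lineCount_le d y
      simp only [Finset.mem_filter, Finset.mem_Icc]
      omega
    rw [h2]
    exact_mod_cast nat_pow_three_le_sum (lineCount p d y)
  have hp0 : (0 : ℝ) < p := by positivity
  calc ∑ y, (lineCount p d y : ℝ) ^ 3
      ≤ ∑ y, ∑ τ ∈ Finset.Icc 1 p, if τ ≤ lineCount p d y then 3 * (τ : ℝ) ^ 2 else 0 :=
        Finset.sum_le_sum fun y _ => h1 y
    _ = ∑ τ ∈ Finset.Icc 1 p,
          ((Finset.univ.filter fun y => τ ≤ lineCount p d y).card : ℝ) * (3 * (τ : ℝ) ^ 2) := by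
        rw [Finset.sum_comm]
        refine Finset.sum_congr rfl fun τ _ => ?_
        rw [← Finset.sum_filter, Finset.sum_const, nsmul_eq_mul]
    _ ≤ ∑ τ ∈ Finset.Icc 1 p, 12582912000 * (p : ℝ) ^ 2 * (τ : ℝ)⁻¹ := by
        refine Finset.sum_le_sum fun τ hτ => ?_
        have hτ0 : (0 : ℝ) < τ := by
          exact_mod_cast (Finset.mem_Icc.1 hτ).1
        have h2 : ((Finset.univ.filter fun y => τ ≤ lineCount p d y).card : ℝ) * (τ : ℝ) ^ 3 ≤
            4194304000 * (p : ℝ) ^ 2 := by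
          exact_mod_cast card_level_mul_pow_le hp d τ
        rw [← div_eq_mul_inv, le_div_iff₀ hτ0]
        nlinarith
    _ = 12582912000 * (p : ℝ) ^ 2 * ((harmonic p : ℚ) : ℝ) := by
        rw [← Finset.mul_sum, harmonic_eq_sum_Icc]
        push_cast
        rfl
    _ ≤ 12582912000 * (p : ℝ) ^ 2 * (1 + Real.log p) := by
        gcongr
        exact harmonic_le_one_add_log p
    _ ≤ 25165824000 * (p : ℝ) ^ 2 * Real.log p := by
        have h3 : 1 ≤ Real.log p := by
          rw [Real.le_log_iff_exp_le hp0]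
          have h4 : (25600 : ℝ) ≤ p := by exact_mod_cast hp
          linarith [Real.exp_one_lt_d9]
        nlinarith [sq_nonneg (p : ℝ)]

end Levels

/-! ### Teichmüller coordinates on `ℤ/p²`. -/

section Coordinates

variable {p : ℕ} [Fact p.Prime]

/-- The Teichmüller lift `u ↦ u ^ p` from `ℤ/p` to `ℤ/p²`. -/
noncomputable def teich (p : ℕ) (u : ZMod p) : ZMod (p ^ 2) := (u.val : ZMod (p ^ 2)) ^ p

/-- The additive embedding `c ↦ p c` of `ℤ/p` into `ℤ/p²`. -/
noncomputable def timesP (p : ℕ) (c : ZMod p) : ZMod (p ^ 2) :=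
  (p : ZMod (p ^ 2)) * (c.val : ZMod (p ^ 2))

/-- Reduction modulo `p` on `ℤ/p²`. -/
def redP (p : ℕ) : ZMod (p ^ 2) →+* ZMod p :=
  ZMod.castHom (dvd_pow_self p two_ne_zero) (ZMod p)

lemma dvd_sub_val (n : ℤ) : (p : ℤ) ∣ n - ((n : ZMod p).val : ℤ) := by
  rw [← ZMod.intCast_zmod_eq_zero_iff_dvd]
  simp

/-- Congruence modulo `p` lifts to congruence of `p`-th powers modulo `p^2`, so the `p`-th power
depends only on the residue class modulo `p`. -/
lemma intCast_pow_eq_teich (n : ℤ) : (n : ZMod (p ^ 2)) ^ p = teich p (n : ZMod p) := by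
  have h := dvd_sub_pow_of_dvd_sub (dvd_sub_val (p := p) n) 1
  rw [pow_one] at h
  have h2 : ((n ^ p - ((n : ZMod p).val : ℤ) ^ p : ℤ) : ZMod (p ^ 2)) = 0 := by
    rw [ZMod.intCast_zmod_eq_zero_iff_dvd]
    exact_mod_cast h
  unfold teich
  push_cast at h2
  exact sub_eq_zero.1 h2

lemma mul_intCast_eq_timesP (n : ℤ) :
    (p : ZMod (p ^ 2)) * (n : ZMod (p ^ 2)) = timesP p (n : ZMod p) := by
  obtain ⟨k, hk⟩ := dvd_sub_val (p := p) n
  have h2 : ((p * n - p * ((n : ZMod p).val : ℤ) : ℤ) : ZMod (p ^ 2)) = 0 := by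
    rw [ZMod.intCast_zmod_eq_zero_iff_dvd]
    refine ⟨k, ?_⟩
    rw [← mul_sub, hk]
    push_cast
    ring
  unfold timesP
  push_cast at h2
  exact sub_eq_zero.1 h2

lemma exists_intCast_eq (c : ZMod p) : ∃ n : ℤ, (n : ZMod p) = c :=
  ⟨c.val, by simp⟩

lemma timesP_add (c d : ZMod p) : timesP p (c + d) = timesP p c + timesP p d := by
  obtain ⟨m, rfl⟩ := exists_intCast_eq c
  obtain ⟨n, rfl⟩ := exists_intCast_eq d
  rw [← Int.cast_add, ← mul_intCast_eq_timesP, ← mul_intCast_eq_timesP, ← mul_intCast_eq_timesP,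
    Int.cast_add, mul_add]

lemma timesP_zero : timesP p 0 = 0 := by
  simp [timesP]

lemma timesP_neg (c : ZMod p) : timesP p (-c) = -timesP p c := by
  have h := timesP_add c (-c)
  rw [add_neg_cancel, timesP_zero] at h
  exact (neg_eq_of_add_eq_zero_right h.symm).symm

lemma timesP_sub (c d : ZMod p) : timesP p (c - d) = timesP p c - timesP p d := by
  rw [sub_eq_add_neg, timesP_add, timesP_neg, sub_eq_add_neg]

lemma timesP_sum {ι : Type*} (s : Finset ι) (c : ι → ZMod p) :
    timesP p (∑ i ∈ s, c i) = ∑ i ∈ s, timesP p (c i) :=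
  map_sum (AddMonoidHom.mk' (timesP p) timesP_add) c s

lemma mul_timesP (x : ZMod (p ^ 2)) (c : ZMod p) : x * timesP p c = timesP p (redP p x * c) := by
  obtain ⟨m, rfl⟩ := ZMod.intCast_surjective x
  obtain ⟨n, rfl⟩ := exists_intCast_eq c
  rw [map_intCast, ← Int.cast_mul, ← mul_intCast_eq_timesP, ← mul_intCast_eq_timesP, Int.cast_mul]
  ring

lemma redP_timesP (c : ZMod p) : redP p (timesP p c) = 0 := by
  simp [timesP]

lemma timesP_mul_timesP (c d : ZMod p) : timesP p c * timesP p d = 0 := by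
  rw [mul_timesP, redP_timesP, zero_mul, timesP_zero]

lemma redP_teich (u : ZMod p) : redP p (teich p u) = u := by
  simp [teich, ZMod.pow_card]

lemma teich_mul (u v : ZMod p) : teich p (u * v) = teich p u * teich p v := by
  obtain ⟨m, rfl⟩ := exists_intCast_eq u
  obtain ⟨n, rfl⟩ := exists_intCast_eq v
  rw [← Int.cast_mul, ← intCast_pow_eq_teich, ← intCast_pow_eq_teich, ← intCast_pow_eq_teich,
    Int.cast_mul, mul_pow]

lemma teich_one : teich p 1 = 1 := by
  have := intCast_pow_eq_teich (p := p) 1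
  simpa using this.symm

lemma teich_zero : teich p 0 = 0 := by
  simp [teich, (Fact.out : p.Prime).ne_zero]

lemma isUnit_teich (u : (ZMod p)ˣ) : IsUnit (teich p u) :=
  IsUnit.of_mul_eq_one (teich p (u⁻¹ : (ZMod p)ˣ)) (by rw [← teich_mul, Units.mul_inv, teich_one])

lemma timesP_injective : Function.Injective (timesP p) := by
  intro c d h
  have h1 : timesP p (c - d) = 0 := by rw [timesP_sub, h, sub_self]
  obtain ⟨n, hn⟩ := exists_intCast_eq (c - d)
  rw [← hn, ← mul_intCast_eq_timesP] at h1
  have h2 : ((p * n : ℤ) : ZMod (p ^ 2)) = 0 := by exact_mod_cast h1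
  rw [ZMod.intCast_zmod_eq_zero_iff_dvd] at h2
  have hp0 : (p : ℤ) ≠ 0 := by exact_mod_cast (Fact.out : p.Prime).ne_zero
  have h3 : (p : ℤ) ∣ n := by
    rw [Nat.cast_pow, sq] at h2
    exact (mul_dvd_mul_iff_left hp0).1 h2
  have h4 : (n : ZMod p) = 0 := (ZMod.intCast_zmod_eq_zero_iff_dvd _ _).2 h3
  rw [hn] at h4
  exact sub_eq_zero.1 h4

/-- Every element of `ℤ/p²` is uniquely `teich w + timesP m`. -/
lemma sum_eq_sum_coords {M : Type*} [AddCommMonoid M] (φ : ZMod (p ^ 2) → M) :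
    ∑ z, φ z = ∑ w : ZMod p, ∑ m : ZMod p, φ (teich p w + timesP p m) := by
  rw [← Fintype.sum_prod_type' (f := fun w m => φ (teich p w + timesP p m))]
  symm
  refine Function.Bijective.sum_comp (e := fun x : ZMod p × ZMod p => teich p x.1 + timesP p x.2)
    ?_ φ
  rw [Fintype.bijective_iff_injective_and_card]
  refine ⟨?_, by simp [ZMod.card, sq]⟩
  rintro ⟨w, m⟩ ⟨w', m'⟩ h
  simp only at h
  have h1 := congrArg (redP p) h
  simp only [map_add, redP_teich, redP_timesP, add_zero] at h1
  subst h1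
  rw [add_right_inj] at h
  rw [timesP_injective h]

/-- Multiples of `p` are split from units. A unit is uniquely `teich w (1 - p c)`: substitute `m =
-w c` in `teich w + p m`. Multiplicative coordinates suit counts that are invariant under the group.
-/
lemma sum_eq_sum_units_coords {M : Type*} [AddCommMonoid M] (φ : ZMod (p ^ 2) → M) :
    ∑ z, φ z = ∑ m : ZMod p, φ (timesP p m) +
      ∑ w : (ZMod p)ˣ, ∑ c : ZMod p, φ (teich p w * (1 - timesP p c)) := by
  rw [sum_eq_sum_coords, ← Finset.add_sum_erase _ _ (Finset.mem_univ (0 : ZMod p))]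
  congr 1
  · simp [teich_zero]
  · symm
    refine Finset.sum_bij' (fun w _ => (w : ZMod p))
      (fun w hw => Units.mk0 w (Finset.ne_of_mem_erase hw)) ?_ ?_ ?_ ?_ ?_
    · intro w _
      exact Finset.mem_erase.2 ⟨w.ne_zero, Finset.mem_univ _⟩
    · intro w _
      exact Finset.mem_univ _
    · intro w _
      exact Units.ext rfl
    · intro w _
      rfl
    · intro w _
      have hb : Function.Bijective fun c : ZMod p => -((w : ZMod p) * c) := by
        rw [Fintype.bijective_iff_injective_and_card]
        refine ⟨fun c d h => ?_, rfl⟩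
        exact mul_left_cancel₀ w.ne_zero (neg_injective h)
      rw [← hb.sum_comp (fun m => φ (teich p w + timesP p m))]
      refine Finset.sum_congr rfl fun c _ => ?_
      rw [mul_sub, mul_one, mul_timesP, redP_teich, timesP_neg, sub_eq_add_neg]

lemma choose_sub_one_eq (k : ℕ) (hk : k < p) : ((p - 1).choose k : ZMod p) = (-1) ^ k := by
  induction k with
  | zero => simp
  | succ k ih =>
    have h1 : (p - 1).choose k + (p - 1).choose (k + 1) = p.choose (k + 1) := by
      have := Nat.choose_succ_succ (p - 1) k
      rw [Nat.succ_eq_add_one, Nat.sub_add_cancel (Fact.out : p.Prime).one_le] at this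
      exact this.symm
    have h2 : (p.choose (k + 1) : ZMod p) = 0 := by
      rw [ZMod.natCast_eq_zero_iff]
      exact (Fact.out : p.Prime).dvd_choose_self (by omega) hk
    rw [← h1] at h2
    push_cast at h2
    rw [ih (by omega)] at h2
    rw [pow_succ, eq_neg_of_add_eq_zero_right h2]
    ring

/-- Dividing the binomial coefficient by `p` gives `(p-1 choose k) / (k+1) = (-1)^k / (k+1)` modulo
`p`, and the signs cancel since `p - 1` is even. Hence the coefficients of the truncated logarithm.
-/
lemma choose_cast_eq (hp2 : p ≠ 2) (k : ℕ) (hk : k + 1 < p) :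
    (p.choose (k + 1) : ZMod (p ^ 2)) * (-1) ^ (p - (k + 1)) =
      timesP p (((k + 1 : ℕ) : ZMod p)⁻¹) := by
  have hp := (Fact.out : p.Prime)
  obtain ⟨c, hc⟩ := hp.dvd_choose_self (Nat.succ_ne_zero k) hk
  have hc' : p.choose (k + 1) = p * c := hc
  have h1 : c * (k + 1) = (p - 1).choose k := by
    have h2 := Nat.add_one_mul_choose_eq (p - 1) k
    rw [Nat.sub_add_cancel hp.one_le, hc'] at h2
    refine Nat.eq_of_mul_eq_mul_left hp.pos ?_
    rw [h2]
    ring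
  have hk0 : ((k + 1 : ℕ) : ZMod p) ≠ 0 := natCast_ne_zero_of_lt (Nat.succ_pos k) hk
  have h3 : ((c : ℕ) : ZMod p) = (-1) ^ k * (((k + 1 : ℕ) : ZMod p)⁻¹) := by
    rw [eq_mul_inv_iff_mul_eq₀ hk0, ← choose_sub_one_eq k (by omega), ← h1]
    push_cast
    ring
  have h4 : (p.choose (k + 1) : ZMod (p ^ 2)) = timesP p (c : ZMod p) := by
    have := mul_intCast_eq_timesP (p := p) (c : ℤ)
    rw [hc']
    push_cast at this ⊢
    exact this
  rw [h4, mul_comm, mul_timesP, h3]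
  congr 1
  have hodd : Even (p - 1) := hp.even_sub_one hp2
  have h5 : (-1 : ZMod p) ^ (p - (k + 1)) * (-1) ^ k = 1 := by
    rw [← pow_add, show p - (k + 1) + k = p - 1 by omega, hodd.neg_one_pow]
  simp only [map_pow, map_neg, map_one]
  rw [← mul_assoc, h5, one_mul]

/-- The Teichmüller lift on consecutive elements. -/
lemma teich_sub_teich (hp2 : p ≠ 2) (s : ZMod p) :
    teich p s - teich p (s - 1) = 1 - timesP p ((truncLog p).eval s) := by
  have hp := (Fact.out : p.Prime)
  obtain ⟨n, rfl⟩ := exists_intCast_eq s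
  have h1 : ((n : ZMod p) - 1) = ((n - 1 : ℤ) : ZMod p) := by push_cast; rfl
  rw [h1, ← intCast_pow_eq_teich, ← intCast_pow_eq_teich]
  have h2 : (((n - 1 : ℤ) : ZMod (p ^ 2))) ^ p =
      (n : ZMod (p ^ 2)) ^ p - 1 + timesP p ((truncLog p).eval (n : ZMod p)) := by
    push_cast
    rw [sub_eq_add_neg, add_pow, Finset.sum_range_succ]
    obtain ⟨r, hr⟩ : ∃ r, p = r + 1 := ⟨p - 1, by have := hp.pos; omega⟩
    have h3 : ∑ m ∈ Finset.range p, (n : ZMod (p ^ 2)) ^ m * (-1) ^ (p - m) *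
        ((p.choose m : ℕ) : ZMod (p ^ 2)) =
        timesP p ((truncLog p).eval (n : ZMod p)) + (-1) ^ p := by
      have h4 : ∀ g : ℕ → ZMod (p ^ 2), ∑ m ∈ Finset.range p, g m =
          ∑ m ∈ Finset.range (p - 1), g (m + 1) + g 0 := by
        intro g
        rw [← Finset.sum_range_succ', Nat.sub_add_cancel hp.one_le]
      rw [h4]
      congr 1
      · unfold truncLog
        rw [eval_finsetSum, timesP_sum]
        refine Finset.sum_congr rfl fun k hk => ?_
        have hk' : k + 1 < p := by have := Finset.mem_range.1 hk; omega
        rw [mul_assoc, mul_comm ((-1 : ZMod (p ^ 2)) ^ _), choose_cast_eq hp2 k hk', mul_timesP]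
        congr 1
        simp only [map_pow, map_intCast, eval_mul, eval_C, eval_pow, eval_X]
        ring
      · simp
    rw [h3, (hp.odd_of_ne_two hp2).neg_one_pow]
    simp only [Nat.sub_self, pow_zero, Nat.choose_self, Nat.cast_one, mul_one]
    ring
  rw [h2]
  ring

end Coordinates

/-! ### Differences of `p`-th powers expressed through line counts. -/

section PairCounts

variable {p : ℕ} [Fact p.Prime]

/-- The number of representations of `z` as a difference
`teich u (1 - p a) - teich v (1 - p b)`. -/
noncomputable def pairCount (p : ℕ) [Fact p.Prime] (a b : ZMod p) (z : ZMod (p ^ 2)) : ℕ :=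
  (Finset.univ.filter fun q : (ZMod p)ˣ × (ZMod p)ˣ =>
    teich p q.1 * (1 - timesP p a) - teich p q.2 * (1 - timesP p b) = z).card

lemma teich_mul_sub_teich_mul (hp2 : p ≠ 2) (a b s : ZMod p) :
    teich p s * (1 - timesP p a) - teich p (s - 1) * (1 - timesP p b) =
      1 - timesP p ((truncLog p).eval s + (a - b) * s + b) := by
  have h := teich_sub_teich hp2 s
  have h1 : teich p s * timesP p a = timesP p (s * a) := by rw [mul_timesP, redP_teich]
  have h2 : teich p (s - 1) * timesP p b = timesP p ((s - 1) * b) := by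
    rw [mul_timesP, redP_teich]
  have h3 : (truncLog p).eval s + (a - b) * s + b =
      (truncLog p).eval s + s * a - (s - 1) * b := by ring
  rw [h3, timesP_sub, timesP_add, mul_sub, mul_sub, h1, h2, mul_one, mul_one]
  linear_combination h

/-- Reduction modulo `p` gives `u - v = w`, so `u = w s` and `v = w (s - 1)`. After division by
`teich w`, what remains is an equation modulo `p` on a line; the exclusions `s ≠ 0, 1` say that `u`
and `v` are units. -/
lemma pairCount_teich_mul (hp2 : p ≠ 2) (a b : ZMod p) (w : (ZMod p)ˣ) (c : ZMod p) :
    pairCount p a b (teich p w * (1 - timesP p c)) = lineCount p (a - b) (c - b) := by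
  unfold pairCount lineCount
  have key : ∀ s : ZMod p,
      (teich p (w * s) * (1 - timesP p a) - teich p (w * (s - 1)) * (1 - timesP p b) =
        teich p w * (1 - timesP p c)) ↔ (truncLog p).eval s + (a - b) * s = c - b := by
    intro s
    rw [teich_mul, teich_mul, mul_assoc, mul_assoc, ← mul_sub, teich_mul_sub_teich_mul hp2,
      (isUnit_teich w).mul_right_inj, sub_right_inj, timesP_injective.eq_iff, eq_sub_iff_add_eq]
  symm
  refine Finset.card_bij'
    (fun s hs => ((w * Units.mk0 s (Finset.mem_filter.1 hs).2.1,
      w * Units.mk0 (s - 1) (sub_ne_zero.2 (Finset.mem_filter.1 hs).2.2.1)) :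
        (ZMod p)ˣ × (ZMod p)ˣ))
    (fun q _ => ((w⁻¹ * q.1 : (ZMod p)ˣ) : ZMod p)) ?_ ?_ ?_ ?_
  · intro s hs
    simp only [Finset.mem_filter, Finset.mem_univ, true_and, Units.val_mul, Units.val_mk0]
    exact (key s).2 (Finset.mem_filter.1 hs).2.2.2
  · intro q hq
    have hq' := (Finset.mem_filter.1 hq).2
    have h1 := congrArg (redP p) hq'
    simp only [map_mul, map_sub, map_one, redP_teich, redP_timesP, sub_zero, mul_one] at h1
    have h2 : ((w⁻¹ * q.1 : (ZMod p)ˣ) : ZMod p) - 1 = ((w⁻¹ * q.2 : (ZMod p)ˣ) : ZMod p) := by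
      rw [sub_eq_iff_eq_add, ← sub_eq_iff_eq_add']
      rw [Units.val_mul, Units.val_mul, ← mul_sub, h1, Units.inv_mul]
    simp only [Finset.mem_filter, Finset.mem_univ, true_and]
    refine ⟨Units.ne_zero _, fun h3 => ?_, ?_⟩
    · rw [h3, sub_self] at h2
      exact Units.ne_zero _ h2.symm
    · rw [← key, h2, ← Units.val_mul, ← Units.val_mul, mul_inv_cancel_left, mul_inv_cancel_left]
      exact hq'
  · intro s hs
    simp
  · intro q hq
    have hq' := (Finset.mem_filter.1 hq).2
    have h1 := congrArg (redP p) hq'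
    simp only [map_mul, map_sub, map_one, redP_teich, redP_timesP, sub_zero, mul_one] at h1
    ext
    · rw [Units.val_mul, Units.val_mk0, Units.val_mul, Units.mul_inv_cancel_left]
    · rw [Units.val_mul, Units.val_mk0, Units.val_mul, mul_sub, Units.mul_inv_cancel_left, mul_one,
        sub_eq_iff_eq_add', ← sub_eq_iff_eq_add]
      exact h1

/-- For differences divisible by `p` no curve appears: the two lifts coincide and the equation is
linear. -/
lemma eq_of_mem_pairCount {a b m : ZMod p} {u v : (ZMod p)ˣ}
    (h : teich p u * (1 - timesP p a) - teich p v * (1 - timesP p b) = timesP p m) :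
    u = v ∧ (u : ZMod p) * (b - a) = m := by
  have h1 := congrArg (redP p) h
  simp only [map_mul, map_sub, map_one, redP_teich, redP_timesP, sub_zero, mul_one] at h1
  have h2 : u = v := Units.ext (sub_eq_zero.1 h1)
  refine ⟨h2, ?_⟩
  subst h2
  rw [← mul_sub, sub_sub_sub_cancel_left, ← timesP_sub, mul_timesP, redP_teich] at h
  exact timesP_injective h

lemma pairCount_timesP_le_one (a b : ZMod p) {m : ZMod p} (hm : m ≠ 0) :
    pairCount p a b (timesP p m) ≤ 1 := by
  unfold pairCount
  rw [Finset.card_le_one]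
  rintro ⟨u, v⟩ hq ⟨u', v'⟩ hq'
  obtain ⟨h1, h2⟩ := eq_of_mem_pairCount (Finset.mem_filter.1 hq).2
  obtain ⟨h3, h4⟩ := eq_of_mem_pairCount (Finset.mem_filter.1 hq').2
  simp only at h1 h2 h3 h4
  subst h1 h3
  have hba : b - a ≠ 0 := by
    rintro h0
    rw [h0, mul_zero] at h2
    exact hm h2.symm
  have h5 : u = u' := Units.ext (mul_right_cancel₀ hba (h2.trans h4.symm))
  rw [h5]

lemma pairCount_self_timesP (a : ZMod p) {m : ZMod p} (hm : m ≠ 0) :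
    pairCount p a a (timesP p m) = 0 := by
  unfold pairCount
  rw [Finset.card_eq_zero, Finset.filter_eq_empty_iff]
  rintro ⟨u, v⟩ _ h
  obtain ⟨_, h2⟩ := eq_of_mem_pairCount h
  rw [sub_self, mul_zero] at h2
  exact hm h2.symm

lemma pairCount_zero_le (a b : ZMod p) : pairCount p a b 0 ≤ if a = b then p else 0 := by
  unfold pairCount
  split_ifs with hab
  · have hc : (Finset.univ : Finset (ZMod p)ˣ).card ≤ p := by
      rw [Finset.card_univ, ZMod.card_units_eq_totient]
      exact Nat.totient_le p
    refine le_trans ?_ hc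
    refine Finset.card_le_card_of_injOn Prod.fst (fun _ _ => Finset.mem_coe.2 (Finset.mem_univ _))
      ?_
    rintro ⟨u, v⟩ hq ⟨u', v'⟩ hq' h
    have h' := (Finset.mem_filter.1 (Finset.mem_coe.1 hq)).2
    have h'' := (Finset.mem_filter.1 (Finset.mem_coe.1 hq')).2
    rw [← timesP_zero] at h' h''
    have h1 := (eq_of_mem_pairCount h').1
    have h2 := (eq_of_mem_pairCount h'').1
    simp only at h h1 h2
    subst h1 h2 h
    rfl
  · rw [Nat.le_zero, Finset.card_eq_zero, Finset.filter_eq_empty_iff]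
    rintro ⟨u, v⟩ _ h
    rw [← timesP_zero] at h
    have h2 := (eq_of_mem_pairCount h).2
    exact hab (sub_eq_zero.1 ((mul_eq_zero.1 h2).resolve_left u.ne_zero)).symm

/-- The third moment of the representation function of the subgroup of `p`-th powers. -/
lemma sum_pairCount_pow_three_le (hp : 25600 ≤ p) :
    ∑ z, (pairCount p 0 0 z : ℝ) ^ 3 ≤ 25165824001 * (p : ℝ) ^ 3 * Real.log p := by
  have hp2 : p ≠ 2 := by omega
  rw [sum_eq_sum_units_coords]
  have hlog : 1 ≤ Real.log p := by
    rw [Real.le_log_iff_exp_le (by exact_mod_cast (Fact.out : p.Prime).pos)]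
    have h1 := Real.exp_one_lt_d9
    have h2 : (25600 : ℝ) ≤ p := by exact_mod_cast hp
    linarith
  have h1 : ∑ m : ZMod p, (pairCount p 0 0 (timesP p m) : ℝ) ^ 3 ≤ (p : ℝ) ^ 3 := by
    rw [Finset.sum_eq_single 0]
    · have := pairCount_zero_le (p := p) 0 0
      rw [if_pos rfl] at this
      rw [timesP_zero]
      gcongr
    · intro m _ hm
      rw [pairCount_self_timesP 0 hm]
      norm_num
    · intro h
      exact absurd (Finset.mem_univ _) h
  have h2 : ∑ w : (ZMod p)ˣ, ∑ c : ZMod p,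
      (pairCount p 0 0 (teich p w * (1 - timesP p c)) : ℝ) ^ 3 ≤
      p * (25165824000 * (p : ℝ) ^ 2 * Real.log p) := by
    have h3 : ∀ w : (ZMod p)ˣ, ∑ c : ZMod p,
      (pairCount p 0 0 (teich p w * (1 - timesP p c)) : ℝ) ^ 3 ≤
        25165824000 * (p : ℝ) ^ 2 * Real.log p := by
      intro w
      refine le_trans (le_of_eq ?_) (sum_lineCount_pow_three_le hp 0)
      refine Finset.sum_congr rfl fun c _ => ?_
      rw [pairCount_teich_mul hp2, sub_zero, sub_zero]
    refine (Finset.sum_le_card_nsmul _ _ _ fun w _ => h3 w).trans ?_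
    rw [nsmul_eq_mul, Finset.card_univ, ZMod.card_units_eq_totient]
    gcongr
    exact Nat.totient_le p
  have h3 : (p : ℝ) ^ 3 ≤ (p : ℝ) ^ 3 * Real.log p := le_mul_of_one_le_right (by positivity) hlog
  linarith

end PairCounts

/-! ### Counts over a box of slopes, and incidences with a pencil of lines. -/

section BoxCounts

variable {p : ℕ} [Fact p.Prime]

lemma sum_mul_lineCount (g : ZMod p → ℝ) (d b : ZMod p) :
    ∑ y, g y * (lineCount p d (y - b) : ℝ) =
      ∑ s ∈ Finset.univ.filter (fun s : ZMod p => s ≠ 0 ∧ s ≠ 1),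
        g ((truncLog p).eval s + d * s + b) := by
  have h1 : ∀ y, g y * (lineCount p d (y - b) : ℝ) =
      ∑ s ∈ Finset.univ.filter (fun s : ZMod p => s ≠ 0 ∧ s ≠ 1),
        if y = (truncLog p).eval s + d * s + b then g y else 0 := by
    intro y
    unfold lineCount
    rw [← Finset.sum_filter, Finset.sum_const, nsmul_eq_mul, mul_comm, Finset.filter_filter]
    congr 3
    ext s
    simp only [Finset.mem_filter, Finset.mem_univ, true_and, and_assoc]
    refine and_congr_right fun _ => and_congr_right fun _ => ?_
    rw [eq_sub_iff_add_eq, eq_comm]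
  simp_rw [h1]
  rw [Finset.sum_comm]
  refine Finset.sum_congr rfl fun s _ => ?_
  rw [Finset.sum_ite_eq' Finset.univ _ g, if_pos (Finset.mem_univ _)]

/-- The number of points `(s, i, j)` with `truncLog s + κ i s - κ j (s - 1) = c`. -/
noncomputable def boxCount (p : ℕ) [Fact p.Prime] (κ : ZMod p) (h : ℕ) (c : ZMod p) : ℕ :=
  ∑ j ∈ Finset.range h, ∑ i ∈ Finset.range h, lineCount p (κ * i - κ * j) (c - κ * j)

lemma sum_lineCount_sub (d b : ZMod p) : ∑ c, (lineCount p d (c - b) : ℝ) ≤ p := by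
  have h := sum_mul_lineCount (p := p) (fun _ => 1) d b
  simp only [one_mul] at h
  rw [h, Finset.sum_const, nsmul_eq_mul, mul_one]
  have h1 := Finset.card_filter_le (Finset.univ : Finset (ZMod p)) (fun s => s ≠ 0 ∧ s ≠ 1)
  rw [Finset.card_univ, ZMod.card] at h1
  exact_mod_cast h1

lemma sum_boxCount_le (κ : ZMod p) (h : ℕ) :
    ∑ c, (boxCount p κ h c : ℝ) ≤ (h : ℝ) ^ 2 * p := by
  unfold boxCount
  push_cast
  rw [Finset.sum_comm]
  calc ∑ j ∈ Finset.range h, ∑ c : ZMod p, ∑ i ∈ Finset.range h,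
        (lineCount p (κ * i - κ * j) (c - κ * j) : ℝ)
      ≤ ∑ j ∈ Finset.range h, ∑ i ∈ Finset.range h, (p : ℝ) := by
        refine Finset.sum_le_sum fun j _ => ?_
        rw [Finset.sum_comm]
        exact Finset.sum_le_sum fun i _ => sum_lineCount_sub _ _
    _ = (h : ℝ) ^ 2 * p := by
        simp only [Finset.sum_const, Finset.card_range, nsmul_eq_mul]
        ring

/-- The power mean inequality over the `h^2` pairs of indices reduces this to one pair, where
translating `c` gives a single line count. -/
lemma sum_boxCount_pow_three_le (hp : 25600 ≤ p) (κ : ZMod p) {h : ℕ} :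
    ∑ c, (boxCount p κ h c : ℝ) ^ 3 ≤
      (h : ℝ) ^ 6 * (25165824000 * (p : ℝ) ^ 2 * Real.log p) := by
  have h1 : ∀ c, (boxCount p κ h c : ℝ) ^ 3 ≤ ((h : ℝ) ^ 2) ^ 2 *
      ∑ q ∈ Finset.range h ×ˢ Finset.range h,
        (lineCount p (κ * q.2 - κ * q.1) (c - κ * q.1) : ℝ) ^ 3 := by
    intro c
    have h2 := pow_sum_div_card_le_sum_pow
      (s := Finset.range h ×ˢ Finset.range h)
      (f := fun q => (lineCount p (κ * q.2 - κ * q.1) (c - κ * q.1) : ℝ))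
      (fun q _ => Nat.cast_nonneg _) 2
    rcases Nat.eq_zero_or_pos h with rfl | hpos
    · simp [boxCount]
    have h3 : (0 : ℝ) < ((h : ℝ) ^ 2) ^ 2 := by positivity
    rw [Finset.card_product, Finset.card_range, div_le_iff₀ (by positivity), Finset.sum_product]
      at h2
    unfold boxCount
    push_cast at h2 ⊢
    rw [mul_comm, sq (h : ℝ)]
    exact h2
  calc ∑ c, (boxCount p κ h c : ℝ) ^ 3
      ≤ ∑ c, ((h : ℝ) ^ 2) ^ 2 * ∑ q ∈ Finset.range h ×ˢ Finset.range h,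
        (lineCount p (κ * q.2 - κ * q.1) (c - κ * q.1) : ℝ) ^ 3 :=
        Finset.sum_le_sum fun c _ => h1 c
    _ ≤ ((h : ℝ) ^ 2) ^ 2 * ∑ q ∈ Finset.range h ×ˢ Finset.range h,
          25165824000 * (p : ℝ) ^ 2 * Real.log p := by
        rw [← Finset.mul_sum, Finset.sum_comm]
        gcongr with q _
        have hb : Function.Bijective fun c : ZMod p => c - κ * q.1 :=
          (Equiv.subRight (κ * (q.1 : ZMod p))).bijective
        rw [hb.sum_comp (fun c => (lineCount p (κ * q.2 - κ * q.1) c : ℝ) ^ 3)]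
        exact sum_lineCount_pow_three_le hp _
    _ = (h : ℝ) ^ 6 * (25165824000 * (p : ℝ) ^ 2 * Real.log p) := by
        rw [Finset.sum_const, Finset.card_product, Finset.card_range, nsmul_eq_mul]
        push_cast
        ring

/-- Two points on lines of a pencil determine the lines and the abscissa. -/
lemma sum_pencil_mul_pencil_le {κ : ZMod p} (hκ : κ ≠ 0) {h : ℕ} (hh : h ≤ p) (b : ZMod p)
    {g : ZMod p → ℝ} (hg : ∀ c, 0 ≤ g c) (F : ZMod p → ZMod p) :
    ∑ q ∈ ((Finset.univ.filter (fun s : ZMod p => s ≠ 0 ∧ s ≠ 1)) ×ˢ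
      (Finset.range h ×ˢ Finset.range h)).filter (fun q => q.2.1 ≠ q.2.2),
        g (F q.1 + (κ * q.2.1 - κ * b) * q.1 + κ * b) *
          g (F q.1 + (κ * q.2.2 - κ * b) * q.1 + κ * b) ≤ 2 * h * (∑ c, g c) ^ 2 := by
  have h1 : 2 * h * (∑ c, g c) ^ 2 =
      ∑ r ∈ Finset.range (2 * h) ×ˢ ((Finset.univ : Finset (ZMod p)) ×ˢ Finset.univ),
        g r.2.1 * g r.2.2 := by
    rw [Finset.sum_product]
    simp only [Finset.sum_product, Finset.sum_const, Finset.card_range, nsmul_eq_mul]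
    rw [sq, Finset.sum_mul_sum]
    push_cast
    ring
  rw [h1]
  -- The shift by `h` encodes the difference `i - j` as a natural number below `2h`. The difference
  -- of the two arguments of `g` is `κ (i - j) s`, so it recovers `s` since `i ≠ j`; then `i` is
  -- recovered since `s ≠ 0`.
  set φ : ZMod p × ℕ × ℕ → ℕ × ZMod p × ZMod p := fun q =>
    (q.2.1 + h - q.2.2, F q.1 + (κ * q.2.1 - κ * b) * q.1 + κ * b,
      F q.1 + (κ * q.2.2 - κ * b) * q.1 + κ * b) with hφ
  rw [← Finset.sum_image (g := φ) (f := fun r => g r.2.1 * g r.2.2)]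
  · refine Finset.sum_le_sum_of_subset_of_nonneg ?_ fun _ _ _ => mul_nonneg (hg _) (hg _)
    intro r hr
    obtain ⟨q, hq, rfl⟩ := Finset.mem_image.1 hr
    simp only [Finset.mem_filter, Finset.mem_product, Finset.mem_range] at hq
    simp only [Finset.mem_product, Finset.mem_range, Finset.mem_univ, and_self, and_true, hφ]
    omega
  · rintro ⟨s, i, j⟩ hq ⟨s', i', j'⟩ hq' heq
    simp only [Finset.coe_filter, Finset.mem_product, Finset.mem_filter, Finset.mem_univ, true_and,
      Finset.mem_range, Set.mem_ofPred_eq] at hq hq'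
    obtain ⟨⟨⟨hs0, _⟩, hi, hj⟩, hij⟩ := hq
    obtain ⟨⟨⟨hs0', _⟩, hi', hj'⟩, hij'⟩ := hq'
    simp only [hφ, Prod.mk.injEq] at heq
    obtain ⟨e1, e2, e3⟩ := heq
    have e4 : i + j' = i' + j := by omega
    have e5 : (i : ZMod p) - j = i' - j' := by
      have : ((i + j' : ℕ) : ZMod p) = ((i' + j : ℕ) : ZMod p) := by rw [e4]
      push_cast at this
      linear_combination this
    have cast_inj : ∀ {m n : ℕ}, m < h → n < h → (m : ZMod p) = n → m = n := by
      intro m n hm hn hmn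
      have := (ZMod.natCast_eq_natCast_iff' m n p).1 hmn
      rwa [Nat.mod_eq_of_lt (by omega), Nat.mod_eq_of_lt (by omega)] at this
    have e6 : (i : ZMod p) - j ≠ 0 := fun h0 => hij (cast_inj hi hj (sub_eq_zero.1 h0))
    have e7 : s = s' := by
      have : κ * ((i : ZMod p) - j) * s = κ * ((i : ZMod p) - j) * s' := by
        nth_rewrite 2 [e5]
        linear_combination e2 - e3
      exact mul_left_cancel₀ (mul_ne_zero hκ e6) this
    subst e7
    have e8 : (i : ZMod p) = i' := by
      have : κ * s * (i : ZMod p) = κ * s * i' := by linear_combination e2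
      exact mul_left_cancel₀ (mul_ne_zero hκ hs0) this
    have e9 := cast_inj hi hi' e8
    subst e9
    have e10 : j = j' := by omega
    subst e10
    rfl

/-- The incidence bound for bounded weights on a pencil of lines. -/
lemma sum_mul_lineCount_le {κ : ZMod p} (hκ : κ ≠ 0) {h : ℕ} (hh : h ≤ p) (b : ZMod p)
    {g : ZMod p → ℝ} (hg : ∀ c, 0 ≤ g c) {k : ℝ} (hk : ∀ c, g c ≤ k) :
    ∑ c, g c * ∑ i ∈ Finset.range h, (lineCount p (κ * i - κ * b) (c - κ * b) : ℝ) ≤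
      p * k + √(2 * p * h) * ∑ c, g c := by
  set S := Finset.univ.filter (fun s : ZMod p => s ≠ 0 ∧ s ≠ 1) with hS
  set G : ZMod p → ℕ → ℝ :=
    fun s i => g ((truncLog p).eval s + (κ * i - κ * b) * s + κ * b) with hG
  have hGnn : ∀ s i, 0 ≤ G s i := fun s i => hg _
  have hW : ∑ c, g c * ∑ i ∈ Finset.range h, (lineCount p (κ * i - κ * b) (c - κ * b) : ℝ) =
      ∑ s ∈ S, ∑ i ∈ Finset.range h, G s i := by
    simp_rw [Finset.mul_sum]
    rw [Finset.sum_comm, Finset.sum_comm (s := S)]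
    exact Finset.sum_congr rfl fun i _ => sum_mul_lineCount g _ _
  rw [hW]
  set W := ∑ s ∈ S, ∑ i ∈ Finset.range h, G s i with hWdef
  have hcard : (S.card : ℝ) ≤ p := by
    have h1 := Finset.card_filter_le (Finset.univ : Finset (ZMod p)) (fun s => s ≠ 0 ∧ s ≠ 1)
    rw [Finset.card_univ, ZMod.card] at h1
    exact_mod_cast h1
  -- Cauchy–Schwarz over `s` calls for this second moment. Equal indices cost `k W`, by the upper
  -- bound on the weights; distinct ones are covered by the pencil estimate.
  have hsq : ∑ s ∈ S, (∑ i ∈ Finset.range h, G s i) ^ 2 ≤ k * W + 2 * h * (∑ c, g c) ^ 2 := by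
    have h1 : ∑ s ∈ S, (∑ i ∈ Finset.range h, G s i) ^ 2 =
        ∑ q ∈ S ×ˢ (Finset.range h ×ˢ Finset.range h), G q.1 q.2.1 * G q.1 q.2.2 := by
      rw [Finset.sum_product]
      refine Finset.sum_congr rfl fun s _ => ?_
      rw [sq, Finset.sum_mul_sum, Finset.sum_product]
    rw [h1, ← Finset.sum_filter_add_sum_filter_not _
      (fun q : ZMod p × ℕ × ℕ => q.2.1 ≠ q.2.2), add_comm]
    refine add_le_add ?_ (sum_pencil_mul_pencil_le hκ hh b hg fun s => (truncLog p).eval s)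
    have h2 : ∑ q ∈ (S ×ˢ (Finset.range h ×ˢ Finset.range h)).filter
        (fun q : ZMod p × ℕ × ℕ => ¬ q.2.1 ≠ q.2.2), G q.1 q.2.1 * G q.1 q.2.2 =
        ∑ s ∈ S, ∑ i ∈ Finset.range h, G s i * G s i := by
      rw [Finset.sum_filter, Finset.sum_product]
      refine Finset.sum_congr rfl fun s _ => ?_
      rw [Finset.sum_product]
      refine Finset.sum_congr rfl fun i hi => ?_
      simp only [not_not, Finset.sum_ite_eq, hi, if_true]
    rw [h2, hWdef, Finset.mul_sum]
    refine Finset.sum_le_sum fun s _ => ?_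
    rw [Finset.mul_sum]
    exact Finset.sum_le_sum fun i _ => mul_le_mul_of_nonneg_right (hk _) (hGnn _ _)
  have hW2 : W ^ 2 ≤ p * (k * W + 2 * h * (∑ c, g c) ^ 2) := by
    refine (sq_sum_le_card_mul_sum_sq).trans ?_
    refine mul_le_mul hcard hsq (Finset.sum_nonneg fun s _ => sq_nonneg _) (Nat.cast_nonneg _)
  have hn : 0 ≤ ∑ c, g c := Finset.sum_nonneg fun c _ => hg c
  have hW0 : 0 ≤ W := Finset.sum_nonneg fun s _ => Finset.sum_nonneg fun i _ => hGnn s i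
  have hk0 : 0 ≤ k := (hg 0).trans (hk 0)
  set B := √(2 * p * h) * ∑ c, g c with hB
  have hB0 : 0 ≤ B := mul_nonneg (Real.sqrt_nonneg _) hn
  have hB2 : B ^ 2 = 2 * p * h * (∑ c, g c) ^ 2 := by
    rw [hB, mul_pow, Real.sq_sqrt (by positivity)]
  -- The inequality `W^2 ≤ p k W + B^2` contradicts `W > p k + B`, since `W (W - p k) > B^2`.
  by_contra! hlt
  have hpk : 0 ≤ (p : ℝ) * k := by positivity
  nlinarith

end BoxCounts

lemma one_le_log_of_le {p : ℕ} (hp : 25600 ≤ p) : 1 ≤ Real.log p := by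
  have h2 : (25600 : ℝ) ≤ p := by exact_mod_cast hp
  rw [Real.le_log_iff_exp_le (by linarith)]
  linarith [Real.exp_one_lt_d9]

/-! ### Additive energy of a union of dilates of the group of `p`-th powers. -/

section BoxEnergy

variable {p : ℕ} [Fact p.Prime]

/-- The second moment of the box counting function. -/
lemma sum_boxCount_sq_le (hp : 25600 ≤ p) {κ : ZMod p} (hκ : κ ≠ 0) {h : ℕ} (h0 : 0 < h)
    (hh : h ≤ p) :
    ∑ c, (boxCount p κ h c : ℝ) ^ 2 ≤
      25165824005 * (√p ^ 3 * √h ^ 7 * √(Real.log p)) := by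
  have hlog := one_le_log_of_le hp
  obtain ⟨x, hx⟩ : ∃ x, x = √(p : ℝ) := ⟨_, rfl⟩
  obtain ⟨y, hy⟩ : ∃ y, y = √(h : ℝ) := ⟨_, rfl⟩
  obtain ⟨l, hl⟩ : ∃ l, l = √(Real.log p) := ⟨_, rfl⟩
  have hp0 : (0 : ℝ) < p := by exact_mod_cast (Fact.out : p.Prime).pos
  have hh0 : (0 : ℝ) < h := by exact_mod_cast h0
  have hx2 : (p : ℝ) = x ^ 2 := by rw [hx, Real.sq_sqrt hp0.le]
  have hy2 : (h : ℝ) = y ^ 2 := by rw [hy, Real.sq_sqrt hh0.le]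
  have hl2 : Real.log p = l ^ 2 := by rw [hl, Real.sq_sqrt (by linarith)]
  have hx0 : 0 < x := by rw [hx]; positivity
  have hy0 : 0 < y := by rw [hy]; positivity
  have hl1 : 1 ≤ l := by rw [hl]; exact Real.one_le_sqrt.2 hlog
  rw [← hx, ← hy, ← hl]
  set G : ZMod p → ℝ := fun c => (boxCount p κ h c : ℝ) with hG
  have hG0 : ∀ c, 0 ≤ G c := fun c => Nat.cast_nonneg _
  -- Values below `k1 ≈ √p h^(3/2)` are handled by the first moment, values above `k2 = h^(5/2) (p
  -- log p)^(1/2)` by the third, and those between by the incidence bound. Each range then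
  -- contributes at most the order of `p^(3/2) h^(7/2) (log p)^(1/2)`.
  set k1 := 3 * x * y ^ 3 with hk1
  set k2 := y ^ 5 * x * l with hk2
  have hk10 : 0 < k1 := by positivity
  have hk20 : 0 < k2 := by positivity
  set g : ZMod p → ℝ := fun c => if k1 ≤ G c ∧ G c < k2 then G c else 0 with hg
  have hg0 : ∀ c, 0 ≤ g c := by
    intro c
    simp only [hg]
    split_ifs
    exacts [hG0 c, le_rfl]
  have hgk : ∀ c, g c ≤ k2 := by
    intro c
    simp only [hg]
    split_ifs with hc
    exacts [hc.2.le, hk20.le]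
  have hpt : ∀ c, G c ^ 2 ≤ k1 * G c + g c * G c + G c ^ 3 / k2 := by
    intro c
    have h1 := hG0 c
    have h3 : 0 ≤ G c ^ 3 / k2 := by positivity
    simp only [hg]
    split_ifs with hc
    · nlinarith [mul_nonneg hk10.le h1]
    · rw [not_and_or, not_le, not_lt] at hc
      rcases hc with hc | hc
      · nlinarith
      · have h4 : G c ^ 2 ≤ G c ^ 3 / k2 := by
          rw [le_div_iff₀ hk20]
          nlinarith [sq_nonneg (G c)]
        nlinarith [mul_nonneg hk10.le h1]
  set n := ∑ c, g c with hn
  set S2 := ∑ c, g c * G c with hS2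
  have hS2n : k1 * n ≤ S2 := by
    rw [hn, hS2, Finset.mul_sum]
    refine Finset.sum_le_sum fun c _ => ?_
    simp only [hg]
    split_ifs with hc
    · nlinarith [hc.1, hG0 c]
    · simp
  have hS2le : S2 ≤ y ^ 2 * (x ^ 2 * k2 + √2 * x * y * n) := by
    have h1 : S2 = ∑ j ∈ Finset.range h, ∑ c, g c *
        ∑ i ∈ Finset.range h, (lineCount p (κ * i - κ * j) (c - κ * j) : ℝ) := by
      rw [hS2, Finset.sum_comm]
      refine Finset.sum_congr rfl fun c _ => ?_
      rw [← Finset.mul_sum]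
      simp only [hG, boxCount]
      push_cast
      rfl
    have h2 : √(2 * p * h) = √2 * x * y := by
      rw [Real.sqrt_mul (by positivity), Real.sqrt_mul (by positivity), hx, hy]
    rw [h1]
    refine (Finset.sum_le_sum fun (j : ℕ) _ =>
      sum_mul_lineCount_le hκ hh (j : ZMod p) hg0 hgk).trans (le_of_eq ?_)
    rw [Finset.sum_const]
    rw [Finset.card_range, nsmul_eq_mul, h2, hx2, hy2]
  have hn0 : 0 ≤ n := Finset.sum_nonneg fun c _ => hg0 c
  -- The factor 3 in `k1` makes the second incidence term at most `k1 * n / 2 ≤ S2 / 2`, as `√2 ≤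
  -- 3/2`; it is absorbed on the left.
  have hS2f : S2 ≤ 2 * (y ^ 2 * x ^ 2 * k2) := by
    have h1 : √2 ≤ 3 / 2 := by
      rw [Real.sqrt_le_left (by norm_num)]
      norm_num
    have h2 : y ^ 2 * (√2 * x * y * n) ≤ k1 * n / 2 := by
      calc y ^ 2 * (√2 * x * y * n) = √2 * (x * y ^ 3 * n) := by ring
        _ ≤ 3 / 2 * (x * y ^ 3 * n) := by gcongr
        _ = k1 * n / 2 := by rw [hk1]; ring
    nlinarith
  have h3 : ∑ c, G c ^ 3 / k2 ≤ 25165824000 * (x ^ 3 * y ^ 7 * l) := by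
    rw [← Finset.sum_div, div_le_iff₀ hk20]
    refine (sum_boxCount_pow_three_le hp κ).trans (le_of_eq ?_)
    rw [hl2, hx2, hy2, hk2]
    ring
  have h1 : ∑ c, k1 * G c ≤ 3 * (x ^ 3 * y ^ 7) := by
    rw [← Finset.mul_sum]
    calc k1 * ∑ c, G c ≤ k1 * ((h : ℝ) ^ 2 * p) := by
          gcongr
          exact sum_boxCount_le κ h
      _ = 3 * (x ^ 3 * y ^ 7) := by
          rw [hx2, hy2, hk1]
          ring
  have h4 : x ^ 3 * y ^ 7 ≤ x ^ 3 * y ^ 7 * l := le_mul_of_one_le_right (by positivity) hl1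
  have h5 : S2 ≤ 2 * (x ^ 3 * y ^ 7 * l) := by
    refine hS2f.trans (le_of_eq ?_)
    rw [hk2]
    ring
  have h6 : ∑ c, G c ^ 2 ≤ ∑ c, k1 * G c + S2 + ∑ c, G c ^ 3 / k2 := by
    rw [hS2, ← Finset.sum_add_distrib, ← Finset.sum_add_distrib]
    exact Finset.sum_le_sum fun c _ => hpt c
  linarith

/-- The representation function of differences of
`{teich u (1 - p κ i) : u ≠ 0, 0 ≤ i < h}`. -/
noncomputable def repCount (p : ℕ) [Fact p.Prime] (κ : ZMod p) (h : ℕ) (z : ZMod (p ^ 2)) : ℕ :=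
  ∑ j ∈ Finset.range h, ∑ i ∈ Finset.range h, pairCount p (κ * i) (κ * j) z

lemma repCount_teich_mul (hp2 : p ≠ 2) (κ : ZMod p) (h : ℕ) (w : (ZMod p)ˣ) (c : ZMod p) :
    repCount p κ h (teich p w * (1 - timesP p c)) = boxCount p κ h c := by
  unfold repCount boxCount
  exact Finset.sum_congr rfl fun j _ => Finset.sum_congr rfl fun i _ =>
    pairCount_teich_mul hp2 _ _ _ _

lemma repCount_timesP_le (κ : ZMod p) (h : ℕ) {m : ZMod p} (hm : m ≠ 0) :
    repCount p κ h (timesP p m) ≤ h ^ 2 := by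
  unfold repCount
  refine (Finset.sum_le_card_nsmul _ _ h fun j _ => ?_).trans (by simp [sq])
  refine (Finset.sum_le_card_nsmul _ _ 1 fun i _ => pairCount_timesP_le_one _ _ hm).trans (by simp)

lemma repCount_zero_le {κ : ZMod p} (hκ : κ ≠ 0) {h : ℕ} (hh : h ≤ p) :
    repCount p κ h 0 ≤ h * p := by
  unfold repCount
  refine (Finset.sum_le_card_nsmul _ _ p fun j hj => ?_).trans (by simp)
  calc ∑ i ∈ Finset.range h, pairCount p (κ * i) (κ * j) 0
      ≤ ∑ i ∈ Finset.range h, if i = j then p else 0 := by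
        refine Finset.sum_le_sum fun i hi => (pairCount_zero_le _ _).trans (le_of_eq ?_)
        congr 1
        rw [eq_iff_iff, mul_right_inj' hκ, ZMod.natCast_eq_natCast_iff', Nat.mod_eq_of_lt,
          Nat.mod_eq_of_lt]
        · exact (Finset.mem_range.1 hj).trans_le hh
        · exact (Finset.mem_range.1 hi).trans_le hh
    _ ≤ p := by
        rw [Finset.sum_ite_eq']
        split_ifs; omega

/-- The additive energy of `{teich u (1 - p κ i) : u ≠ 0, 0 ≤ i < h}`. -/
lemma sum_repCount_sq_le (hp : 25600 ≤ p) {κ : ZMod p} (hκ : κ ≠ 0) {h : ℕ} (h0 : 0 < h)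
    (hh : h ≤ p) :
    ∑ z, (repCount p κ h z : ℝ) ^ 2 ≤
      25165824007 * (√p ^ 5 * √h ^ 7 * √(Real.log p)) := by
  have hlog := one_le_log_of_le hp
  have hE := sum_boxCount_sq_le hp hκ h0 hh
  obtain ⟨x, hx⟩ : ∃ x, x = √(p : ℝ) := ⟨_, rfl⟩
  obtain ⟨y, hy⟩ : ∃ y, y = √(h : ℝ) := ⟨_, rfl⟩
  obtain ⟨l, hl⟩ : ∃ l, l = √(Real.log p) := ⟨_, rfl⟩
  have hp0 : (0 : ℝ) < p := by exact_mod_cast (Fact.out : p.Prime).pos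
  have hh0 : (1 : ℝ) ≤ h := by exact_mod_cast h0
  have hx2 : (p : ℝ) = x ^ 2 := by rw [hx, Real.sq_sqrt hp0.le]
  have hy2 : (h : ℝ) = y ^ 2 := by rw [hy, Real.sq_sqrt (by positivity)]
  have hx0 : 0 < x := by rw [hx]; positivity
  have hyx : y ≤ x := by rw [hx, hy]; exact Real.sqrt_le_sqrt (by exact_mod_cast hh)
  have hy1 : 1 ≤ y := by rw [hy]; exact Real.one_le_sqrt.2 hh0
  have hl1 : 1 ≤ l := by rw [hl]; exact Real.one_le_sqrt.2 hlog
  rw [← hx, ← hy, ← hl] at hE ⊢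
  have hx1 : 1 ≤ x := hy1.trans hyx
  rw [sum_eq_sum_units_coords]
  have h1 : ∑ m : ZMod p, (repCount p κ h (timesP p m) : ℝ) ^ 2 ≤ 2 * (x ^ 5 * y ^ 7 * l) := by
    rw [← Finset.add_sum_erase _ _ (Finset.mem_univ (0 : ZMod p))]
    have h2 : (repCount p κ h (timesP p 0) : ℝ) ^ 2 ≤ x ^ 5 * y ^ 7 * l := by
      have h3 : (repCount p κ h 0 : ℝ) ≤ h * p := by exact_mod_cast repCount_zero_le hκ hh
      rw [timesP_zero]
      calc (repCount p κ h 0 : ℝ) ^ 2 ≤ (h * p) ^ 2 := by gcongr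
        _ = x ^ 4 * y ^ 4 * 1 := by rw [hx2, hy2]; ring
        _ ≤ x ^ 5 * y ^ 7 * l := by
          gcongr
          · norm_num
          · norm_num
    have h4 : ∑ m ∈ Finset.univ.erase (0 : ZMod p), (repCount p κ h (timesP p m) : ℝ) ^ 2 ≤
        x ^ 5 * y ^ 7 * l := by
      refine (Finset.sum_le_card_nsmul _ _ (((h : ℝ) ^ 2) ^ 2) fun m hm => ?_).trans ?_
      · have : (repCount p κ h (timesP p m) : ℝ) ≤ (h : ℝ) ^ 2 := by
          exact_mod_cast repCount_timesP_le κ h (Finset.ne_of_mem_erase hm)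
        gcongr
      · rw [nsmul_eq_mul]
        have h5 : ((Finset.univ.erase (0 : ZMod p)).card : ℝ) ≤ p := by
          have := Finset.card_le_univ (Finset.univ.erase (0 : ZMod p))
          rw [ZMod.card] at this
          exact_mod_cast this
        calc ((Finset.univ.erase (0 : ZMod p)).card : ℝ) * ((h : ℝ) ^ 2) ^ 2
            ≤ p * ((h : ℝ) ^ 2) ^ 2 := by gcongr
          _ = x ^ 2 * (y * y ^ 7) * 1 := by rw [hx2, hy2]; ring
          _ ≤ x ^ 2 * (x * y ^ 7) * l := by gcongr
          _ = x ^ 3 * y ^ 7 * l := by ring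
          _ ≤ x ^ 5 * y ^ 7 * l := by
            gcongr
            norm_num
    linarith
  have h6 : ∑ w : (ZMod p)ˣ, ∑ c : ZMod p,
      (repCount p κ h (teich p w * (1 - timesP p c)) : ℝ) ^ 2 ≤
      x ^ 2 * (25165824005 * (x ^ 3 * y ^ 7 * l)) := by
    refine (Finset.sum_le_card_nsmul _ _ (25165824005 * (x ^ 3 * y ^ 7 * l)) fun w _ => ?_).trans ?_
    · simp_rw [repCount_teich_mul (by omega : p ≠ 2)]
      exact hE
    · rw [nsmul_eq_mul, Finset.card_univ, ZMod.card_units_eq_totient, ← hx2]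
      gcongr
      exact Nat.totient_le p
  have h7 : x ^ 2 * (25165824005 * (x ^ 3 * y ^ 7 * l)) = 25165824005 * (x ^ 5 * y ^ 7 * l) := by
    ring
  linarith

end BoxEnergy

/-! ### Characters and Parseval on `ℤ/N`. -/

section FourierZMod

variable {N : ℕ} [NeZero N]

lemma sum_stdAddChar_mul (b : ZMod N) :
    ∑ α : ZMod N, (ZMod.stdAddChar (α * b) : ℂ) = if b = 0 then (N : ℂ) else 0 := by
  rw [AddChar.sum_mulShift b (ZMod.isPrimitive_stdAddChar N), ZMod.card]
  split_ifs <;> simp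

lemma conj_stdAddChar (x : ZMod N) :
    (starRingEnd ℂ) (ZMod.stdAddChar x) = (ZMod.stdAddChar (-x) : ℂ) := by
  rw [AddChar.map_neg_eq_conj]

lemma norm_stdAddChar (x : ZMod N) : ‖(ZMod.stdAddChar x : ℂ)‖ = 1 := by
  rw [ZMod.stdAddChar_apply, Circle.norm_coe]

/-- Parseval's identity on `ℤ/N`. -/
lemma sum_norm_sq_fourier (r : ZMod N → ℂ) :
    ∑ α : ZMod N, ‖∑ z, r z * (ZMod.stdAddChar (α * z) : ℂ)‖ ^ 2 = N * ∑ z, ‖r z‖ ^ 2 := by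
  have h : (∑ α : ZMod N, ((‖∑ z, r z * (ZMod.stdAddChar (α * z) : ℂ)‖ ^ 2 : ℝ) : ℂ)) =
      N * ∑ z, ((‖r z‖ ^ 2 : ℝ) : ℂ) := by
    have h1 : ∀ α : ZMod N, ((‖∑ z, r z * (ZMod.stdAddChar (α * z) : ℂ)‖ ^ 2 : ℝ) : ℂ) =
        ∑ z, ∑ y, r z * (starRingEnd ℂ) (r y) * (ZMod.stdAddChar (α * (z - y)) : ℂ) := by
      intro α
      push_cast
      rw [← Complex.mul_conj', map_sum, Finset.sum_mul_sum]
      refine Finset.sum_congr rfl fun z _ => Finset.sum_congr rfl fun y _ => ?_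
      rw [map_mul (starRingEnd ℂ), conj_stdAddChar, mul_sub, sub_eq_add_neg, AddChar.map_add_eq_mul]
      ring
    simp_rw [h1]
    rw [Finset.sum_comm, Finset.mul_sum]
    refine Finset.sum_congr rfl fun z _ => ?_
    rw [Finset.sum_comm]
    simp_rw [← Finset.mul_sum, sum_stdAddChar_mul, sub_eq_zero]
    simp only [mul_ite, mul_zero, Finset.sum_ite_eq, Finset.mem_univ, if_true]
    push_cast
    rw [← Complex.mul_conj']
    ring
  exact_mod_cast h

end FourierZMod

/-- Cauchy–Schwarz along the fibres of a map. -/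
lemma sq_sum_comp_le {X Z : Type*} [Fintype X] [Fintype Z] [DecidableEq Z] (π : X → Z)
    (F : Z → ℝ) :
    (∑ x, F (π x)) ^ 2 ≤
      ((Finset.univ.filter fun q : X × X => π q.1 = π q.2).card : ℝ) * ∑ z, F z ^ 2 := by
  classical
  set n : Z → ℕ := fun z => (Finset.univ.filter fun x => π x = z).card with hn
  have h1 : ∑ x, F (π x) = ∑ z, (n z : ℝ) * F z := by
    rw [← Finset.sum_fiberwise (s := Finset.univ) (g := π)]
    refine Finset.sum_congr rfl fun z _ => ?_
    rw [Finset.sum_congr rfl fun x hx => by rw [(Finset.mem_filter.1 hx).2], Finset.sum_const,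
      nsmul_eq_mul]
  have h2 : ((Finset.univ.filter fun q : X × X => π q.1 = π q.2).card : ℝ) =
      ∑ z, (n z : ℝ) ^ 2 := by
    rw [Finset.card_eq_sum_card_fiberwise (f := fun q => π q.1) (t := Finset.univ)
      (fun _ _ => Finset.mem_coe.2 (Finset.mem_univ _))]
    push_cast
    refine Finset.sum_congr rfl fun z _ => ?_
    rw [sq, hn, ← Nat.cast_mul, ← Finset.card_product]
    congr 2
    ext q
    simp only [Finset.mem_filter, Finset.mem_univ, true_and, Finset.mem_product]
    constructor
    · rintro ⟨h3, h4⟩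
      exact ⟨h4, h3 ▸ h4⟩
    · rintro ⟨h3, h4⟩
      exact ⟨h3.trans h4.symm, h3⟩
  rw [h1, h2]
  exact Finset.sum_mul_sq_le_sq_mul_sq _ _ _

/-! ### The uniform bound for sums over `p`-th powers. -/

section SupBound

variable {p : ℕ} [Fact p.Prime]

/-- The exponential sum over the subgroup of `p`-th powers modulo `p²`. -/
noncomputable def powerSum (p : ℕ) [Fact p.Prime] (α : ZMod (p ^ 2)) : ℂ :=
  ∑ u : (ZMod p)ˣ, ZMod.stdAddChar (α * teich p u)

lemma powerSum_mul_teich (α : ZMod (p ^ 2)) (w : (ZMod p)ˣ) :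
    powerSum p (α * teich p w) = powerSum p α := by
  unfold powerSum
  rw [← (Group.mulLeft_bijective w).sum_comp fun u : (ZMod p)ˣ =>
    (ZMod.stdAddChar (α * teich p u) : ℂ)]
  refine Finset.sum_congr rfl fun u _ => ?_
  rw [Units.val_mul, teich_mul, mul_assoc]

lemma powerSum_mul_conj (α : ZMod (p ^ 2)) (a b : ZMod p) :
    powerSum p (α * (1 - timesP p a)) * (starRingEnd ℂ) (powerSum p (α * (1 - timesP p b))) =
      ∑ z, (pairCount p a b z : ℂ) * ZMod.stdAddChar (α * z) := by
  unfold powerSum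
  rw [map_sum, Finset.sum_mul_sum, ← Finset.sum_product',
    ← Finset.sum_fiberwise (s := Finset.univ ×ˢ Finset.univ) (g := fun q : (ZMod p)ˣ × (ZMod p)ˣ =>
      teich p q.1 * (1 - timesP p a) - teich p q.2 * (1 - timesP p b))]
  refine Finset.sum_congr rfl fun z _ => ?_
  unfold pairCount
  rw [← nsmul_eq_mul, ← Finset.sum_const, Finset.univ_product_univ]
  refine Finset.sum_congr rfl fun q hq => ?_
  rw [conj_stdAddChar, ← AddChar.map_add_eq_mul, ← (Finset.mem_filter.1 hq).2]
  congr 1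
  ring

lemma norm_powerSum_sq (α : ZMod (p ^ 2)) :
    ((‖powerSum p α‖ ^ 2 : ℝ) : ℂ) = ∑ z, (pairCount p 0 0 z : ℂ) * ZMod.stdAddChar (α * z) := by
  have h := powerSum_mul_conj (p := p) α 0 0
  rw [timesP_zero, sub_zero, mul_one] at h
  rw [← h, Complex.mul_conj']
  push_cast
  rfl

lemma sum_norm_powerSum_sq_mul (y : ZMod (p ^ 2)) :
    ∑ ξ, ((‖powerSum p ξ‖ ^ 2 : ℝ) : ℂ) * ZMod.stdAddChar (-(ξ * y)) =
      (p : ℂ) ^ 2 * (pairCount p 0 0 y : ℂ) := by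
  simp_rw [norm_powerSum_sq, Finset.sum_mul]
  rw [Finset.sum_comm]
  have h : ∀ z, ∑ ξ : ZMod (p ^ 2), (pairCount p 0 0 z : ℂ) * ZMod.stdAddChar (ξ * z) *
      ZMod.stdAddChar (-(ξ * y)) = if z = y then (p : ℂ) ^ 2 * (pairCount p 0 0 y : ℂ) else 0 := by
    intro z
    simp_rw [mul_assoc, ← AddChar.map_add_eq_mul, ← sub_eq_add_neg, ← mul_sub]
    rw [← Finset.mul_sum, sum_stdAddChar_mul]
    simp only [sub_eq_zero]
    split_ifs with h1
    · rw [h1]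
      push_cast
      ring
    · simp
  simp_rw [h]
  rw [Finset.sum_ite_eq' Finset.univ y, if_pos (Finset.mem_univ _)]

/-- The function `‖powerSum‖^2` is the Fourier transform of the representation function. Expanding
only the third factor and inverting the other two gives the cube. -/
lemma sum_norm_powerSum_triple :
    ∑ r : ZMod (p ^ 2) × ZMod (p ^ 2),
      (‖powerSum p r.1‖ * ‖powerSum p r.2‖ * ‖powerSum p (r.1 + r.2)‖) ^ 2 =
      (p : ℝ) ^ 4 * ∑ z, (pairCount p 0 0 z : ℝ) ^ 3 := by
  have hconj : ∀ α : ZMod (p ^ 2), ((‖powerSum p α‖ ^ 2 : ℝ) : ℂ) =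
      ∑ z, (pairCount p 0 0 z : ℂ) * ZMod.stdAddChar (-(α * z)) := by
    intro α
    rw [← Complex.conj_ofReal, norm_powerSum_sq, map_sum]
    refine Finset.sum_congr rfl fun z _ => ?_
    rw [map_mul, conj_stdAddChar, Complex.conj_natCast]
  have h : ∑ r : ZMod (p ^ 2) × ZMod (p ^ 2), ((‖powerSum p r.1‖ ^ 2 : ℝ) : ℂ) *
      ((‖powerSum p r.2‖ ^ 2 : ℝ) : ℂ) * ((‖powerSum p (r.1 + r.2)‖ ^ 2 : ℝ) : ℂ) =
      (p : ℂ) ^ 4 * ∑ z, (pairCount p 0 0 z : ℂ) ^ 3 := by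
    simp_rw [hconj (_ + _), Finset.mul_sum]
    rw [Finset.sum_comm]
    refine Finset.sum_congr rfl fun z _ => ?_
    have h1 := sum_norm_powerSum_sq_mul (p := p) z
    calc ∑ r : ZMod (p ^ 2) × ZMod (p ^ 2), ((‖powerSum p r.1‖ ^ 2 : ℝ) : ℂ) *
          ((‖powerSum p r.2‖ ^ 2 : ℝ) : ℂ) *
            ((pairCount p 0 0 z : ℂ) * ZMod.stdAddChar (-((r.1 + r.2) * z)))
        = (∑ ξ, ((‖powerSum p ξ‖ ^ 2 : ℝ) : ℂ) * ZMod.stdAddChar (-(ξ * z))) *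
          (∑ ξ, ((‖powerSum p ξ‖ ^ 2 : ℝ) : ℂ) * ZMod.stdAddChar (-(ξ * z))) *
            (pairCount p 0 0 z : ℂ) := by
          rw [Finset.sum_mul_sum, ← Finset.sum_product', Finset.sum_mul,
            Finset.univ_product_univ]
          refine Finset.sum_congr rfl fun r _ => ?_
          rw [add_mul, neg_add, AddChar.map_add_eq_mul]
          ring
      _ = (p : ℂ) ^ 4 * (pairCount p 0 0 z : ℂ) ^ 3 := by
          rw [h1]
          ring
  simp_rw [mul_pow]
  exact_mod_cast h

/-- Two triples collide exactly when their coordinates differ by one common `z`, which gives three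
representations of the same difference. -/
lemma card_collisions_le {b : ZMod (p ^ 2)} (hb : IsUnit b) :
    (Finset.univ.filter fun q : ((ZMod p)ˣ × (ZMod p)ˣ × (ZMod p)ˣ) ×
      ((ZMod p)ˣ × (ZMod p)ˣ × (ZMod p)ˣ) =>
        (b * (teich p q.1.1 - teich p q.1.2.1), b * (teich p q.1.2.1 - teich p q.1.2.2)) =
        (b * (teich p q.2.1 - teich p q.2.2.1), b * (teich p q.2.2.1 - teich p q.2.2.2))).card ≤
      ∑ z, pairCount p 0 0 z ^ 3 := by
  set R : ZMod (p ^ 2) → Finset ((ZMod p)ˣ × (ZMod p)ˣ) := fun z =>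
    Finset.univ.filter fun q : (ZMod p)ˣ × (ZMod p)ˣ =>
      teich p q.1 * (1 - timesP p 0) - teich p q.2 * (1 - timesP p 0) = z with hR
  have h1 : ∑ z, pairCount p 0 0 z ^ 3 =
      (Finset.univ.sigma fun z => R z ×ˢ R z ×ˢ R z).card := by
    rw [Finset.card_sigma]
    refine Finset.sum_congr rfl fun z _ => ?_
    rw [Finset.card_product, Finset.card_product]
    simp only [hR, pairCount]
    ring
  rw [h1]
  refine Finset.card_le_card_of_injOn (fun q => ⟨teich p q.1.1 - teich p q.2.1,
    ((q.1.1, q.2.1), (q.1.2.1, q.2.2.1), (q.1.2.2, q.2.2.2))⟩) ?_ ?_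
  · rintro ⟨⟨x, y, z⟩, ⟨x', y', z'⟩⟩ hq
    simp only [Finset.coe_filter, Set.mem_ofPred_eq, Finset.mem_univ, true_and, Prod.mk.injEq,
      hb.mul_right_inj] at hq
    simp only [Finset.coe_sigma, Set.mem_sigma_iff, Finset.mem_coe, Finset.mem_univ, true_and,
      Finset.mem_product, hR, Finset.mem_filter, timesP_zero, sub_zero, mul_one]
    obtain ⟨e1, e2⟩ := hq
    refine ⟨?_, ?_⟩
    · linear_combination -e1
    · linear_combination -e1 - e2
  · rintro ⟨⟨x, y, z⟩, ⟨x', y', z'⟩⟩ _ ⟨⟨x1, y1, z1⟩, ⟨x1', y1', z1'⟩⟩ _ h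
    simp only [Sigma.mk.injEq, heq_eq_eq, Prod.mk.injEq] at h
    obtain ⟨_, ⟨rfl, rfl⟩, ⟨rfl, rfl⟩, rfl, rfl⟩ := h
    rfl

lemma sum_triple_powerSum_le {b : ZMod (p ^ 2)} (hb : IsUnit b) :
    ∑ q : (ZMod p)ˣ × (ZMod p)ˣ × (ZMod p)ˣ,
      ‖powerSum p (b * (teich p q.1 - teich p q.2.1))‖ *
        ‖powerSum p (b * (teich p q.2.1 - teich p q.2.2))‖ *
        ‖powerSum p (b * (teich p q.1 - teich p q.2.2))‖ ≤
      (p : ℝ) ^ 2 * ∑ z, (pairCount p 0 0 z : ℝ) ^ 3 := by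
  have h := sq_sum_comp_le (fun q : (ZMod p)ˣ × (ZMod p)ˣ × (ZMod p)ˣ =>
    (b * (teich p q.1 - teich p q.2.1), b * (teich p q.2.1 - teich p q.2.2)))
    (fun r : ZMod (p ^ 2) × ZMod (p ^ 2) =>
      ‖powerSum p r.1‖ * ‖powerSum p r.2‖ * ‖powerSum p (r.1 + r.2)‖)
  rw [sum_norm_powerSum_triple] at h
  simp only [← mul_add, sub_add_sub_cancel] at h
  have h2 : ((Finset.univ.filter fun q : ((ZMod p)ˣ × (ZMod p)ˣ × (ZMod p)ˣ) ×
      ((ZMod p)ˣ × (ZMod p)ˣ × (ZMod p)ˣ) =>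
        (b * (teich p q.1.1 - teich p q.1.2.1), b * (teich p q.1.2.1 - teich p q.1.2.2)) =
        (b * (teich p q.2.1 - teich p q.2.2.1),
          b * (teich p q.2.2.1 - teich p q.2.2.2))).card : ℝ) ≤
      ∑ z, (pairCount p 0 0 z : ℝ) ^ 3 := by
    exact_mod_cast card_collisions_le hb
  refine (sq_le_sq₀ (by positivity) (by positivity)).1 ?_
  refine h.trans ((mul_le_mul_of_nonneg_right h2 (by positivity)).trans (le_of_eq ?_))
  ring

/-- After opening the inner sum over `w`, invariance under the group makes the sum over `x`
independent of `w`. -/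
lemma sum_mul_teich_sub (b : ZMod (p ^ 2)) (y : (ZMod p)ˣ) :
    ∑ x : (ZMod p)ˣ, powerSum p (b * (teich p x - teich p y)) =
      powerSum p b * (starRingEnd ℂ) (powerSum p b) := by
  have h1 : ∀ x : (ZMod p)ˣ, powerSum p (b * (teich p x - teich p y)) =
      ∑ w : (ZMod p)ˣ, (ZMod.stdAddChar (b * teich p w * teich p x) : ℂ) *
        ZMod.stdAddChar (-(b * teich p y * teich p w)) := by
    intro x
    unfold powerSum
    refine Finset.sum_congr rfl fun w _ => ?_
    rw [← AddChar.map_add_eq_mul]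
    congr 1
    ring
  simp_rw [h1]
  rw [Finset.sum_comm]
  simp_rw [← Finset.sum_mul]
  have h2 : ∀ w : (ZMod p)ˣ, ∑ x : (ZMod p)ˣ,
      (ZMod.stdAddChar (b * teich p w * teich p x) : ℂ) = powerSum p b :=
    fun w => powerSum_mul_teich b w
  simp_rw [h2]
  rw [← Finset.mul_sum, ← powerSum_mul_teich b y]
  unfold powerSum
  rw [map_sum]
  simp_rw [conj_stdAddChar]

/-- A sixth power bound for the exponential sum over `p`-th powers in terms of the third moment
of the representation function. -/
lemma norm_powerSum_pow_six_le {b : ZMod (p ^ 2)} (hb : IsUnit b) :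
    ‖powerSum p b‖ ^ 6 ≤ (p : ℝ) ^ 2 * ∑ z, (pairCount p 0 0 z : ℝ) ^ 3 := by
  set t : ℝ := (Fintype.card (ZMod p)ˣ : ℝ) with ht
  have ht0 : 0 < t := by
    rw [ht]
    exact_mod_cast Fintype.card_pos
  -- The total of `A` is `t |S|^2 S` with `S = powerSum p b`. Its mean square is a cyclic triple
  -- correlation of `powerSum`, to which `sum_triple_powerSum_le` applies. Cauchy–Schwarz over the
  -- `t^2` pairs turns this into a bound for `|S|^6` without loss in `t`.
  set A : (ZMod p)ˣ × (ZMod p)ˣ → ℂ := fun q => ∑ y : (ZMod p)ˣ,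
    powerSum p (b * (teich p q.1 - teich p y)) * ZMod.stdAddChar (b * teich p y * teich p q.2)
    with hA
  have hsum : ∑ q, A q = t * (powerSum p b ^ 2 * (starRingEnd ℂ) (powerSum p b)) := by
    rw [Fintype.sum_prod_type, Finset.sum_comm]
    have h1 : ∀ v : (ZMod p)ˣ, ∑ x, A (x, v) =
        powerSum p b ^ 2 * (starRingEnd ℂ) (powerSum p b) := by
      intro v
      simp only [hA]
      rw [Finset.sum_comm]
      simp_rw [← Finset.sum_mul, sum_mul_teich_sub, ← Finset.mul_sum]
      have h2 : ∑ y : (ZMod p)ˣ, (ZMod.stdAddChar (b * teich p y * teich p v) : ℂ) =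
          powerSum p b := by
        rw [← powerSum_mul_teich b v]
        unfold powerSum
        refine Finset.sum_congr rfl fun y _ => ?_
        rw [mul_right_comm]
      rw [h2]
      ring
    simp_rw [h1]
    rw [Finset.sum_const, nsmul_eq_mul, ht, Finset.card_univ]
    push_cast
    ring
  have hupper : ∑ q, ‖A q‖ ^ 2 ≤ (p : ℝ) ^ 2 * ∑ z, (pairCount p 0 0 z : ℝ) ^ 3 := by
    have h1 : ((∑ q, ‖A q‖ ^ 2 : ℝ) : ℂ) = ∑ q : (ZMod p)ˣ × (ZMod p)ˣ × (ZMod p)ˣ,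
        powerSum p (b * (teich p q.1 - teich p q.2.1)) *
        powerSum p (b * (teich p q.2.1 - teich p q.2.2)) *
        (starRingEnd ℂ) (powerSum p (b * (teich p q.1 - teich p q.2.2))) := by
      push_cast
      rw [Fintype.sum_prod_type, Fintype.sum_prod_type]
      refine Finset.sum_congr rfl fun x _ => ?_
      rw [Fintype.sum_prod_type]
      simp only [hA]
      simp_rw [← Complex.mul_conj', map_sum, Finset.sum_mul_sum]
      rw [Finset.sum_comm]
      refine Finset.sum_congr rfl fun y _ => ?_
      rw [Finset.sum_comm]
      refine Finset.sum_congr rfl fun y' _ => ?_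
      have hmid : powerSum p (b * (teich p y - teich p y')) = ∑ v : (ZMod p)ˣ,
          (ZMod.stdAddChar (b * teich p y * teich p v) : ℂ) *
            ZMod.stdAddChar (-(b * teich p y' * teich p v)) := by
        unfold powerSum
        refine Finset.sum_congr rfl fun v _ => ?_
        rw [← AddChar.map_add_eq_mul]
        congr 1
        ring
      rw [hmid, mul_right_comm, Finset.mul_sum]
      refine Finset.sum_congr rfl fun v _ => ?_
      rw [map_mul (starRingEnd ℂ), conj_stdAddChar]
      ring
    have h2 : ∑ q, ‖A q‖ ^ 2 = ‖((∑ q, ‖A q‖ ^ 2 : ℝ) : ℂ)‖ := by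
      rw [Complex.norm_real, Real.norm_of_nonneg (by positivity)]
    rw [h2, h1]
    refine (norm_sum_le _ _).trans (le_trans (le_of_eq ?_) (sum_triple_powerSum_le hb))
    refine Finset.sum_congr rfl fun q _ => ?_
    rw [norm_mul, norm_mul, RCLike.norm_conj]
  have h3 : ‖∑ q, A q‖ ^ 2 ≤ t ^ 2 * ∑ q, ‖A q‖ ^ 2 := by
    calc ‖∑ q, A q‖ ^ 2 ≤ (∑ q, ‖A q‖) ^ 2 := by
          gcongr
          exact norm_sum_le _ _
      _ ≤ ((Finset.univ : Finset ((ZMod p)ˣ × (ZMod p)ˣ)).card : ℝ) * ∑ q, ‖A q‖ ^ 2 :=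
          sq_sum_le_card_mul_sum_sq
      _ = t ^ 2 * ∑ q, ‖A q‖ ^ 2 := by
          rw [Finset.card_univ, Fintype.card_prod, ht]
          push_cast
          ring
  rw [hsum, norm_mul, norm_mul, norm_pow, RCLike.norm_conj, Complex.norm_real,
    Real.norm_of_nonneg ht0.le] at h3
  have h4 : t ^ 2 * ‖powerSum p b‖ ^ 6 ≤ t ^ 2 * ∑ q, ‖A q‖ ^ 2 := by
    refine le_trans (le_of_eq ?_) h3
    ring
  exact (le_of_mul_le_mul_left h4 (by positivity)).trans hupper

end SupBound

/-! ### Fourth moments of shifted exponential sums. -/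

section FourthMoment

variable {p : ℕ} [Fact p.Prime]

lemma isUnit_of_redP_ne_zero {α : ZMod (p ^ 2)} (h : redP p α ≠ 0) : IsUnit α := by
  obtain ⟨n, rfl⟩ := ZMod.natCast_zmod_surjective α
  rw [ZMod.isUnit_iff_coprime]
  refine Nat.Coprime.pow_right 2 (Nat.Coprime.symm ?_)
  rw [(Fact.out : p.Prime).coprime_iff_not_dvd, ← ZMod.natCast_eq_zero_iff]
  rwa [map_natCast] at h

lemma redP_add_timesP (a : ZMod (p ^ 2)) (b : ZMod p) : redP p (a + timesP p b) = redP p a := by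
  rw [map_add, redP_timesP, add_zero]

/-- The pointwise bound for the exponential sum over `p`-th powers. -/
lemma norm_powerSum_pow_six_le_log (hp : 25600 ≤ p) {α : ZMod (p ^ 2)} (hα : redP p α ≠ 0) :
    ‖powerSum p α‖ ^ 6 ≤ 25165824001 * (p : ℝ) ^ 5 * Real.log p := by
  refine (norm_powerSum_pow_six_le (isUnit_of_redP_ne_zero hα)).trans ?_
  calc (p : ℝ) ^ 2 * ∑ z, (pairCount p 0 0 z : ℝ) ^ 3
      ≤ (p : ℝ) ^ 2 * (25165824001 * (p : ℝ) ^ 3 * Real.log p) := by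
        gcongr
        exact sum_pairCount_pow_three_le hp
    _ = 25165824001 * (p : ℝ) ^ 5 * Real.log p := by ring

/-- The squared modulus is a Fourier transform whose coefficients are at most `repCount` in absolute
value, since `|θ| ≤ 1`; Parseval then gives the additive energy. -/
lemma sum_norm_pow_four_le_repCount (κ : ZMod p) (h : ℕ) {θ : ℕ → ℂ} (hθ : ∀ j, ‖θ j‖ ≤ 1) :
    ∑ α, ‖∑ j ∈ Finset.range h, θ j * powerSum p (α * (1 - timesP p (κ * j)))‖ ^ 4 ≤
      (p : ℝ) ^ 2 * ∑ z, (repCount p κ h z : ℝ) ^ 2 := by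
  set r : ZMod (p ^ 2) → ℂ := fun z => ∑ j ∈ Finset.range h, ∑ i ∈ Finset.range h,
    θ i * (starRingEnd ℂ) (θ j) * (pairCount p (κ * i) (κ * j) z : ℂ) with hr
  have h1 : ∀ α : ZMod (p ^ 2),
      ‖∑ j ∈ Finset.range h, θ j * powerSum p (α * (1 - timesP p (κ * j)))‖ ^ 4 =
        ‖∑ z, r z * (ZMod.stdAddChar (α * z) : ℂ)‖ ^ 2 := by
    intro α
    set Φ := ∑ j ∈ Finset.range h, θ j * powerSum p (α * (1 - timesP p (κ * j))) with hΦ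
    have h2 : Φ * (starRingEnd ℂ) Φ = ∑ z, r z * (ZMod.stdAddChar (α * z) : ℂ) := by
      simp only [hr]
      simp_rw [Finset.sum_mul]
      rw [Finset.sum_comm, hΦ, map_sum, Finset.sum_mul_sum, Finset.sum_comm]
      refine Finset.sum_congr rfl fun j _ => ?_
      rw [Finset.sum_comm]
      refine Finset.sum_congr rfl fun i _ => ?_
      simp_rw [mul_assoc (θ i * _)]
      rw [← Finset.mul_sum, ← powerSum_mul_conj, map_mul]
      ring
    rw [← h2, norm_mul, RCLike.norm_conj]
    ring
  simp_rw [h1]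
  rw [sum_norm_sq_fourier]
  push_cast
  gcongr with z _
  unfold repCount
  push_cast
  refine (norm_sum_le _ _).trans (Finset.sum_le_sum fun j _ => ?_)
  refine (norm_sum_le _ _).trans (Finset.sum_le_sum fun i _ => ?_)
  rw [norm_mul, norm_mul, RCLike.norm_conj, Complex.norm_natCast]
  refine mul_le_of_le_one_left (Nat.cast_nonneg _) ?_
  exact mul_le_one₀ (hθ i) (norm_nonneg _) (hθ j)

/-- A fourth moment estimate for linear combinations of shifted exponential sums. -/
lemma sum_norm_shifted_pow_four_le (hp : 25600 ≤ p) {a : ZMod (p ^ 2)} (ha : redP p a ≠ 0)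
    {h : ℕ} (h0 : 0 < h) (hh : h ≤ p) {θ : ℕ → ℂ} (hθ : ∀ j, ‖θ j‖ ≤ 1) :
    ∑ b : ZMod p, ‖∑ j ∈ Finset.range h, θ j * powerSum p (a + timesP p (b + j))‖ ^ 4 ≤
      50331648014 * (√p ^ 7 * √h ^ 7 * √(Real.log p)) := by
  -- With this `κ`, the dilation by `1 - p κ j` moves the frequency `a + p b` to `a + p (b + j)`, up
  -- to a factor in the group that `powerSum` ignores.
  set κ : ZMod p := -(redP p a)⁻¹ with hκdef
  have hκ : κ ≠ 0 := neg_ne_zero.2 (inv_ne_zero ha)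
  set Φ : ZMod (p ^ 2) → ℝ := fun α =>
    ‖∑ j ∈ Finset.range h, θ j * powerSum p (α * (1 - timesP p (κ * j)))‖ ^ 4 with hΦ
  set E := ∑ b : ZMod p, ‖∑ j ∈ Finset.range h, θ j * powerSum p (a + timesP p (b + j))‖ ^ 4
    with hE
  have h1 : ∑ α, Φ α ≤ (p : ℝ) ^ 2 * (25165824007 * (√p ^ 5 * √h ^ 7 * √(Real.log p))) :=
    (sum_norm_pow_four_le_repCount κ h hθ).trans
      (mul_le_mul_of_nonneg_left (sum_repCount_sq_le hp hκ h0 hh) (by positivity))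
  have h2 : ∑ α, Φ (a * α) = ∑ α, Φ α :=
    (IsUnit.isUnit_iff_mulLeft_bijective.1 (isUnit_of_redP_ne_zero ha)).sum_comp Φ
  have h3 : ∀ (w : (ZMod p)ˣ) (c : ZMod p), Φ (a * (teich p w * (1 - timesP p c))) =
      ‖∑ j ∈ Finset.range h, θ j * powerSum p (a + timesP p (-(redP p a * c) + j))‖ ^ 4 := by
    intro w c
    simp only [hΦ]
    congr 2
    refine Finset.sum_congr rfl fun j _ => ?_
    congr 1
    have h4 : a * (teich p w * (1 - timesP p c)) * (1 - timesP p (κ * j)) =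
        (a + timesP p (-(redP p a * c) + j)) * teich p w := by
      have h5 := timesP_mul_timesP (p := p) c (κ * j)
      have h6 := mul_timesP (p := p) a c
      have h7 : a * timesP p (κ * j) = -timesP p j := by
        rw [mul_timesP, ← mul_assoc, hκdef, mul_neg, mul_inv_cancel₀ ha, neg_one_mul, timesP_neg]
      rw [timesP_add, timesP_neg]
      linear_combination (a * teich p w) * h5 - teich p w * h6 - teich p w * h7
    rw [h4, powerSum_mul_teich]
  -- In the full fourth moment each of the `p - 1` classes `teich w` repeats the same sum over `b`.
  -- Non-units only add nonnegative terms.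
  have h4 : ((Fintype.card (ZMod p)ˣ : ℕ) : ℝ) * E ≤ ∑ α, Φ α := by
    rw [← h2, sum_eq_sum_units_coords]
    have h5 : ∀ w : (ZMod p)ˣ, ∑ c, Φ (a * (teich p w * (1 - timesP p c))) = E := by
      intro w
      have hb : Function.Bijective fun c : ZMod p => -(redP p a * c) :=
        (Equiv.neg (ZMod p)).bijective.comp (mulLeft_bijective₀ _ ha)
      rw [hE, ← hb.sum_comp fun b : ZMod p =>
        ‖∑ j ∈ Finset.range h, θ j * powerSum p (a + timesP p (b + j))‖ ^ 4]
      exact Finset.sum_congr rfl fun c _ => h3 w c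
    simp_rw [h5]
    rw [Finset.sum_const, nsmul_eq_mul, Finset.card_univ]
    refine le_add_of_nonneg_left (Finset.sum_nonneg fun m _ => ?_)
    simp only [hΦ]
    positivity
  have hp0 : (0 : ℝ) < p := by exact_mod_cast (Fact.out : p.Prime).pos
  have hcard : (p : ℝ) ≤ 2 * ((Fintype.card (ZMod p)ˣ : ℕ) : ℝ) := by
    rw [ZMod.card_units_eq_totient, Nat.totient_prime (Fact.out : p.Prime)]
    exact_mod_cast (by omega : p ≤ 2 * (p - 1))
  have hE0 : 0 ≤ E := by positivity
  have hx2 : (p : ℝ) = √p ^ 2 := (Real.sq_sqrt hp0.le).symm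
  have h5 : (p : ℝ) * E ≤ p * (50331648014 * (√p ^ 7 * √h ^ 7 * √(Real.log p))) := by
    calc (p : ℝ) * E ≤ 2 * ((Fintype.card (ZMod p)ˣ : ℕ) : ℝ) * E := by gcongr
      _ = 2 * (((Fintype.card (ZMod p)ˣ : ℕ) : ℝ) * E) := by ring
      _ ≤ 2 * ((p : ℝ) ^ 2 * (25165824007 * (√p ^ 5 * √h ^ 7 * √(Real.log p)))) := by
          have := h4.trans h1
          linarith
      _ = p * (50331648014 * ((p : ℝ) * √p ^ 5 * √h ^ 7 * √(Real.log p))) := by ring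
      _ = p * (50331648014 * (√p ^ 7 * √h ^ 7 * √(Real.log p))) := by
          congr 2
          nth_rewrite 1 [hx2]
          ring
  exact le_of_mul_le_mul_left h5 hp0

end FourthMoment

/-! ### Hölder with exponents `4/3` and `4`, and cube roots. -/

section Hoelder

/-- Hölder's inequality with exponents `4/3` and `4`. -/
lemma sum_pow_three_mul_pow_four_le {ι : Type*} (s : Finset ι) (φ X : ι → ℝ) :
    (∑ b ∈ s, φ b ^ 3 * X b) ^ 4 ≤ (∑ b ∈ s, φ b ^ 4) ^ 3 * ∑ b ∈ s, X b ^ 4 := by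
  have h1 := Finset.sum_mul_sq_le_sq_mul_sq s (fun b => φ b ^ 2) (fun b => φ b * X b)
  have h2 := Finset.sum_mul_sq_le_sq_mul_sq s (fun b => φ b ^ 2) (fun b => X b ^ 2)
  have e1 : ∑ b ∈ s, φ b ^ 2 * (φ b * X b) = ∑ b ∈ s, φ b ^ 3 * X b :=
    Finset.sum_congr rfl fun b _ => by ring
  have e2 : ∑ b ∈ s, (φ b ^ 2) ^ 2 = ∑ b ∈ s, φ b ^ 4 :=
    Finset.sum_congr rfl fun b _ => by ring
  have e3 : ∑ b ∈ s, (φ b * X b) ^ 2 = ∑ b ∈ s, φ b ^ 2 * X b ^ 2 :=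
    Finset.sum_congr rfl fun b _ => by ring
  have e4 : ∑ b ∈ s, (X b ^ 2) ^ 2 = ∑ b ∈ s, X b ^ 4 :=
    Finset.sum_congr rfl fun b _ => by ring
  rw [e1, e2, e3] at h1
  rw [e2, e4] at h2
  set P := ∑ b ∈ s, φ b ^ 4
  set Q := ∑ b ∈ s, φ b ^ 2 * X b ^ 2
  have hP : 0 ≤ P := Finset.sum_nonneg fun b _ => by positivity
  calc (∑ b ∈ s, φ b ^ 3 * X b) ^ 4 = ((∑ b ∈ s, φ b ^ 3 * X b) ^ 2) ^ 2 := by ring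
    _ ≤ (P * Q) ^ 2 := pow_le_pow_left₀ (sq_nonneg _) h1 2
    _ = P ^ 2 * Q ^ 2 := by ring
    _ ≤ P ^ 2 * (P * ∑ b ∈ s, X b ^ 4) := by gcongr
    _ = P ^ 3 * ∑ b ∈ s, X b ^ 4 := by ring

/-- The real cube root of a nonnegative number. -/
lemma exists_cube_root {x : ℝ} (hx : 0 ≤ x) : ∃ y : ℝ, 0 ≤ y ∧ y ^ 3 = x :=
  ⟨x ^ ((1 : ℝ) / 3), by positivity, by
    rw [← Real.rpow_natCast, ← Real.rpow_mul hx]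
    norm_num⟩

/-- This is the comparison of `n^(-4/3)` with the integral of `x^(-4/3)`, written with cube roots so
that the tail telescopes. -/
lemma inv_pow_four_le_telescope {a b : ℝ} (ha : 0 < a) (hab : b ^ 3 = a ^ 3 + 1) :
    (b ^ 4)⁻¹ ≤ 3 * (a⁻¹ - b⁻¹) := by
  have hb3 : a ^ 3 < b ^ 3 := by linarith
  have hba : a < b := by
    by_contra! hle
    rcases le_or_gt 0 b with h0 | h0
    · exact absurd (pow_le_pow_left₀ h0 hle 3) (not_le.2 hb3)
    · have : b ^ 3 < 0 := Odd.pow_neg (by decide) h0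
      have : 0 < a ^ 3 := by positivity
      linarith
  have hb : 0 < b := ha.trans hba
  have h1 : (b - a) * (a ^ 2 + a * b + b ^ 2) = 1 := by linear_combination hab
  have h2 : a ^ 2 + a * b + b ^ 2 ≤ 3 * b ^ 2 := by nlinarith
  have h3 : 1 ≤ (b - a) * (3 * b ^ 2) := by
    rw [← h1]
    exact mul_le_mul_of_nonneg_left h2 (by linarith)
  have h4 : 3 * (a⁻¹ - b⁻¹) = 3 * (b - a) / (a * b) := by
    field_simp
  rw [h4, le_div_iff₀ (by positivity), inv_mul_le_iff₀ (by positivity)]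
  calc a * b ≤ b * b * 1 := by nlinarith
    _ ≤ b * b * ((b - a) * (3 * b ^ 2)) := by gcongr
    _ = b ^ 4 * (3 * (b - a)) := by ring

lemma sum_inv_cube_root_pow_four_le {r : ℕ → ℝ} (hr0 : ∀ n, 0 ≤ r n)
    (hr : ∀ n, r n ^ 3 = n) {T : ℕ} (hT : 0 < T) (m : ℕ) :
    ∑ n ∈ Finset.range m, (r (T + n + 1) ^ 4)⁻¹ ≤ 3 * (r T)⁻¹ := by
  have hpos : ∀ n, 0 < n → 0 < r n := by
    intro n hn
    refine lt_of_le_of_ne (hr0 n) fun h => ?_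
    have h1 := hr n
    rw [← h] at h1
    have h2 : (n : ℝ) ≠ 0 := by exact_mod_cast hn.ne'
    exact h2 (by rw [← h1]; norm_num)
  have h : ∀ m, ∑ n ∈ Finset.range m, (r (T + n + 1) ^ 4)⁻¹ ≤
      3 * ((r T)⁻¹ - (r (T + m))⁻¹) := by
    intro m
    induction m with
    | zero => simp
    | succ m ih =>
      rw [Finset.sum_range_succ]
      have h1 := inv_pow_four_le_telescope (a := r (T + m)) (b := r (T + m + 1))
        (hpos _ (by omega)) (by rw [hr, hr]; push_cast; ring)
      rw [← add_assoc]
      linarith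
  have h2 : 0 ≤ (r (T + m))⁻¹ := inv_nonneg.2 (hr0 _)
  linarith [h m]

end Hoelder

/-! ### Sums against weights decaying in the least absolute residue. -/

section MinimalResidues

variable {p : ℕ} [NeZero p]

/-- The absolute value of the absolutely least residue. -/
def absRes (b : ZMod p) : ℕ := b.valMinAbs.natAbs

lemma absRes_lt (b : ZMod p) : absRes b < p := by
  have h := ZMod.natAbs_valMinAbs_le b
  have hp := NeZero.pos p
  unfold absRes
  omega

lemma card_absRes_fiber_le (n : ℕ) :
    (Finset.univ.filter fun b : ZMod p => absRes b = n).card ≤ 2 := by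
  refine (Finset.card_le_card (t := {(n : ZMod p), -(n : ZMod p)}) ?_).trans Finset.card_le_two
  intro b hb
  have h1 := (Finset.mem_filter.1 hb).2
  unfold absRes at h1
  rw [Finset.mem_insert, Finset.mem_singleton, ← h1]
  have h2 : ((b.valMinAbs : ℤ) : ZMod p) = b := ZMod.coe_valMinAbs b
  rcases Int.natAbs_eq b.valMinAbs with h3 | h3
  · left
    nth_rewrite 1 [← h2, h3]
    simp
  · right
    nth_rewrite 1 [← h2, h3]
    simp

lemma sum_absRes_le {f : ℕ → ℝ} (hf : ∀ n, 0 ≤ f n) :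
    ∑ b : ZMod p, f (absRes b) ≤ 2 * ∑ n ∈ Finset.range p, f n := by
  rw [← Finset.sum_fiberwise_of_maps_to (t := Finset.range p) (g := absRes)
    fun b _ => Finset.mem_range.2 (absRes_lt b), Finset.mul_sum]
  refine Finset.sum_le_sum fun n _ => ?_
  rw [Finset.sum_congr rfl fun b hb => by rw [(Finset.mem_filter.1 hb).2], Finset.sum_const,
    nsmul_eq_mul]
  refine mul_le_mul_of_nonneg_right ?_ (hf n)
  exact_mod_cast card_absRes_fiber_le n

/-- Hölder's inequality against a sequence bounded by `min (A, B / |b|)`. -/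
lemma sum_mul_pow_four_le {A B : ℝ} (hA : 0 < A) (hAB : A ≤ B) {c X : ZMod p → ℝ}
    (hc0 : ∀ b, 0 ≤ c b) (hcA : ∀ b, c b ≤ A) (hcB : ∀ b, c b * absRes b ≤ B) :
    (∑ b, c b * X b) ^ 4 ≤ 2744 * (A * B ^ 3) * ∑ b, X b ^ 4 := by
  have hB : 0 < B := hA.trans_le hAB
  choose φ hφ0 hφ using fun b => exists_cube_root (hc0 b)
  obtain ⟨α, hα0, hα⟩ := exists_cube_root hA.le
  obtain ⟨β, hβ0, hβ⟩ := exists_cube_root hB.le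
  choose r hr0 hr using fun n : ℕ => exists_cube_root (Nat.cast_nonneg (α := ℝ) n)
  have hαpos : 0 < α := lt_of_le_of_ne hα0 fun h => by rw [← h] at hα; norm_num at hα; linarith
  have hβpos : 0 < β := lt_of_le_of_ne hβ0 fun h => by rw [← h] at hβ; norm_num at hβ; linarith
  have hmono : ∀ {x y : ℝ}, 0 ≤ x → 0 ≤ y → x ^ 3 ≤ y ^ 3 → x ≤ y := fun hx hy h =>
    (pow_le_pow_iff_left₀ hx hy three_ne_zero).1 h
  set T := ⌈B / A⌉₊ with hT
  have hT0 : 0 < T := Nat.ceil_pos.2 (by positivity)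
  have hTge : B / A ≤ T := Nat.le_ceil _
  have hTle : (T : ℝ) ≤ 2 * (B / A) := by
    have h1 := Nat.ceil_lt_add_one (show 0 ≤ B / A by positivity)
    have h2 : 1 ≤ B / A := (one_le_div hA).2 hAB
    linarith
  -- `u` is the `4/3` power of `min(A, B/n)`, cut where the two bounds cross, at `T ≈ B/A`. Its sum
  -- is at most `7 A^(1/3) B`; two residues per absolute value give 14, and `14^3 = 2744`.
  set u : ℕ → ℝ := fun n => if n ≤ T then α ^ 4 else β ^ 4 * (r n ^ 4)⁻¹ with hu
  have hu0 : ∀ n, 0 ≤ u n := by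
    intro n
    simp only [hu]
    split_ifs <;> positivity
  have hφu : ∀ b, φ b ^ 4 ≤ u (absRes b) := by
    intro b
    simp only [hu]
    split_ifs with h
    · have : φ b ≤ α := hmono (hφ0 b) hα0 (by rw [hφ, hα]; exact hcA b)
      gcongr
      exact hφ0 b
    · have h1 : φ b * r (absRes b) ≤ β :=
        hmono (mul_nonneg (hφ0 b) (hr0 _)) hβ0 (by rw [mul_pow, hφ, hβ, hr]; exact hcB b)
      have hr1 : 0 < r (absRes b) := by
        refine lt_of_le_of_ne (hr0 _) fun h2 => ?_
        have h3 := hr (absRes b)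
        rw [← h2] at h3
        have h4 : (absRes b : ℝ) ≠ 0 := by
          have : absRes b ≠ 0 := by omega
          exact_mod_cast this
        exact h4 (by rw [← h3]; norm_num)
      rw [← div_eq_mul_inv, le_div_iff₀ (by positivity), ← mul_pow]
      exact pow_le_pow_left₀ (mul_nonneg (hφ0 b) (hr0 _)) h1 4
  have hsum : ∑ b, φ b ^ 4 ≤ 14 * (α * B) := by
    refine (Finset.sum_le_sum fun b _ => hφu b).trans ((sum_absRes_le hu0).trans ?_)
    have h1 : ∑ n ∈ Finset.range p, u n ≤ ∑ n ∈ Finset.range (T + 1 + p), u n :=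
      Finset.sum_le_sum_of_subset_of_nonneg
        (Finset.range_subset_range.2 (by omega)) fun n _ _ => hu0 n
    rw [Finset.sum_range_add] at h1
    have h2 : ∑ n ∈ Finset.range (T + 1), u n = (T + 1) * α ^ 4 := by
      rw [Finset.sum_congr rfl (g := fun _ => α ^ 4), Finset.sum_const, Finset.card_range,
        nsmul_eq_mul]
      · push_cast
        rfl
      · intro n hn
        simp only [hu]
        rw [if_pos (by have := Finset.mem_range.1 hn; omega)]
    have h3 : ∑ n ∈ Finset.range p, u (T + 1 + n) ≤ 3 * (α * B) := by
      have h4 : ∀ n, u (T + 1 + n) = β ^ 4 * (r (T + n + 1) ^ 4)⁻¹ := by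
        intro n
        simp only [hu]
        rw [if_neg (by omega), add_right_comm]
      simp_rw [h4]
      rw [← Finset.mul_sum]
      have h5 : β * α⁻¹ ≤ r T := by
        refine hmono (by positivity) (hr0 T) ?_
        rw [mul_pow, inv_pow, hβ, hα, hr, ← div_eq_mul_inv]
        exact hTge
      have h6 : (r T)⁻¹ ≤ α * β⁻¹ := by
        have := inv_anti₀ (by positivity) h5
        rwa [mul_inv, inv_inv, mul_comm] at this
      calc β ^ 4 * ∑ n ∈ Finset.range p, (r (T + n + 1) ^ 4)⁻¹
          ≤ β ^ 4 * (3 * (α * β⁻¹)) := by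
            gcongr
            refine (sum_inv_cube_root_pow_four_le hr0 hr hT0 p).trans ?_
            gcongr
        _ = 3 * (α * B) := by
            rw [← hβ]
            field_simp
    have h7 : ((T : ℝ) + 1) * α ^ 4 ≤ 4 * (α * B) := by
      have hT1 : (1 : ℝ) ≤ T := by exact_mod_cast hT0
      calc ((T : ℝ) + 1) * α ^ 4 ≤ (4 * (B / A)) * α ^ 4 := by
            gcongr
            linarith
        _ = 4 * (α * B) := by
            rw [← hα]
            field_simp
    linarith
  have hmain := sum_pow_three_mul_pow_four_le Finset.univ φ X
  simp_rw [hφ] at hmain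
  refine hmain.trans ?_
  refine mul_le_mul_of_nonneg_right ?_ (Finset.sum_nonneg fun b _ => by positivity)
  calc (∑ b, φ b ^ 4) ^ 3 ≤ (14 * (α * B)) ^ 3 := by gcongr
    _ = 2744 * (A * B ^ 3) := by
        rw [← hα]
        ring

end MinimalResidues

/-! ### Bounds for geometric sums of characters. -/

section GeometricSums

variable {p : ℕ} [NeZero p]

lemma norm_stdAddChar_intCast_sub_one (n : ℤ) :
    ‖(ZMod.stdAddChar (n : ZMod p) : ℂ) - 1‖ = 2 * |Real.sin (Real.pi * n / p)| := by
  have h1 : (ZMod.stdAddChar (n : ZMod p) : ℂ) =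
      Complex.exp (Complex.I * ((2 * Real.pi * n / p : ℝ) : ℂ)) := by
    rw [ZMod.stdAddChar_coe]
    congr 1
    push_cast
    ring
  rw [h1, Complex.norm_exp_I_mul_ofReal_sub_one, norm_mul, Real.norm_eq_abs, Real.norm_eq_abs,
    abs_of_pos two_pos]
  congr 3
  ring

lemma norm_stdAddChar_natCast_sub_one_le (n : ℕ) :
    ‖(ZMod.stdAddChar (n : ZMod p) : ℂ) - 1‖ ≤ 7 * n / p := by
  have h := norm_stdAddChar_intCast_sub_one (p := p) n
  rw [Int.cast_natCast, Int.cast_natCast] at h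
  rw [h]
  have hp : (0 : ℝ) < p := by exact_mod_cast NeZero.pos p
  have h1 : |Real.sin (Real.pi * n / p)| ≤ Real.pi * n / p := by
    refine Real.abs_sin_le_abs.trans (le_of_eq (abs_of_nonneg ?_))
    have := Real.pi_pos
    positivity
  have h2 : Real.pi * n / p ≤ 3.5 * n / p := by
    gcongr
    linarith [Real.pi_lt_d2]
  calc 2 * |Real.sin (Real.pi * n / p)| ≤ 2 * (3.5 * n / p) := by linarith
    _ = 7 * n / p := by ring

lemma absRes_le_norm_stdAddChar_sub_one (b : ZMod p) :
    4 * (absRes b : ℝ) ≤ p * ‖(ZMod.stdAddChar b : ℂ) - 1‖ := by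
  have hp : (0 : ℝ) < p := by exact_mod_cast NeZero.pos p
  have hpi := Real.pi_pos
  have h := norm_stdAddChar_intCast_sub_one (p := p) b.valMinAbs
  rw [ZMod.coe_valMinAbs] at h
  have h1 : (absRes b : ℝ) = |((b.valMinAbs : ℤ) : ℝ)| := by
    unfold absRes
    rw [Nat.cast_natAbs, Int.cast_abs]
  have h2 : |((b.valMinAbs : ℤ) : ℝ)| ≤ p / 2 := by
    rw [← h1, le_div_iff₀ two_pos]
    have := ZMod.natAbs_valMinAbs_le b
    unfold absRes
    exact_mod_cast (by omega : b.valMinAbs.natAbs * 2 ≤ p)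
  have h3 : |Real.pi * (b.valMinAbs : ℝ) / p| = Real.pi * |((b.valMinAbs : ℤ) : ℝ)| / p := by
    rw [abs_div, abs_mul, abs_of_pos hpi, abs_of_pos hp]
  have h4 : 2 / Real.pi * |Real.pi * (b.valMinAbs : ℝ) / p| ≤
      |Real.sin (Real.pi * (b.valMinAbs : ℝ) / p)| := by
    refine Real.mul_abs_le_abs_sin ?_
    rw [h3, div_le_iff₀ hp]
    nlinarith
  rw [h3] at h4
  have h5 : 2 / Real.pi * (Real.pi * |((b.valMinAbs : ℤ) : ℝ)| / p) =
      2 * |((b.valMinAbs : ℤ) : ℝ)| / p := by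
    field_simp
  rw [h5, div_le_iff₀ hp] at h4
  rw [h, h1]
  linarith

lemma norm_geom_sum_mul_absRes_le (b : ZMod p) (m : ℕ) :
    ‖∑ k ∈ Finset.range m, (ZMod.stdAddChar (b * (k : ZMod p)) : ℂ)‖ * absRes b ≤ p / 2 := by
  set z : ℂ := ZMod.stdAddChar b with hz
  have hpow : ∀ k : ℕ, (ZMod.stdAddChar (b * (k : ZMod p)) : ℂ) = z ^ k := by
    intro k
    rw [mul_comm, ← nsmul_eq_mul, AddChar.map_nsmul_eq_pow]
  simp_rw [hpow]
  have h1 : ‖∑ k ∈ Finset.range m, z ^ k‖ * ‖z - 1‖ ≤ 2 := by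
    rw [← norm_mul, geom_sum_mul]
    refine (norm_sub_le _ _).trans ?_
    rw [norm_pow, norm_stdAddChar, one_pow, norm_one]
    norm_num
  have h2 := absRes_le_norm_stdAddChar_sub_one b
  have hp : (0 : ℝ) < p := by exact_mod_cast NeZero.pos p
  have h3 := norm_nonneg (∑ k ∈ Finset.range m, z ^ k)
  nlinarith

lemma norm_stdAddChar_mul_geom_sum_le (b : ZMod p) (m : ℕ) :
    ‖∑ k ∈ Finset.range m, (ZMod.stdAddChar (b * (k : ZMod p)) : ℂ)‖ ≤ m := by
  refine (norm_sum_le _ _).trans ?_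
  simp

end GeometricSums

/-- Abel summation. -/
lemma norm_sum_mul_le_of_partial_sums {K z : ℕ → ℂ} {G k V : ℝ}
    (hG : ∀ m, ‖∑ n ∈ Finset.range m, z n‖ ≤ G) {L : ℕ}
    (hK : ‖K (L - 1)‖ ≤ k)
    (hV : ∑ n ∈ Finset.range (L - 1), ‖K (n + 1) - K n‖ ≤ V) :
    ‖∑ n ∈ Finset.range L, K n * z n‖ ≤ (k + V) * G := by
  have hG0 : 0 ≤ G := (norm_nonneg _).trans (hG 0)
  have h := Finset.sum_range_by_parts K z L
  simp only [smul_eq_mul] at h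
  rw [h]
  refine (norm_sub_le _ _).trans ?_
  rw [add_mul]
  refine add_le_add ?_ ?_
  · rw [norm_mul]
    exact mul_le_mul hK (hG _) (norm_nonneg _) ((norm_nonneg _).trans hK)
  · refine (norm_sum_le _ _).trans ?_
    refine le_trans ?_ (mul_le_mul_of_nonneg_right hV hG0)
    rw [Finset.sum_mul]
    refine Finset.sum_le_sum fun n _ => ?_
    rw [norm_mul]
    exact mul_le_mul_of_nonneg_left (hG _) (norm_nonneg _)

/-! ### Short intervals through Dirichlet means. -/

section ShortIntervals

variable {p : ℕ} [NeZero p]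

/-- The finite Fourier transform with the sign convention `e(+bu/p)`. -/
noncomputable def fourierSum (F : ZMod p → ℂ) (b : ZMod p) : ℂ :=
  ∑ u, F u * ZMod.stdAddChar (b * u)

lemma fourierSum_inversion (F : ZMod p → ℂ) (u : ZMod p) :
    ∑ b, fourierSum F b * ZMod.stdAddChar (-(b * u)) = p * F u := by
  unfold fourierSum
  simp_rw [Finset.sum_mul]
  rw [Finset.sum_comm]
  have h : ∀ v, ∑ b : ZMod p, F v * ZMod.stdAddChar (b * v) * ZMod.stdAddChar (-(b * u)) =
      if v = u then (p : ℂ) * F u else 0 := by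
    intro v
    simp_rw [mul_assoc, ← AddChar.map_add_eq_mul, ← sub_eq_add_neg, ← mul_sub]
    rw [← Finset.mul_sum, sum_stdAddChar_mul]
    simp only [sub_eq_zero]
    split_ifs with h1
    · rw [h1, mul_comm]
    · simp
  simp_rw [h]
  rw [Finset.sum_ite_eq' Finset.univ u, if_pos (Finset.mem_univ _)]

/-- The average `h⁻¹ ∑_{j<h} e(jk/p)`. -/
noncomputable def dirichletMean (p : ℕ) [NeZero p] (h k : ℕ) : ℂ :=
  (h : ℂ)⁻¹ * ∑ j ∈ Finset.range h, ZMod.stdAddChar ((j : ZMod p) * (k : ZMod p))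

lemma norm_dirichletMean_sub_one_le {h : ℕ} (h0 : 0 < h) (k : ℕ) :
    ‖dirichletMean p h k - 1‖ ≤ 7 * (h * k) / p := by
  have hh : (h : ℂ) ≠ 0 := by exact_mod_cast h0.ne'
  have hhr : (0 : ℝ) < h := by exact_mod_cast h0
  have h1 : dirichletMean p h k - 1 =
      (h : ℂ)⁻¹ * ∑ j ∈ Finset.range h, ((ZMod.stdAddChar ((j : ZMod p) * (k : ZMod p)) : ℂ) - 1) := by
    unfold dirichletMean
    rw [Finset.sum_sub_distrib, mul_sub]
    congr 1
    simp [hh]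
  rw [h1, norm_mul, norm_inv, Complex.norm_natCast, inv_mul_le_iff₀ hhr]
  refine (norm_sum_le _ _).trans ((Finset.sum_le_card_nsmul _ _ (7 * ((h : ℝ) * k) / p) fun j hj => ?_).trans
    (by simp))
  have h2 := norm_stdAddChar_natCast_sub_one_le (p := p) (j * k)
  push_cast at h2
  refine h2.trans ?_
  have h3 : (j : ℝ) ≤ h := by exact_mod_cast (Finset.mem_range.1 hj).le
  gcongr

lemma norm_dirichletMean_succ_sub_le {h : ℕ} (h0 : 0 < h) (k : ℕ) :
    ‖dirichletMean p h (k + 1) - dirichletMean p h k‖ ≤ 7 * h / p := by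
  have hhr : (0 : ℝ) < h := by exact_mod_cast h0
  unfold dirichletMean
  rw [← mul_sub, ← Finset.sum_sub_distrib, norm_mul, norm_inv, Complex.norm_natCast,
    inv_mul_le_iff₀ hhr]
  refine (norm_sum_le _ _).trans ((Finset.sum_le_card_nsmul _ _ (7 * (h : ℝ) / p) fun j hj => ?_).trans
    (by simp))
  have h1 : (ZMod.stdAddChar ((j : ZMod p) * ((k + 1 : ℕ) : ZMod p)) : ℂ) -
      ZMod.stdAddChar ((j : ZMod p) * (k : ZMod p)) =
      ZMod.stdAddChar ((j : ZMod p) * (k : ZMod p)) * ((ZMod.stdAddChar (j : ZMod p) : ℂ) - 1) := by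
    push_cast
    rw [mul_add, mul_one, AddChar.map_add_eq_mul]
    ring
  rw [h1, norm_mul, norm_stdAddChar, one_mul]
  refine (norm_stdAddChar_natCast_sub_one_le j).trans ?_
  have h3 : (j : ℝ) ≤ h := by exact_mod_cast (Finset.mem_range.1 hj).le
  gcongr

/-- The weights obtained by dividing an interval by a Dirichlet mean. -/
noncomputable def intervalWeight (p : ℕ) [NeZero p] (h L : ℕ) (b : ZMod p) : ℂ :=
  (p : ℂ)⁻¹ * ∑ k ∈ Finset.range L, (dirichletMean p h k)⁻¹ * ZMod.stdAddChar (-b * (k : ZMod p))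

lemma half_le_norm_dirichletMean {h L : ℕ} (h0 : 0 < h) (hL : 16 * (h * L) ≤ p) {k : ℕ}
    (hk : k ≤ L) : 1 / 2 ≤ ‖dirichletMean p h k‖ := by
  have h1 := norm_dirichletMean_sub_one_le (p := p) h0 k
  have hp : (0 : ℝ) < p := by exact_mod_cast NeZero.pos p
  -- The requirement `16 h L ≤ p` keeps all phases `jk/p` small, so the mean stays near 1 and may be
  -- inverted.
  have h2 : 7 * ((h : ℝ) * k) / p ≤ 1 / 2 := by
    rw [div_le_iff₀ hp]
    have h3 : ((16 * (h * L) : ℕ) : ℝ) ≤ p := by exact_mod_cast hL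
    have h4 : (h : ℝ) * k ≤ h * L := by gcongr
    push_cast at h3
    have h5 : 0 ≤ (h : ℝ) * L := by positivity
    linarith
  have h3 := norm_sub_norm_le (1 : ℂ) (1 - dirichletMean p h k)
  rw [norm_one, sub_sub_cancel, norm_sub_rev] at h3
  linarith

lemma norm_inv_dirichletMean_le {h L : ℕ} (h0 : 0 < h) (hL : 16 * (h * L) ≤ p) {k : ℕ}
    (hk : k ≤ L) : ‖(dirichletMean p h k)⁻¹‖ ≤ 2 := by
  have h1 := half_le_norm_dirichletMean h0 hL hk
  rw [norm_inv]
  have h2 := inv_anti₀ (by norm_num) h1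
  norm_num at h2
  exact h2

lemma norm_intervalWeight_le {h L : ℕ} (h0 : 0 < h) (hL : 16 * (h * L) ≤ p) (b : ZMod p) :
    ‖intervalWeight p h L b‖ ≤ 2 * L / p := by
  have hp : (0 : ℝ) < p := by exact_mod_cast NeZero.pos p
  unfold intervalWeight
  rw [norm_mul, norm_inv, Complex.norm_natCast, inv_mul_le_iff₀ hp]
  refine (norm_sum_le _ _).trans ((Finset.sum_le_card_nsmul _ _ 2 fun k hk => ?_).trans ?_)
  · rw [norm_mul, norm_stdAddChar, mul_one]
    exact norm_inv_dirichletMean_le h0 hL (Finset.mem_range.1 hk).le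
  · rw [Finset.card_range, nsmul_eq_mul, mul_div_cancel₀ _ hp.ne', mul_comm]

lemma sum_norm_inv_dirichletMean_sub_le {h L : ℕ} (h0 : 0 < h) (hL : 16 * (h * L) ≤ p) :
    ∑ n ∈ Finset.range (L - 1),
      ‖(dirichletMean p h (n + 1))⁻¹ - (dirichletMean p h n)⁻¹‖ ≤ 2 := by
  have hp : (0 : ℝ) < p := by exact_mod_cast NeZero.pos p
  refine (Finset.sum_le_card_nsmul _ _ (4 * (7 * (h : ℝ) / p)) fun n hn => ?_).trans ?_
  · have hn' := Finset.mem_range.1 hn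
    have e1 := norm_inv_dirichletMean_le (p := p) h0 hL (k := n + 1) (by omega)
    have e2 := norm_inv_dirichletMean_le (p := p) h0 hL (k := n) (by omega)
    have hne : ∀ k, k ≤ L → dirichletMean p h k ≠ 0 := by
      intro k hk h1
      have := half_le_norm_dirichletMean (p := p) h0 hL hk
      rw [h1, norm_zero] at this
      norm_num at this
    rw [inv_sub_inv (hne _ (by omega)) (hne _ (by omega)), div_eq_mul_inv, mul_inv, norm_mul,
      norm_mul, norm_sub_rev]
    calc ‖dirichletMean p h (n + 1) - dirichletMean p h n‖ *
          (‖(dirichletMean p h (n + 1))⁻¹‖ * ‖(dirichletMean p h n)⁻¹‖)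
        ≤ 7 * h / p * (2 * 2) := by
          gcongr
          exact norm_dirichletMean_succ_sub_le h0 n
      _ = 4 * (7 * h / p) := by ring
  · rw [Finset.card_range, nsmul_eq_mul]
    have h1 : ((L - 1 : ℕ) : ℝ) ≤ L := by exact_mod_cast Nat.sub_le L 1
    have h2 : ((16 * (h * L) : ℕ) : ℝ) ≤ p := by exact_mod_cast hL
    push_cast at h2
    calc ((L - 1 : ℕ) : ℝ) * (4 * (7 * h / p)) ≤ L * (4 * (7 * h / p)) := by gcongr
      _ = 28 * (h * L) / p := by ring
      _ ≤ 2 := by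
        rw [div_le_iff₀ hp]
        linarith

lemma norm_intervalWeight_mul_absRes_le {h L : ℕ} (h0 : 0 < h)
    (hL : 16 * (h * L) ≤ p) (b : ZMod p) : ‖intervalWeight p h L b‖ * absRes b ≤ 2 := by
  have hp : (0 : ℝ) < p := by exact_mod_cast NeZero.pos p
  have habs : absRes (-b) = absRes b := ZMod.natAbs_valMinAbs_neg b
  rcases Nat.eq_zero_or_pos (absRes b) with hb | hb
  · rw [hb]
    norm_num
  have hbr : (0 : ℝ) < absRes b := by exact_mod_cast hb
  have hG : ∀ m, ‖∑ k ∈ Finset.range m, (ZMod.stdAddChar (-b * (k : ZMod p)) : ℂ)‖ ≤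
      p / 2 / absRes b := by
    intro m
    rw [le_div_iff₀ hbr, ← habs]
    exact norm_geom_sum_mul_absRes_le (-b) m
  have h1 := norm_sum_mul_le_of_partial_sums (K := fun n => (dirichletMean p h n)⁻¹)
    (z := fun k => (ZMod.stdAddChar (-b * (k : ZMod p)) : ℂ)) hG
    (norm_inv_dirichletMean_le (p := p) h0 hL (Nat.sub_le L 1))
    (sum_norm_inv_dirichletMean_sub_le (p := p) h0 hL)
  unfold intervalWeight
  rw [norm_mul, norm_inv, Complex.norm_natCast, mul_assoc, inv_mul_le_iff₀ hp]
  refine (mul_le_mul_of_nonneg_right h1 hbr.le).trans (le_of_eq ?_)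
  rw [mul_assoc, div_mul_cancel₀ _ hbr.ne']
  ring

/-- Dividing and multiplying by the Dirichlet mean replaces `F` by an average of `h` modulations,
whose Fourier transforms are shifts by `j`. The inverse means are absorbed into weights that decay
like those of an interval. -/
lemma interval_sum_eq (F : ZMod p → ℂ) (M : ZMod p) {h L : ℕ} (h0 : 0 < h)
    (hL : 16 * (h * L) ≤ p) :
    (h : ℂ) * ∑ k ∈ Finset.range L, F (M + k) =
      ∑ b, intervalWeight p h L b * (ZMod.stdAddChar (-(b * M)) *
        ∑ j ∈ Finset.range h, ZMod.stdAddChar (-((j : ZMod p) * M)) * fourierSum F (b + j)) := by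
  have hp : (p : ℂ) ≠ 0 := by exact_mod_cast NeZero.ne p
  have hh : (h : ℂ) ≠ 0 := by exact_mod_cast h0.ne'
  have hinv : ∀ (k j : ℕ), F (M + k) * ZMod.stdAddChar ((j : ZMod p) * (k : ZMod p)) =
      (p : ℂ)⁻¹ * ∑ b, ZMod.stdAddChar (-b * (k : ZMod p)) * (ZMod.stdAddChar (-(b * M)) *
        (ZMod.stdAddChar (-((j : ZMod p) * M)) * fourierSum F (b + j))) := by
    intro k j
    have h1 := fourierSum_inversion F (M + k)
    rw [← Equiv.sum_comp (Equiv.addRight (j : ZMod p))] at h1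
    rw [eq_inv_mul_iff_mul_eq₀ hp, ← mul_assoc, ← h1, Finset.sum_mul]
    refine Finset.sum_congr rfl fun b _ => ?_
    simp only [Equiv.coe_addRight]
    have h2 : (ZMod.stdAddChar (-((b + (j : ZMod p)) * (M + (k : ZMod p)))) : ℂ) * ZMod.stdAddChar ((j : ZMod p) * (k : ZMod p)) =
        ZMod.stdAddChar (-b * (k : ZMod p)) * (ZMod.stdAddChar (-(b * M)) *
          ZMod.stdAddChar (-((j : ZMod p) * M))) := by
      rw [← AddChar.map_add_eq_mul, ← AddChar.map_add_eq_mul, ← AddChar.map_add_eq_mul]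
      congr 1
      ring
    rw [mul_assoc, h2]
    ring
  have hterm : ∀ k ∈ Finset.range L, (h : ℂ) * F (M + k) = ∑ b, ((p : ℂ)⁻¹ *
      ((dirichletMean p h k)⁻¹ * ZMod.stdAddChar (-b * (k : ZMod p)))) * (ZMod.stdAddChar (-(b * M)) *
        ∑ j ∈ Finset.range h, ZMod.stdAddChar (-((j : ZMod p) * M)) * fourierSum F (b + j)) := by
    intro k hk
    have hne : dirichletMean p h k ≠ 0 := by
      intro h1
      have := half_le_norm_dirichletMean (p := p) h0 hL (Finset.mem_range.1 hk).le
      rw [h1, norm_zero] at this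
      norm_num at this
    have h2 : (h : ℂ) * dirichletMean p h k * F (M + k) =
        ∑ j ∈ Finset.range h, F (M + k) * ZMod.stdAddChar ((j : ZMod p) * (k : ZMod p)) := by
      unfold dirichletMean
      rw [mul_inv_cancel_left₀ hh, Finset.sum_mul]
      exact Finset.sum_congr rfl fun j _ => mul_comm _ _
    have h3 : (h : ℂ) * F (M + k) = (dirichletMean p h k)⁻¹ *
        ((h : ℂ) * dirichletMean p h k * F (M + k)) := by
      field_simp
    rw [h3, h2]
    simp_rw [hinv]
    rw [← Finset.mul_sum, Finset.sum_comm, Finset.mul_sum, Finset.mul_sum]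
    refine Finset.sum_congr rfl fun b _ => ?_
    rw [← Finset.mul_sum, ← Finset.mul_sum]
    ring
  rw [Finset.mul_sum, Finset.sum_congr rfl hterm, Finset.sum_comm]
  refine Finset.sum_congr rfl fun b _ => ?_
  rw [← Finset.sum_mul, ← Finset.mul_sum]
  rfl

/-- Sums over short intervals, given a fourth moment bound for shifted Fourier coefficients. -/
lemma norm_short_interval_sum_pow_le {F : ZMod p → ℂ} {E : ℝ}
    (hE : ∀ (h : ℕ) (θ : ℕ → ℂ), 0 < h → h ≤ p → (∀ j, ‖θ j‖ ≤ 1) →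
      ∑ b, ‖∑ j ∈ Finset.range h, θ j * fourierSum F (b + j)‖ ^ 4 ≤ E * √h ^ 7)
    (M : ZMod p) {L : ℕ} (hL : 16 * L ≤ p) :
    ‖∑ k ∈ Finset.range L, F (M + k)‖ ^ 8 ≤
      43904 ^ 2 * 32 * ((L : ℝ) ^ 3 / (p : ℝ) ^ 3) * E ^ 2 := by
  rcases Nat.eq_zero_or_pos L with rfl | hL0
  · simp
  have hp : (0 : ℝ) < p := by exact_mod_cast NeZero.pos p
  have hLr : (0 : ℝ) < L := by exact_mod_cast hL0
  -- The largest admissible number of frequencies: the final bound for `I^8` carries a factor `1/h`,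
  -- traded for `32 L / p`.
  set h := p / (16 * L) with hh
  have h0 : 0 < h := Nat.div_pos hL (by omega)
  have hhL : 16 * (h * L) ≤ p := by
    have := Nat.div_mul_le_self p (16 * L)
    rw [← hh] at this
    linarith
  have hhp : h ≤ p := Nat.div_le_self _ _
  have hlow : (p : ℝ) ≤ 32 * L * h := by
    have h1 := Nat.lt_div_mul_add (a := p) (b := 16 * L) (by omega)
    rw [← hh] at h1
    have h2 : 16 * L ≤ h * (16 * L) := Nat.le_mul_of_pos_left _ h0
    have h3 : p ≤ 32 * L * h := by nlinarith
    exact_mod_cast h3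
  have hhr : (0 : ℝ) < h := by exact_mod_cast h0
  set X : ZMod p → ℝ := fun b => ‖∑ j ∈ Finset.range h,
    (ZMod.stdAddChar (-((j : ZMod p) * M)) : ℂ) * fourierSum F (b + j)‖ with hX
  have hX4 : ∑ b, X b ^ 4 ≤ E * √h ^ 7 :=
    hE h _ h0 hhp fun j => (norm_stdAddChar _).le
  have h1 : h * ‖∑ k ∈ Finset.range L, F (M + k)‖ ≤ ∑ b, ‖intervalWeight p h L b‖ * X b := by
    rw [← Complex.norm_natCast, ← norm_mul, interval_sum_eq F M h0 hhL]
    refine (norm_sum_le _ _).trans (le_of_eq (Finset.sum_congr rfl fun b _ => ?_))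
    rw [norm_mul, norm_mul, norm_stdAddChar, one_mul]
  have hLp : (L : ℝ) ≤ p := by exact_mod_cast (by omega : L ≤ p)
  have h2 := sum_mul_pow_four_le (p := p) (A := 2 * L / p) (B := 2) (X := X) (by positivity)
    (by rw [div_le_iff₀ hp]; linarith) (fun b => norm_nonneg (intervalWeight p h L b))
    (norm_intervalWeight_le h0 hhL) (norm_intervalWeight_mul_absRes_le h0 hhL)
  have hE0 : 0 ≤ E := by
    have : 0 ≤ E * √h ^ 7 := le_trans (Finset.sum_nonneg fun b _ => by positivity) hX4
    exact nonneg_of_mul_nonneg_left this (by positivity)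
  set I := ‖∑ k ∈ Finset.range L, F (M + k)‖ with hI
  have hI0 : 0 ≤ I := norm_nonneg _
  have h3 : (h * I) ^ 4 ≤ 43904 * (L / p) * (E * √h ^ 7) := by
    refine (pow_le_pow_left₀ (by positivity) h1 4).trans (h2.trans ?_)
    calc 2744 * (2 * L / p * 2 ^ 3) * ∑ b, X b ^ 4 = 43904 * (L / p) * ∑ b, X b ^ 4 := by ring
      _ ≤ 43904 * (L / p) * (E * √h ^ 7) := by gcongr
  have h4 : (h : ℝ) ^ 8 * I ^ 8 ≤ 43904 ^ 2 * (L / p) ^ 2 * E ^ 2 * h ^ 7 := by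
    calc (h : ℝ) ^ 8 * I ^ 8 = ((h * I) ^ 4) ^ 2 := by ring
      _ ≤ (43904 * (L / p) * (E * √h ^ 7)) ^ 2 := by gcongr
      _ = 43904 ^ 2 * (L / p) ^ 2 * E ^ 2 * (√h ^ 2) ^ 7 := by ring
      _ = 43904 ^ 2 * (L / p) ^ 2 * E ^ 2 * h ^ 7 := by rw [Real.sq_sqrt hhr.le]
  have h5 : (h : ℝ) ^ 8 * I ^ 8 ≤
      h ^ 8 * (43904 ^ 2 * 32 * ((L : ℝ) ^ 3 / (p : ℝ) ^ 3) * E ^ 2) := by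
    refine h4.trans ?_
    have h6 : (1 : ℝ) ≤ 32 * L * h / p := by
      rw [le_div_iff₀ hp, one_mul]
      exact hlow
    calc 43904 ^ 2 * ((L : ℝ) / p) ^ 2 * E ^ 2 * h ^ 7
        ≤ 43904 ^ 2 * ((L : ℝ) / p) ^ 2 * E ^ 2 * h ^ 7 * (32 * L * h / p) :=
          le_mul_of_one_le_right (by positivity) h6
      _ = h ^ 8 * (43904 ^ 2 * 32 * ((L : ℝ) ^ 3 / (p : ℝ) ^ 3) * E ^ 2) := by
          field_simp
  exact le_of_mul_le_mul_left h5 (by positivity)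

end ShortIntervals

/-! ### Long intervals by averaging over shifts. -/

section LongIntervals

variable {p : ℕ} [NeZero p]

lemma sum_range_natCast_eq {A : Type*} [AddCommMonoid A] {R : ℕ} (hR : R ≤ p) (f : ZMod p → A) :
    ∑ k ∈ Finset.range R, f k = ∑ z : ZMod p, if z.val < R then f z else 0 := by
  rw [← Finset.sum_filter]
  refine Finset.sum_bij' (fun k _ => (k : ZMod p)) (fun z _ => z.val) ?_ ?_ ?_ ?_ ?_
  · intro k hk
    have hk' := Finset.mem_range.1 hk
    simp only [Finset.mem_filter, Finset.mem_univ, true_and]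
    rwa [ZMod.val_natCast_of_lt (by omega)]
  · intro z hz
    exact Finset.mem_range.2 (Finset.mem_filter.1 hz).2
  · intro k hk
    have hk' := Finset.mem_range.1 hk
    exact ZMod.val_natCast_of_lt (by omega)
  · intro z _
    exact ZMod.natCast_zmod_val z
  · intro k _
    rfl

lemma sum_norm_geom_sum_sq {R : ℕ} (hR : R ≤ p) :
    ∑ b : ZMod p, ‖∑ k ∈ Finset.range R, (ZMod.stdAddChar (b * (k : ZMod p)) : ℂ)‖ ^ 2 =
      p * R := by
  have h := sum_norm_sq_fourier (N := p) fun z => if z.val < R then 1 else 0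
  have h1 : ∀ b : ZMod p, ∑ k ∈ Finset.range R, (ZMod.stdAddChar (b * (k : ZMod p)) : ℂ) =
      ∑ z : ZMod p, (if z.val < R then 1 else 0) * (ZMod.stdAddChar (b * z) : ℂ) := by
    intro b
    rw [sum_range_natCast_eq hR fun z => (ZMod.stdAddChar (b * z) : ℂ)]
    simp only [ite_mul, one_mul, zero_mul]
  simp_rw [h1]
  rw [h]
  congr 1
  have h2 := sum_range_natCast_eq (p := p) hR fun _ => (1 : ℝ)
  rw [Finset.sum_const, Finset.card_range, nsmul_eq_mul, mul_one] at h2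
  rw [h2]
  refine Finset.sum_congr rfl fun z _ => ?_
  split_ifs <;> simp

/-- Two factors are bounded trivially by `R`, the other two by Parseval. -/
lemma sum_norm_geom_sum_pow_four_le {R : ℕ} (hR : R ≤ p) :
    ∑ b : ZMod p, ‖∑ k ∈ Finset.range R, (ZMod.stdAddChar (b * (k : ZMod p)) : ℂ)‖ ^ 4 ≤
      p * (R : ℝ) ^ 3 := by
  calc ∑ b : ZMod p, ‖∑ k ∈ Finset.range R, (ZMod.stdAddChar (b * (k : ZMod p)) : ℂ)‖ ^ 4
      ≤ ∑ b : ZMod p, (R : ℝ) ^ 2 *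
          ‖∑ k ∈ Finset.range R, (ZMod.stdAddChar (b * (k : ZMod p)) : ℂ)‖ ^ 2 := by
        refine Finset.sum_le_sum fun b _ => ?_
        have h1 := norm_stdAddChar_mul_geom_sum_le b R
        have h2 := norm_nonneg (∑ k ∈ Finset.range R, (ZMod.stdAddChar (b * (k : ZMod p)) : ℂ))
        have h3 := pow_le_pow_left₀ h2 h1 2
        nlinarith [sq_nonneg ‖∑ k ∈ Finset.range R, (ZMod.stdAddChar (b * (k : ZMod p)) : ℂ)‖]
    _ = p * (R : ℝ) ^ 3 := by
        rw [← Finset.mul_sum, sum_norm_geom_sum_sq hR]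
        ring

/-- Averages of interval sums over shifts, given a bound for the Fourier coefficients. -/
lemma norm_sum_shifted_interval_pow_le {F : ZMod p → ℂ} {S : ℝ}
    (hS : ∀ b, ‖fourierSum F b‖ ≤ S) (M : ZMod p) {R L : ℕ} (hL0 : 0 < L) (hR : R ≤ p)
    (hL : L ≤ p) :
    ‖∑ r ∈ Finset.range R, ∑ k ∈ Finset.range L, F (M + r + k)‖ ^ 4 ≤
      2744 * S ^ 4 * L * (R : ℝ) ^ 3 := by
  have hp : (0 : ℝ) < p := by exact_mod_cast NeZero.pos p
  have hS0 : 0 ≤ S := (norm_nonneg _).trans (hS 0)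
  set D : ℕ → ZMod p → ℝ := fun m b =>
    ‖∑ k ∈ Finset.range m, (ZMod.stdAddChar (b * (k : ZMod p)) : ℂ)‖ with hD
  set T := ∑ r ∈ Finset.range R, ∑ k ∈ Finset.range L, F (M + r + k) with hT
  have h1 : (p : ℂ) * T = ∑ b, fourierSum F b * ZMod.stdAddChar (-(b * M)) *
      ((∑ r ∈ Finset.range R, (ZMod.stdAddChar (-b * (r : ZMod p)) : ℂ)) *
        ∑ k ∈ Finset.range L, (ZMod.stdAddChar (-b * (k : ZMod p)) : ℂ)) := by
    have e1 : ∀ b, fourierSum F b * ZMod.stdAddChar (-(b * M)) *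
        ((∑ r ∈ Finset.range R, (ZMod.stdAddChar (-b * (r : ZMod p)) : ℂ)) *
          ∑ k ∈ Finset.range L, (ZMod.stdAddChar (-b * (k : ZMod p)) : ℂ)) =
        ∑ r ∈ Finset.range R, ∑ k ∈ Finset.range L,
          fourierSum F b * ZMod.stdAddChar (-(b * (M + (r : ZMod p) + (k : ZMod p)))) := by
      intro b
      rw [Finset.sum_mul_sum, Finset.mul_sum]
      refine Finset.sum_congr rfl fun r _ => ?_
      rw [Finset.mul_sum]
      refine Finset.sum_congr rfl fun k _ => ?_
      rw [mul_assoc, ← AddChar.map_add_eq_mul, ← AddChar.map_add_eq_mul]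
      congr 2
      ring
    simp_rw [e1]
    rw [hT, Finset.sum_comm (s := (Finset.univ : Finset (ZMod p))), Finset.mul_sum]
    refine Finset.sum_congr rfl fun r _ => ?_
    rw [Finset.sum_comm (s := (Finset.univ : Finset (ZMod p))), Finset.mul_sum]
    exact (Finset.sum_congr rfl fun k _ => fourierSum_inversion F _).symm
  have h2 : p * ‖T‖ ≤ S * ∑ b, D L b * D R b := by
    rw [← Complex.norm_natCast, ← norm_mul, h1, ← Equiv.sum_comp (Equiv.neg (ZMod p)), Finset.mul_sum]
    refine (norm_sum_le _ _).trans (Finset.sum_le_sum fun b _ => ?_)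
    simp only [Equiv.neg_apply, neg_neg]
    rw [norm_mul, norm_mul, norm_mul, norm_stdAddChar, mul_one, mul_comm (D L b)]
    exact mul_le_mul_of_nonneg_right (hS _) (by positivity)
  have h3 := sum_mul_pow_four_le (p := p) (A := L) (B := p) (c := D L) (X := D R)
    (by exact_mod_cast hL0) (by exact_mod_cast hL) (fun b => norm_nonneg _)
    (fun b => norm_stdAddChar_mul_geom_sum_le b L)
    (fun b => (norm_geom_sum_mul_absRes_le b L).trans (by linarith))
  have h4 : (p : ℝ) ^ 4 * ‖T‖ ^ 4 ≤ (p : ℝ) ^ 4 * (2744 * S ^ 4 * L * (R : ℝ) ^ 3) := by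
    calc (p : ℝ) ^ 4 * ‖T‖ ^ 4 = (p * ‖T‖) ^ 4 := by ring
      _ ≤ (S * ∑ b, D L b * D R b) ^ 4 := by gcongr
      _ = S ^ 4 * (∑ b, D L b * D R b) ^ 4 := by ring
      _ ≤ S ^ 4 * (2744 * (L * (p : ℝ) ^ 3) * (p * (R : ℝ) ^ 3)) := by
          gcongr
          refine h3.trans ?_
          gcongr
          exact sum_norm_geom_sum_pow_four_le hR
      _ = (p : ℝ) ^ 4 * (2744 * S ^ 4 * L * (R : ℝ) ^ 3) := by ring
  exact le_of_mul_le_mul_left h4 (by positivity)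

/-- Passing from short to long intervals by averaging over shifts. -/
lemma norm_long_interval_sum_le {F : ZMod p → ℂ} {S E t : ℝ}
    (hS : ∀ b, ‖fourierSum F b‖ ≤ S) {R L : ℕ} (hR : 0 < R) (hRL : R < L) (hL : L ≤ p)
    (hE : ∀ (M : ZMod p) (m : ℕ), m ≤ R → ‖∑ k ∈ Finset.range m, F (M + k)‖ ≤ E)
    (ht0 : 0 ≤ t) (ht : 2744 * S ^ 4 * L ≤ t ^ 4 * R) (M : ZMod p) :
    ‖∑ k ∈ Finset.range L, F (M + k)‖ ≤ 2 * E + t := by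
  have hRr : (0 : ℝ) < R := by exact_mod_cast hR
  set I := ∑ k ∈ Finset.range L, F (M + k) with hI
  -- For every shift `r < R` the interval is a head of length `r`, a middle of fixed length `L - R`
  -- starting at `M + r`, and a tail of length `R - r`. Only the middle is averaged; the head and
  -- tail are bounded by `E`.
  have hsplit : ∀ r ∈ Finset.range R, I = ∑ k ∈ Finset.range r, F (M + k) +
      ∑ k ∈ Finset.range (L - R), F (M + r + k) +
        ∑ k ∈ Finset.range (R - r), F (M + ((r + (L - R) : ℕ) : ZMod p) + k) := by
    intro r hr
    have hr' := Finset.mem_range.1 hr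
    have h1 : L = r + (L - R) + (R - r) := by omega
    rw [hI]
    nth_rewrite 1 [h1]
    rw [Finset.sum_range_add, Finset.sum_range_add]
    push_cast
    simp only [add_assoc]
  have hT := norm_sum_shifted_interval_pow_le hS M (R := R) (L := L - R) (by omega) (by omega)
    (by omega)
  have hTt : ‖∑ r ∈ Finset.range R, ∑ k ∈ Finset.range (L - R), F (M + r + k)‖ ≤ R * t := by
    refine (pow_le_pow_iff_left₀ (norm_nonneg _) (by positivity) four_ne_zero).1 ?_
    have hLr : ((L - R : ℕ) : ℝ) ≤ L := by exact_mod_cast Nat.sub_le L R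
    calc ‖∑ r ∈ Finset.range R, ∑ k ∈ Finset.range (L - R), F (M + r + k)‖ ^ 4
        ≤ 2744 * S ^ 4 * (L - R : ℕ) * (R : ℝ) ^ 3 := hT
      _ ≤ 2744 * S ^ 4 * L * (R : ℝ) ^ 3 := by gcongr
      _ ≤ t ^ 4 * R * (R : ℝ) ^ 3 := by gcongr
      _ = (R * t) ^ 4 := by ring
  have hsum : (R : ℂ) * I = ∑ r ∈ Finset.range R, ∑ k ∈ Finset.range r, F (M + k) +
      ∑ r ∈ Finset.range R, ∑ k ∈ Finset.range (L - R), F (M + r + k) +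
        ∑ r ∈ Finset.range R, ∑ k ∈ Finset.range (R - r),
          F (M + ((r + (L - R) : ℕ) : ZMod p) + k) := by
    rw [← Finset.sum_add_distrib, ← Finset.sum_add_distrib, ← Finset.sum_congr rfl hsplit,
      Finset.sum_const, Finset.card_range, nsmul_eq_mul]
  have hedge : ∀ (m : ℕ → ℕ) (M' : ℕ → ZMod p), (∀ r, r < R → m r ≤ R) →
      ‖∑ r ∈ Finset.range R, ∑ k ∈ Finset.range (m r), F (M' r + k)‖ ≤ R * E := by
    intro m M' hm
    refine (norm_sum_le _ _).trans ((Finset.sum_le_card_nsmul _ _ E fun r hr => ?_).trans ?_)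
    · exact hE _ _ (hm r (Finset.mem_range.1 hr))
    · rw [Finset.card_range, nsmul_eq_mul]
  have h1 : R * ‖I‖ ≤ R * (2 * E + t) := by
    have e1 := hedge (fun r => r) (fun _ => M) (fun r hr => hr.le)
    have e2 := hedge (fun r => R - r) (fun r => M + ((r + (L - R) : ℕ) : ZMod p))
      (fun r _ => Nat.sub_le R r)
    rw [← Complex.norm_natCast R, ← norm_mul, hsum, Complex.norm_natCast]
    refine (norm_add_le _ _).trans ?_
    have e3 := norm_add_le (∑ r ∈ Finset.range R, ∑ k ∈ Finset.range r, F (M + k))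
      (∑ r ∈ Finset.range R, ∑ k ∈ Finset.range (L - R), F (M + r + k))
    linarith
  exact le_of_mul_le_mul_left h1 hRr

end LongIntervals

/-! ### Application to Heilbronn sums. -/

section HeilbronnSums

variable {p : ℕ} [Fact p.Prime]

lemma stdAddChar_timesP (c : ZMod p) :
    (ZMod.stdAddChar (timesP p c) : ℂ) = ZMod.stdAddChar c := by
  obtain ⟨n, rfl⟩ := exists_intCast_eq c
  have hp : (p : ℂ) ≠ 0 := by exact_mod_cast (Fact.out : p.Prime).ne_zero
  have h : timesP p (n : ZMod p) = ((p * n : ℤ) : ZMod (p ^ 2)) := by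
    rw [← mul_intCast_eq_timesP]
    push_cast
    rfl
  rw [h, ZMod.stdAddChar_coe, ZMod.stdAddChar_coe]
  congr 1
  push_cast
  field_simp

/-- The summand of the Heilbronn sum, with the multiples of `p` removed. -/
noncomputable def heilbronnTerm (p : ℕ) [Fact p.Prime] (a : ZMod (p ^ 2)) (u : ZMod p) : ℂ :=
  if u = 0 then 0 else ZMod.stdAddChar (a * teich p u)

/-- Since `teich u` reduces to `u`, the character `e(bu/p)` equals `e(p b teich(u) / p^2)`, and the
twist is absorbed into the frequency. -/
lemma fourierSum_heilbronnTerm (a : ZMod (p ^ 2)) (b : ZMod p) :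
    fourierSum (heilbronnTerm p a) b = powerSum p (a + timesP p b) := by
  unfold fourierSum powerSum
  rw [← Finset.add_sum_erase _ _ (Finset.mem_univ (0 : ZMod p))]
  have h0 : heilbronnTerm p a 0 = 0 := if_pos rfl
  rw [h0, zero_mul, zero_add]
  symm
  refine Finset.sum_bij' (fun w _ => (w : ZMod p))
    (fun w hw => Units.mk0 w (Finset.ne_of_mem_erase hw)) ?_ ?_ ?_ ?_ ?_
  · intro w _
    exact Finset.mem_erase.2 ⟨w.ne_zero, Finset.mem_univ _⟩
  · intro w _
    exact Finset.mem_univ _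
  · intro w _
    exact Units.ext rfl
  · intro w _
    rfl
  · intro w _
    unfold heilbronnTerm
    rw [if_neg w.ne_zero, ← stdAddChar_timesP (b * (w : ZMod p)), ← AddChar.map_add_eq_mul]
    congr 1
    have h := mul_timesP (p := p) (teich p w) b
    rw [redP_teich] at h
    rw [add_mul, mul_comm (timesP p b), h, mul_comm b]

lemma norm_short_heilbronn_sum_le (hp : 25600 ≤ p) {a : ZMod (p ^ 2)} (ha : redP p a ≠ 0)
    (M : ZMod p) {L : ℕ} (hL : 16 * L ≤ p) :
    ‖∑ k ∈ Finset.range L, heilbronnTerm p a (M + k)‖ ^ 8 ≤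
      20000 ^ 8 * ((L : ℝ) ^ 3 * (p : ℝ) ^ 4 * Real.log p) := by
  have hlog := one_le_log_of_le hp
  have hp0 : (0 : ℝ) < p := by exact_mod_cast (Fact.out : p.Prime).pos
  have h := norm_short_interval_sum_pow_le (F := heilbronnTerm p a)
    (E := 50331648014 * (√p ^ 7 * √(Real.log p))) (fun h θ h0 hh hθ => ?_) M hL
  · refine h.trans ?_
    have e1 : (50331648014 * (√(p : ℝ) ^ 7 * √(Real.log p))) ^ 2 =
        50331648014 ^ 2 * ((p : ℝ) ^ 7 * Real.log p) := by
      rw [mul_pow, mul_pow, Real.sq_sqrt (by linarith), ← pow_mul, mul_comm 7 2, pow_mul,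
        Real.sq_sqrt hp0.le]
    rw [e1]
    calc 43904 ^ 2 * 32 * ((L : ℝ) ^ 3 / (p : ℝ) ^ 3) *
          (50331648014 ^ 2 * ((p : ℝ) ^ 7 * Real.log p))
        = (43904 ^ 2 * 32 * 50331648014 ^ 2) * ((L : ℝ) ^ 3 * (p : ℝ) ^ 4 * Real.log p) := by
          field_simp
      _ ≤ 20000 ^ 8 * ((L : ℝ) ^ 3 * (p : ℝ) ^ 4 * Real.log p) := by
          gcongr
          norm_num
  · simp_rw [fourierSum_heilbronnTerm]
    refine (sum_norm_shifted_pow_four_le hp ha h0 hh hθ).trans (le_of_eq ?_)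
    ring

/-- Heilbronn sums over intervals of length at most `p`, in terms of
`q = p ^ (1/36)`, `v = L ^ (1/8)` and `l = (log p) ^ (1/24)`. -/
lemma norm_heilbronn_sum_le (hp : 2 ^ 36 ≤ p) {a : ZMod (p ^ 2)} (ha : redP p a ≠ 0)
    (M : ZMod p) {L : ℕ} (hLp : L ≤ p) {q v l : ℝ} (hq0 : 0 ≤ q) (hq : q ^ 36 = p)
    (hv0 : 0 ≤ v) (hv : v ^ 8 = L) (hl0 : 0 ≤ l) (hl : l ^ 24 = Real.log p) :
    ‖∑ k ∈ Finset.range L, heilbronnTerm p a (M + k)‖ ≤ 41000 * (q ^ 22 * v ^ 2 * l ^ 4) := by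
  have hp' : 25600 ≤ p := le_trans (by norm_num) hp
  have hlog := one_le_log_of_le hp'
  have hl1 : 1 ≤ l := by
    rw [← hl] at hlog
    exact (one_le_pow_iff_of_nonneg hl0 (by norm_num)).1 hlog
  have hq2 : 2 ≤ q := by
    refine (pow_le_pow_iff_left₀ (by norm_num) hq0 (n := 36) (by norm_num)).1 ?_
    rw [hq]
    exact_mod_cast hp
  have hq16 : 16 ≤ q ^ 4 := by
    calc (16 : ℝ) = 2 ^ 4 := by norm_num
      _ ≤ q ^ 4 := by gcongr
  -- Lengths up to `p^(8/9)` are short intervals because `p^(1/9) ≥ 16`, that is `p ≥ 2^36`.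
  have h16 : ∀ m : ℕ, (m : ℝ) ≤ q ^ 32 → 16 * m ≤ p := by
    intro m hm
    have : (16 : ℝ) * m ≤ p := by
      rw [← hq]
      calc (16 : ℝ) * m ≤ q ^ 4 * q ^ 32 := by gcongr
        _ = q ^ 36 := by ring
    exact_mod_cast this
  rcases le_or_gt (L : ℝ) (q ^ 32) with hLq | hLq
  · have hvq : v ≤ q ^ 4 := by
      refine (pow_le_pow_iff_left₀ hv0 (by positivity) (n := 8) (by norm_num)).1 ?_
      rw [hv, ← pow_mul]
      exact hLq
    have h1 : ‖∑ k ∈ Finset.range L, heilbronnTerm p a (M + k)‖ ≤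
        20000 * (v ^ 3 * q ^ 18 * l ^ 3) := by
      refine (pow_le_pow_iff_left₀ (norm_nonneg _) (by positivity) (n := 8) (by norm_num)).1 ?_
      refine (norm_short_heilbronn_sum_le hp' ha M (h16 L hLq)).trans (le_of_eq ?_)
      rw [← hl, ← hq, ← hv]
      ring
    refine h1.trans ?_
    calc 20000 * (v ^ 3 * q ^ 18 * l ^ 3) = 20000 * (v * (v ^ 2 * q ^ 18) * (l ^ 3 * 1)) := by ring
      _ ≤ 41000 * (q ^ 4 * (v ^ 2 * q ^ 18) * (l ^ 3 * l)) := by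
          gcongr
          norm_num
      _ = 41000 * (q ^ 22 * v ^ 2 * l ^ 4) := by ring
  · have hvq : q ^ 4 ≤ v := by
      refine (pow_le_pow_iff_left₀ (by positivity) hv0 (n := 8) (by norm_num)).1 ?_
      rw [hv, ← pow_mul]
      exact hLq.le
    -- At `R ≈ p^(8/9)` the edge sums have size `R^(3/8) p^(1/2) = p^(5/6)` apart from logarithms,
    -- at most `p^(11/18) L^(1/4)` as `L > R`; the middle has size `p^(5/6) (L/R)^(1/4) = p^(11/18)
    -- L^(1/4)`.
    set R := ⌊q ^ 32⌋₊ with hR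
    have hRle : (R : ℝ) ≤ q ^ 32 := Nat.floor_le (by positivity)
    have hq1 : 1 ≤ q ^ 32 := one_le_pow₀ (by linarith)
    have hR0 : 0 < R := Nat.floor_pos.2 hq1
    have hRge : q ^ 32 ≤ 2 * R := by
      have h1 := Nat.lt_floor_add_one (q ^ 32)
      have h2 : (1 : ℝ) ≤ R := by exact_mod_cast hR0
      rw [← hR] at h1
      linarith
    have hRL : R < L := by
      have : (R : ℝ) < L := hRle.trans_lt hLq
      exact_mod_cast this
    have hS : ∀ b, ‖fourierSum (heilbronnTerm p a) b‖ ≤ 64 * (q ^ 30 * l ^ 4) := by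
      intro b
      rw [fourierSum_heilbronnTerm]
      refine (pow_le_pow_iff_left₀ (norm_nonneg _) (by positivity) (n := 6) (by norm_num)).1 ?_
      refine (norm_powerSum_pow_six_le_log hp' (by rwa [redP_add_timesP])).trans ?_
      calc 25165824001 * (p : ℝ) ^ 5 * Real.log p = 25165824001 * (q ^ 180 * l ^ 24) := by
            rw [← hl, ← hq]
            ring
        _ ≤ 64 ^ 6 * (q ^ 180 * l ^ 24) := by
            gcongr
            norm_num
        _ = (64 * (q ^ 30 * l ^ 4)) ^ 6 := by ring
    have hE : ∀ (M' : ZMod p) (m : ℕ), m ≤ R →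
        ‖∑ k ∈ Finset.range m, heilbronnTerm p a (M' + k)‖ ≤ 20000 * (q ^ 30 * l ^ 4) := by
      intro M' m hm
      have hmq : (m : ℝ) ≤ q ^ 32 := le_trans (by exact_mod_cast hm) hRle
      refine (pow_le_pow_iff_left₀ (norm_nonneg _) (by positivity) (n := 8) (by norm_num)).1 ?_
      refine (norm_short_heilbronn_sum_le hp' ha M' (h16 m hmq)).trans ?_
      calc 20000 ^ 8 * ((m : ℝ) ^ 3 * (p : ℝ) ^ 4 * Real.log p)
          ≤ 20000 ^ 8 * ((q ^ 32) ^ 3 * (p : ℝ) ^ 4 * Real.log p) := by gcongr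
        _ = 20000 ^ 8 * (q ^ 240 * (l ^ 24 * 1)) := by
            rw [← hl, ← hq]
            ring
        _ ≤ 20000 ^ 8 * (q ^ 240 * (l ^ 24 * l ^ 8)) := by
            gcongr
            exact one_le_pow₀ hl1
        _ = (20000 * (q ^ 30 * l ^ 4)) ^ 8 := by ring
    -- Here `576 = 9 * 64` and `2 * 2744 ≤ 9^4`, the factor 2 coming from the floor in `R`. Then `2
    -- * 20000 + 576 ≤ 41000`.
    have ht : 2744 * (64 * (q ^ 30 * l ^ 4)) ^ 4 * L ≤ (576 * (q ^ 22 * v ^ 2 * l ^ 4)) ^ 4 * R := by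
      calc 2744 * (64 * (q ^ 30 * l ^ 4)) ^ 4 * L
          = 2744 * 64 ^ 4 * (q ^ 88 * v ^ 8 * l ^ 16) * q ^ 32 := by
            rw [← hv]
            ring
        _ ≤ 2744 * 64 ^ 4 * (q ^ 88 * v ^ 8 * l ^ 16) * (2 * R) := by gcongr
        _ = (5488 * 64 ^ 4) * ((q ^ 88 * v ^ 8 * l ^ 16) * R) := by ring
        _ ≤ 576 ^ 4 * ((q ^ 88 * v ^ 8 * l ^ 16) * R) := by
            gcongr
            norm_num
        _ = (576 * (q ^ 22 * v ^ 2 * l ^ 4)) ^ 4 * R := by ring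
    have h1 := norm_long_interval_sum_le hS hR0 hRL hLp hE (by positivity) ht M
    refine h1.trans ?_
    have h2 : q ^ 30 * l ^ 4 ≤ q ^ 22 * v ^ 2 * l ^ 4 := by
      calc q ^ 30 * l ^ 4 = q ^ 22 * (q ^ 4) ^ 2 * l ^ 4 := by ring
        _ ≤ q ^ 22 * v ^ 2 * l ^ 4 := by gcongr
    have h3 : 0 ≤ q ^ 22 * v ^ 2 * l ^ 4 := by positivity
    linarith

lemma e_eq_stdAddChar (a : ℤ) (n : ℕ) :
    Heilbronn.e ((a : ℝ) * (n : ℝ) ^ p / (p : ℝ) ^ 2) =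
      ZMod.stdAddChar ((a : ZMod (p ^ 2)) * teich p n) := by
  have h := intCast_pow_eq_teich (p := p) n
  rw [Int.cast_natCast, Int.cast_natCast] at h
  have h2 : (a : ZMod (p ^ 2)) * teich p n = ((a * (n : ℤ) ^ p : ℤ) : ZMod (p ^ 2)) := by
    rw [← h]
    push_cast
    rfl
  rw [h2, ZMod.stdAddChar_coe]
  unfold Heilbronn.e
  congr 1
  push_cast
  ring

lemma sum_range_ite_eq_zero_le (M : ZMod p) {N : ℕ} (hN : N ≤ p) :
    ∑ k ∈ Finset.range N, (if M + k = 0 then (1 : ℝ) else 0) ≤ 1 := by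
  rw [sum_range_natCast_eq hN fun z : ZMod p => if M + z = 0 then (1 : ℝ) else 0]
  calc ∑ z : ZMod p, (if z.val < N then (if M + z = 0 then (1 : ℝ) else 0) else 0)
      ≤ ∑ z : ZMod p, if z = -M then (1 : ℝ) else 0 := by
        refine Finset.sum_le_sum fun z _ => ?_
        simp only [eq_neg_iff_add_eq_zero, add_comm z M]
        split_ifs <;> norm_num
    _ = 1 := by
        rw [Finset.sum_ite_eq' Finset.univ (-M), if_pos (Finset.mem_univ _)]

/-- The sum has `N + 1` terms. The last one and the at most one multiple of `p` among the others
each cost 1. -/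
lemma norm_incompleteSum_le (a : ℤ) (M : ℕ) {N : ℕ} (hN : N ≤ p) :
    ‖Heilbronn.incompleteSum p a M N‖ ≤
      ‖∑ k ∈ Finset.range N, heilbronnTerm p (a : ZMod (p ^ 2)) ((M : ZMod p) + k)‖ + 2 := by
  have h1 : Heilbronn.incompleteSum p a M N = ∑ k ∈ Finset.range (N + 1),
      (ZMod.stdAddChar ((a : ZMod (p ^ 2)) * teich p ((M : ZMod p) + k)) : ℂ) := by
    unfold Heilbronn.incompleteSum
    rw [← Finset.Ico_add_one_right_eq_Icc, Finset.sum_Ico_eq_sum_range]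
    have h2 : M + N + 1 - M = N + 1 := by omega
    rw [h2]
    refine Finset.sum_congr rfl fun k _ => ?_
    rw [e_eq_stdAddChar]
    push_cast
    rfl
  have h3 : ∀ u : ZMod p, (ZMod.stdAddChar ((a : ZMod (p ^ 2)) * teich p u) : ℂ) =
      heilbronnTerm p (a : ZMod (p ^ 2)) u + ((if u = 0 then (1 : ℝ) else 0 : ℝ) : ℂ) := by
    intro u
    unfold heilbronnTerm
    split_ifs with hu
    · rw [hu, teich_zero, mul_zero, AddChar.map_zero_eq_one]
      simp
    · simp
  rw [h1, Finset.sum_range_succ]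
  simp_rw [h3 ((M : ZMod p) + _)]
  rw [Finset.sum_add_distrib, ← h3, ← Complex.ofReal_sum]
  refine (norm_add_le _ _).trans ?_
  rw [norm_stdAddChar]
  have h4 := norm_add_le
    (∑ k ∈ Finset.range N, heilbronnTerm p (a : ZMod (p ^ 2)) ((M : ZMod p) + k))
    ((∑ k ∈ Finset.range N, (if (M : ZMod p) + k = 0 then (1 : ℝ) else 0) : ℝ) : ℂ)
  have h5 : ‖((∑ k ∈ Finset.range N, (if (M : ZMod p) + k = 0 then (1 : ℝ) else 0) : ℝ) : ℂ)‖ ≤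
      1 := by
    rw [Complex.norm_real, Real.norm_of_nonneg
      (Finset.sum_nonneg fun k _ => by split_ifs <;> norm_num)]
    exact sum_range_ite_eq_zero_le (M : ZMod p) hN
  linarith

end HeilbronnSums

/-! ### Small primes by the trivial bound, and the conclusion. -/

lemma norm_incompleteSum_le_card (p : ℕ) (a : ℤ) (M N : ℕ) :
    ‖Heilbronn.incompleteSum p a M N‖ ≤ N + 1 := by
  unfold Heilbronn.incompleteSum
  refine (norm_sum_le _ _).trans ((Finset.sum_le_card_nsmul _ _ 1 fun n _ => ?_).trans ?_)
  · unfold Heilbronn.e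
    rw [show ∀ x : ℝ, 2 * (Real.pi : ℂ) * Complex.I * (x : ℂ) =
      ((2 * Real.pi * x : ℝ) : ℂ) * Complex.I from fun x => by push_cast; ring,
      Complex.norm_exp_ofReal_mul_I]
  · rw [Nat.card_Icc, nsmul_eq_mul, mul_one]
    exact_mod_cast (by omega : M + N + 1 - M ≤ N + 1)

lemma norm_incompleteSum_le_rpow (p : ℕ) (a : ℤ) (M N : ℕ) (hp : p.Prime)
    (ha : ¬ ((p : ℤ) ∣ a)) (hN1 : 1 ≤ N) (hNp : N ≤ p) :
    ‖Heilbronn.incompleteSum p a M N‖ ≤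
      2 ^ 38 * ((p : ℝ) ^ ((11 : ℝ) / 18) * (N : ℝ) ^ ((1 : ℝ) / 4) *
        Real.log (p : ℝ) ^ ((1 : ℝ) / 6)) := by
  have : Fact p.Prime := ⟨hp⟩
  have hp1 : (1 : ℝ) ≤ p := by exact_mod_cast hp.one_le
  have hN1' : (1 : ℝ) ≤ N := by exact_mod_cast hN1
  -- Below the threshold the trivial bound `N + 1 ≤ 2^37` suffices, since the logarithmic factor is
  -- at least `1/2` even at `p = 2`; hence the constant `2^38`.
  rcases lt_or_ge p (2 ^ 36) with hlt | hge
  · have h1 := norm_incompleteSum_le_card p a M N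
    have h2 : (N : ℝ) + 1 ≤ 2 ^ 37 := by exact_mod_cast (by omega : N + 1 ≤ 2 ^ 37)
    have hlog2 : 1 / 2 ≤ Real.log p ^ ((1 : ℝ) / 6) := by
      have h3 : Real.log 2 ≤ Real.log p :=
        Real.log_le_log (by norm_num) (by exact_mod_cast hp.two_le)
      have h4 := Real.log_two_gt_d9
      have h5 := Real.log_two_lt_d9
      calc (1 : ℝ) / 2 ≤ Real.log 2 := by linarith
        _ = Real.log 2 ^ (1 : ℝ) := (Real.rpow_one _).symm
        _ ≤ Real.log 2 ^ ((1 : ℝ) / 6) :=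
          Real.rpow_le_rpow_of_exponent_ge (by linarith) (by linarith) (by norm_num)
        _ ≤ Real.log p ^ ((1 : ℝ) / 6) := by
          refine Real.rpow_le_rpow (by linarith) h3 (by norm_num)
    have h6 : 1 ≤ (p : ℝ) ^ ((11 : ℝ) / 18) := Real.one_le_rpow hp1 (by norm_num)
    have h7 : 1 ≤ (N : ℝ) ^ ((1 : ℝ) / 4) := Real.one_le_rpow hN1' (by norm_num)
    have h8 : 1 * 1 * (1 / 2) ≤ (p : ℝ) ^ ((11 : ℝ) / 18) * (N : ℝ) ^ ((1 : ℝ) / 4) *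
        Real.log (p : ℝ) ^ ((1 : ℝ) / 6) := by gcongr
    linarith
  · have hlog := one_le_log_of_le (p := p) (le_trans (by norm_num) hge)
    have hred : redP p (a : ZMod (p ^ 2)) ≠ 0 := by
      rw [map_intCast]
      exact fun h => ha ((ZMod.intCast_zmod_eq_zero_iff_dvd _ _).1 h)
    have hpw : ∀ (x : ℝ) (n m : ℕ), 0 ≤ x → (x ^ ((1 : ℝ) / n)) ^ m = x ^ ((m : ℝ) / n) := by
      intro x n m hx
      rw [← Real.rpow_natCast, ← Real.rpow_mul hx]
      congr 1
      ring
    have h1 := norm_heilbronn_sum_le hge hred (M : ZMod p) hNp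
      (q := (p : ℝ) ^ ((1 : ℝ) / (36 : ℕ))) (v := (N : ℝ) ^ ((1 : ℝ) / (8 : ℕ)))
      (l := Real.log p ^ ((1 : ℝ) / (24 : ℕ)))
      (by positivity) (by rw [hpw _ _ _ (by positivity)]; norm_num)
      (by positivity) (by rw [hpw _ _ _ (by positivity)]; norm_num)
      (by positivity) (by rw [hpw _ _ _ (by linarith)]; norm_num)
    rw [hpw _ _ _ (by positivity), hpw _ _ _ (by positivity), hpw _ _ _ (by linarith)] at h1
    have e1 : ((22 : ℕ) : ℝ) / (36 : ℕ) = 11 / 18 := by norm_num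
    have e2 : ((2 : ℕ) : ℝ) / (8 : ℕ) = 1 / 4 := by norm_num
    have e3 : ((4 : ℕ) : ℝ) / (24 : ℕ) = 1 / 6 := by norm_num
    rw [e1, e2, e3] at h1
    have h2 := norm_incompleteSum_le (p := p) a M hNp
    have h6 : 1 ≤ (p : ℝ) ^ ((11 : ℝ) / 18) := Real.one_le_rpow hp1 (by norm_num)
    have h7 : 1 ≤ (N : ℝ) ^ ((1 : ℝ) / 4) := Real.one_le_rpow hN1' (by norm_num)
    have h9 : 1 ≤ Real.log p ^ ((1 : ℝ) / 6) := Real.one_le_rpow hlog (by norm_num)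
    have h8 : 1 * 1 * 1 ≤ (p : ℝ) ^ ((11 : ℝ) / 18) * (N : ℝ) ^ ((1 : ℝ) / 4) *
        Real.log (p : ℝ) ^ ((1 : ℝ) / 6) := by gcongr
    linarith

theorem mainTheorem1 :
    (∃ C : ℝ, 0 < C ∧ ∀ (p : ℕ) (a : ℤ) (M N : ℕ), p.Prime → ¬ ((p : ℤ) ∣ a) →
        1 ≤ M → 1 ≤ N → N ≤ p →
        ‖Heilbronn.incompleteSum p a M N‖ ≤
          C * ((p : ℝ) ^ ((11 : ℝ) / 18) * (N : ℝ) ^ ((1 : ℝ) / 4) *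
            Real.log (p : ℝ) ^ ((1 : ℝ) / 6))) ∧
    (∃ C : ℝ, 0 < C ∧ ∀ (p : ℕ) (a : ℤ), p.Prime → ¬ ((p : ℤ) ∣ a) →
        ‖Heilbronn.completeSum p a‖ ≤
          C * ((p : ℝ) ^ ((31 : ℝ) / 36) * Real.log (p : ℝ) ^ ((1 : ℝ) / 6))) := by
  refine ⟨⟨2 ^ 38, by norm_num, fun p a M N hp ha _ hN hNp =>
    norm_incompleteSum_le_rpow p a M N hp ha hN hNp⟩, 2 ^ 38, by norm_num, fun p a hp ha => ?_⟩
  have hp0 : (0 : ℝ) < p := by exact_mod_cast hp.pos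
  -- Both endpoints count in the incomplete sum, so the complete one has `M = 1` and `N = p - 1`;
  -- this `N` is at least 1 since `p ≥ 2`. The exponent is `11/18 + 1/4 = 31/36`.
  have h1 : Heilbronn.completeSum p a = Heilbronn.incompleteSum p a 1 (p - 1) := by
    unfold Heilbronn.completeSum Heilbronn.incompleteSum
    rw [Nat.add_sub_cancel' hp.one_le]
  rw [h1]
  refine (norm_incompleteSum_le_rpow p a 1 (p - 1) hp ha
    (by have := hp.two_le; omega) (Nat.sub_le _ _)).trans ?_
  have h2 : (p : ℝ) ^ ((31 : ℝ) / 36) = (p : ℝ) ^ ((11 : ℝ) / 18) * (p : ℝ) ^ ((1 : ℝ) / 4) := by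
    rw [← Real.rpow_add hp0]
    norm_num
  rw [h2]
  have h3 : ((p - 1 : ℕ) : ℝ) ≤ p := by exact_mod_cast Nat.sub_le p 1
  have h4 : 0 ≤ Real.log p := Real.log_nonneg (by exact_mod_cast hp.one_le)
  gcongr
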